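/- Let $S^1=\mathbb{R}/2\pi\mathbb{Z}$ with its quotient distance $d$, let $f:S^1\to S^1$ be smooth, let $\sigma:S^1\to(0,\infty)$ be smooth, and for $\varepsilon>0$ let $X_{n+1}=f(X_n)+\varepsilon\,\sigma(X_n)\chi_n \pmod{2\pi}$ with $\chi_n$ i.i.d. standard normal. Assume that $f$ has fixed points $x_s,x_u$ with $|f'(x_s)|<1$ and $|c_u|>1$, where $c_u:=f'(x_u)$, and that $f^n(x)\to x_s$ for every $x\neq x_u$. Let $V_1=\{x: d(x,x_u)<\delta_u\}$, $\delta_u>0$, be any ball that does not contain $x_s$ and for which there is $\eta>0$ with $d(f(x),V_1)>\eta$ for all $x\notin V_1$. Let $B(V_1)$ be the space of bounded Borel functions $V_1\to\mathbb{C}$ and let $T_{11}^\varepsilon$ be the operator on $B(V_1)$ given by $$T_{11}^\varepsilon\phi(x)=\mathbb{E}\big[(\phi\mathbf 1_{V_1})(f(x)+\varepsilon\sigma(x)\chi)\big],\qquad x\in V_1,\ \chi\sim N(0,1).$$ Let $\beta=\sqrt{(c_u^2-1)/(2\sigma(x_u)^2)}$ and $h_j(x)=e^{-x^2}H_j(x)$,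 where $H_j$ are the Hermite polynomials, $\sum_j H_j(x)z^j/j!=e^{2xz-z^2}$. Then for every $r>0$ there are constants $\varepsilon_r,L_r,K_r,k>0$ such that for every $0<\varepsilon<\varepsilon_r$ there are numbers $\lambda_{j,1}^\varepsilon\in\mathbb{C}$ and functions $\psi_j^\varepsilon:\mathbb{R}\to\mathbb{C}$, $j=0,1,2,\dots$, with $$|\lambda_{j,1}^\varepsilon|\le L_r,\qquad \sup_{y\in\mathbb{R}}|\psi_j^\varepsilon(y)|e^{ky^2}\le K_r\qquad\text{for all } j\ge 0,$$ with the following property. Every eigenvalue $\lambda$ of $T_{11}^\varepsilon$ in $B(V_1)$ with $|\lambda|>r$ is simple (it has algebraic multiplicity one), and there is a $j\ge0$ such that $$\lambda=|c_u|^{-1}c_u^{-j}+\varepsilon\lambda_{j,1}^\varepsilon$$ and all eigenfunctions of $T_{11}^\varepsilon$ for $\lambda$ are (complex) multiples of $$\Big[h_j\Big(\frac{\beta(x-x_u)}{\varepsilon}\Big)+\varepsilon\psi_j^\varepsilon\Big(\frac{x-x_u}{\varepsilon}\Big)\Big]\mathbf 1_{V_1}(x),$$ where $x-x_u$ is read as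 its representative in $(-\pi,\pi)$. -/

import Mathlib

open MeasureTheory ProbabilityTheory
open scoped ContDiff

noncomputable section

instance fact_two_pi_pos : Fact (0 < 2 * Real.pi) := ⟨Real.two_pi_pos⟩

/-- The circle `ℝ / 2πℤ`; its distance is the quotient distance. -/
abbrev S1 : Type := AddCircle (2 * Real.pi)

/-- The representative in `(-π, π]` of a point of the circle. The difference of two points `x`, `a`
of the circle that are at distance less than `π` is read as the real number `signedRep (x - a)`. -/
def signedRep (x : S1) : ℝ := (AddCircle.equivIoc (2 * Real.pi) (-Real.pi) x : ℝ)

/-- The derivative at `x` of a self-map of the circle, in the coordinates given by arc length. -/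
def circleDeriv (f : S1 → S1) (x : S1) : ℝ :=
  deriv (fun s : ℝ => signedRep (f (x + (s : S1)) - f x)) 0

/-- The data of the chain `X_{n+1} = f (X_n) + ε σ(X_n) χ_n mod 2π`: a smooth map `f` of the circle
(that is, one with a smooth lift to `ℝ`) and a smooth positive noise intensity `σ` on the circle
(bounded above and away from zero, the circle being compact). -/
structure NoisyCircleMap where
  f : S1 → S1
  σ : S1 → ℝ
  smooth_f : ∃ F : ℝ → ℝ, ContDiff ℝ ∞ F ∧ ∀ t : ℝ, f (t : S1) = ((F t : ℝ) : S1)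
  smooth_σ : ContDiff ℝ ∞ (fun t : ℝ => σ (t : S1))
  σ_pos : ∀ x, 0 < σ x

namespace NoisyCircleMap

theorem continuous_f (S : NoisyCircleMap) : Continuous S.f := by
  obtain ⟨F, hF, h⟩ := S.smooth_f
  have hq : Topology.IsQuotientMap (fun t : ℝ => (t : S1)) := isQuotientMap_quotient_mk'
  refine hq.continuous_iff.2 ?_
  have : S.f ∘ (fun t : ℝ => (t : S1)) = fun t => ((F t : ℝ) : S1) := funext h
  rw [this]
  exact (AddCircle.continuous_mk' _).comp hF.continuous

theorem continuous_σ (S : NoisyCircleMap) : Continuous S.σ := by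
  have hq : Topology.IsQuotientMap (fun t : ℝ => (t : S1)) := isQuotientMap_quotient_mk'
  exact hq.continuous_iff.2 S.smooth_σ.continuous

/-- The position after one step from `x` when the normal variable takes the value `z`. -/
def step (S : NoisyCircleMap) (ε : ℝ) (x : S1) (z : ℝ) : S1 :=
  S.f x + ((ε * S.σ x * z : ℝ) : S1)

theorem measurable_step (S : NoisyCircleMap) (ε : ℝ) :
    Measurable (fun p : S1 × ℝ => S.step ε p.1 p.2) := by
  have h1 := S.continuous_f
  have h2 := S.continuous_σ
  have h3 : Continuous (fun t : ℝ => (t : S1)) := AddCircle.continuous_mk' _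
  have h4 : Measurable (fun p : S1 × ℝ => S.f p.1) := h1.measurable.comp measurable_fst
  have h5 : Measurable (fun p : S1 × ℝ => ((ε * S.σ p.1 * p.2 : ℝ) : S1)) :=
    h3.measurable.comp
      (((h2.measurable.comp measurable_fst).const_mul ε).mul measurable_snd)
  exact h4.add h5

end NoisyCircleMap

/-- `B(X)`: the (complex) vector space of bounded measurable functions on `X`. -/
def BddMeas (X : Type) [MeasurableSpace X] : Submodule ℂ (X → ℂ) where
  carrier := {φ | Measurable φ ∧ ∃ C : ℝ, ∀ x, ‖φ x‖ ≤ C}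
  add_mem' := by
    rintro φ ψ ⟨h1, C, hC⟩ ⟨h2, D, hD⟩
    exact ⟨h1.add h2, C + D, fun x => (norm_add_le _ _).trans (add_le_add (hC x) (hD x))⟩
  zero_mem' := ⟨measurable_const, 0, fun x => by simp⟩
  smul_mem' := by
    rintro c φ ⟨h1, C, hC⟩
    refine ⟨h1.const_smul c, ‖c‖ * C, fun x => ?_⟩
    rw [Pi.smul_apply, norm_smul]
    exact mul_le_mul_of_nonneg_left (hC x) (norm_nonneg c)

theorem NoisyCircleMap.integrable_step (S : NoisyCircleMap) (ε : ℝ) (φ : BddMeas S1) (x : S1) :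
    Integrable (fun z => φ.1 (S.step ε x z)) (gaussianReal 0 1) := by
  obtain ⟨h, C, hC⟩ := φ.2
  refine Integrable.of_bound (C := C) ?_ (Filter.Eventually.of_forall fun z => hC _)
  exact (h.comp ((S.measurable_step ε).comp
    (measurable_const.prodMk measurable_id))).aestronglyMeasurable

/-- The transition operator `T^ε φ (x) = E[φ (f (x) + ε σ(x) χ)]`, `χ` standard normal, on
`B(S1)`. -/
def NoisyCircleMap.transition (S : NoisyCircleMap) (ε : ℝ) : BddMeas S1 →ₗ[ℂ] BddMeas S1 where
  toFun φ := ⟨fun x => ∫ z, φ.1 (S.step ε x z) ∂(gaussianReal 0 1), by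
    obtain ⟨h, C, hC⟩ := φ.2
    refine ⟨?_, C, fun x => ?_⟩
    · have h1 : StronglyMeasurable (fun p : S1 × ℝ => φ.1 (S.step ε p.1 p.2)) :=
        (h.comp (S.measurable_step ε)).stronglyMeasurable
      exact h1.integral_prod_right'.measurable
    · have := norm_integral_le_of_norm_le_const (μ := gaussianReal 0 1)
        (Filter.Eventually.of_forall fun z => hC (S.step ε x z))
      simpa using this⟩
  map_add' φ ψ := by
    apply Subtype.ext
    funext x
    exact integral_add (S.integrable_step ε φ x) (S.integrable_step ε ψ x)
  map_smul' c φ := by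
    apply Subtype.ext
    funext x
    exact integral_const_mul c _

open Classical in
/-- Extension by zero `B(V) → B(S1)`. -/
def extendByZero (V : Set S1) (hV : MeasurableSet V) : BddMeas V →ₗ[ℂ] BddMeas S1 where
  toFun φ := ⟨fun x => if h : x ∈ V then φ.1 ⟨x, h⟩ else 0, by
    obtain ⟨h, C, hC⟩ := φ.2
    refine ⟨Measurable.dite (s := V) h measurable_const hV, max C 0, fun x => ?_⟩
    by_cases hx : x ∈ V
    · simpa [hx] using Or.inl (hC ⟨x, hx⟩)
    · simp [hx]⟩
  map_add' φ ψ := by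
    apply Subtype.ext
    funext x
    by_cases hx : x ∈ V <;> simp [hx]
  map_smul' c φ := by
    apply Subtype.ext
    funext x
    by_cases hx : x ∈ V <;> simp [hx]

/-- Restriction `B(S1) → B(V)`. -/
def restrictTo (V : Set S1) : BddMeas S1 →ₗ[ℂ] BddMeas V where
  toFun φ := ⟨fun x => φ.1 x.1, by
    obtain ⟨h, C, hC⟩ := φ.2
    exact ⟨h.comp measurable_subtype_coe, C, fun x => hC _⟩⟩
  map_add' _ _ := rfl
  map_smul' _ _ := rfl

/-- The block `φ ↦ 1_V(x) E[(φ 1_V)(f (x) + ε σ(x) χ)]` of the transition operator, as an operator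
on `B(V)`, for the open ball `V` of radius `δ` about `a`. -/
def NoisyCircleMap.localBlock (S : NoisyCircleMap) (ε : ℝ) (a : S1) (δ : ℝ) :
    Module.End ℂ (BddMeas (Metric.ball a δ)) :=
  restrictTo (Metric.ball a δ) ∘ₗ S.transition ε ∘ₗ
    extendByZero (Metric.ball a δ) measurableSet_ball

/-- `μ` is a simple eigenvalue of `T`: its algebraic multiplicity, the dimension of the space of
all generalized eigenvectors `⋃ₘ ker (T - μ)^m`, is one. -/
def IsSimpleEigenvalue {E : Type} [AddCommGroup E] [Module ℂ E] (T : Module.End ℂ E) (μ : ℂ) :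
    Prop :=
  T.HasEigenvalue μ ∧ Module.finrank ℂ (T.maxGenEigenspace μ) = 1

/-- The Hermite polynomials `H_n` with generating function `∑ H_n(x) z^n / n! = exp (2xz - z²)`. -/
def hermitePoly : ℕ → Polynomial ℝ
  | 0 => 1
  | n + 1 => 2 * Polynomial.X * hermitePoly n - Polynomial.derivative (hermitePoly n)

/-- The Hermite functions `h_n(x) = exp (-x²) H_n(x)`. -/
def hermiteFun (n : ℕ) (x : ℝ) : ℝ := Real.exp (-x ^ 2) * (hermitePoly n).eval x

end

/-! Put x = x_u + ε y. Near x_u the chain then looks like y ↦ c y + s χ with c = f'(x_u) and s =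
σ(x_u), so the block should resemble the operator `gaussOp c s`, v ↦ E v(c y + s χ), on the line.
Among decaying functions this operator has the right eigenfunctions h_j(βy) and the left
eigenfunctions H_j(βy), with eigenvalue |c|⁻¹c⁻ʲ (`gaussOp_scaledHermite`,
`hermitePairing_gaussOp`). No eigenvalue is constructed: the proof takes an eigenfunction of the
block and shows that it almost solves the limit problem and therefore almost is a Hermite function.

Rigidity of the limit problem. A function orthogonal to H_0, …, H_{J-1} is contracted by high powers
of `gaussOp` at a rate of order |c|^{-(J+1)} per step, because the Taylor polynomial of the kernel
integrates to zero against it (`exists_norm_gaussOp_le_of_orthogonal`). For large J this beats |μ| >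
r, so an approximate eigenfunction is, up to its error, a combination of h_0, …, h_{J-1}. Pairing
with H_j bounds |μ - λ_j| times the j-th coefficient by the error; since the λ_j are separated, a
single coefficient survives (`exists_hermite_dominates`).

Transfer to the circle (`exists_norm_gaussOp_lineLift_sub_le`). The error must be O(ε) in a weighted
norm whose constants do not depend on ε. For |εy| ≤ ρ/2 the true normal law is compared with its
linearisation. Farther out, the deterministic orbit leaves the ball within a fixed number of steps,
so the eigenfunction equation forces a size exp(-const/ε²). The weight `plateauWeight k q (ρ/ε)`
serves both regions: exp(-k y²) measures the linearisation error, its floor exp(-k ρ²/ε²) absorbs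
the exponentially small terms on the whole circle, and exp(-q y²) keeps it below a Gaussian
independent of ε.

Simplicity. Let φ be an eigenfunction near h_j, and let u solve T u = μ' u + b φ with μ' near λ_j.
Subtract the multiple of φ that kills the j-th coefficient. Pairing with H_j shows that the
remaining φ-term is O(ε), so the difference is an approximate eigenfunction without j-th
coefficient, hence zero. With μ' = μ this excludes Jordan chains and further eigenfunctions; with b
= 0 it excludes a second eigenvalue near λ_j (`exists_simple_structure`). -/

noncomputable section

/-! ### Gaussian expectations -/

/-- The standard normal law. -/
abbrev stdNormal : Measure ℝ := gaussianReal 0 1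

/-- The density of the normal law with mean `a` and standard deviation `s`. -/
def normalKernel (a s z : ℝ) : ℝ :=
  (Real.sqrt (2 * Real.pi) * s)⁻¹ * Real.exp (-(z - a) ^ 2 / (2 * s ^ 2))

theorem normalKernel_nonneg (a z : ℝ) {s : ℝ} (hs : 0 < s) : 0 ≤ normalKernel a s z := by
  unfold normalKernel; positivity

theorem continuous_normalKernel_uncurry (c s : ℝ) :
    Continuous (fun p : ℝ × ℝ => normalKernel (c * p.1) s p.2) := by
  unfold normalKernel; fun_prop

theorem integral_stdNormal_affine {E : Type*} [NormedAddCommGroup E] [NormedSpace ℝ E]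
    (v : ℝ → E) (a : ℝ) {s : ℝ} (hs : 0 < s) :
    ∫ z, v (a + s * z) ∂stdNormal = ∫ z, normalKernel a s z • v z := by
  have hm : (stdNormal.map (fun z => a + s * z)) = gaussianReal a (Real.toNNReal (s ^ 2)) := by
    have h1 : (fun z : ℝ => a + s * z) = (fun z => a + z) ∘ (fun z => s * z) := rfl
    rw [h1, ← Measure.map_map (by fun_prop) (by fun_prop), gaussianReal_map_const_mul,
      gaussianReal_map_const_add]
    congr 1
    · simp
    · ext; simp [sq_nonneg]
  have he : MeasurableEmbedding (fun z : ℝ => a + s * z) :=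
    ((Homeomorph.mulLeft₀ s hs.ne').trans (Homeomorph.addLeft a)).measurableEmbedding
  rw [← he.integral_map (μ := stdNormal) v, hm, integral_gaussianReal_eq_integral_smul]
  · congr 1; funext z
    congr 1
    unfold gaussianPDFReal normalKernel
    have h2 : Real.sqrt (2 * Real.pi * s ^ 2) = Real.sqrt (2 * Real.pi) * s := by
      rw [Real.sqrt_mul (by positivity), Real.sqrt_sq hs.le]
    simp [sq_nonneg, h2]
  · simp only [ne_eq, Real.toNNReal_eq_zero, not_le]; positivity

theorem integrable_stdNormal_affine {E : Type*} [NormedAddCommGroup E] [NormedSpace ℝ E]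
    {v : ℝ → E} (a s : ℝ) {C : ℝ} (hv : StronglyMeasurable v) (hC : ∀ y, ‖v y‖ ≤ C) :
    Integrable (fun z => v (a + s * z)) stdNormal :=
  Integrable.of_bound (C := C) (hv.comp_measurable (by fun_prop)).aestronglyMeasurable
    (Filter.Eventually.of_forall fun _ => hC _)

theorem integrable_exp_sq_div_four : Integrable (fun z : ℝ => Real.exp (z ^ 2 / 4)) stdNormal := by
  rw [stdNormal, gaussianReal_of_var_ne_zero 0 one_ne_zero]
  have h : Integrable (fun z : ℝ => (gaussianPDFReal 0 1 z) • Real.exp (z ^ 2 / 4)) := by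
    have h1 := (integrable_exp_neg_mul_sq (b := 1/4) (by norm_num)).const_mul
      ((Real.sqrt (2 * Real.pi * (1 : NNReal)))⁻¹)
    refine h1.congr (Filter.Eventually.of_forall fun z => ?_)
    simp only [gaussianPDFReal, smul_eq_mul]
    rw [mul_assoc _ (Real.exp _) (Real.exp _), ← Real.exp_add]
    congr 2
    push_cast; ring
  have := (integrable_withDensity_iff_integrable_smul₀ (μ := volume)
    (f := fun x => Real.toNNReal (gaussianPDFReal 0 1 x))
    (g := fun z : ℝ => Real.exp (z ^ 2 / 4))
    (by exact (measurable_gaussianPDFReal 0 1).real_toNNReal.aemeasurable)).2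
  refine this ?_
  refine h.congr (Filter.Eventually.of_forall fun z => ?_)
  simp only [NNReal.smul_def, Real.coe_toNNReal _ (gaussianPDFReal_nonneg 0 1 z)]

/-- The exponential moment `E exp (χ² / 4)` of a standard normal variable. -/
def normalExpMoment : ℝ := ∫ z, Real.exp (z ^ 2 / 4) ∂stdNormal

theorem one_le_normalExpMoment : 1 ≤ normalExpMoment := by
  have h : ∫ _z, (1 : ℝ) ∂stdNormal ≤ normalExpMoment := by
    refine integral_mono (integrable_const _) integrable_exp_sq_div_four fun z => ?_
    exact Real.one_le_exp (by positivity)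
  simpa using h

/-- Bound an expectation by a multiple of `E exp (χ² / 4)` plus a constant. -/
theorem norm_integral_stdNormal_le {E : Type*} [NormedAddCommGroup E] [NormedSpace ℝ E]
    (g : ℝ → E) {A D : ℝ} (h : ∀ z, ‖g z‖ ≤ A * Real.exp (z ^ 2 / 4) + D) :
    ‖∫ z, g z ∂stdNormal‖ ≤ A * normalExpMoment + D := by
  refine (norm_integral_le_of_norm_le
    ((integrable_exp_sq_div_four.const_mul A).add (integrable_const D))
    (Filter.Eventually.of_forall h)).trans (le_of_eq ?_)
  simp only [Pi.add_apply]
  rw [integral_add (integrable_exp_sq_div_four.const_mul A) (integrable_const D),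
    integral_const_mul]
  simp [normalExpMoment]

/-- The expectation operator `v ↦ E v (c y + s χ)`. -/
def gaussOp (c s : ℝ) (v : ℝ → ℂ) (y : ℝ) : ℂ := ∫ z, v (c * y + s * z) ∂stdNormal

theorem gaussOp_eq_kernel (c : ℝ) {s : ℝ} (hs : 0 < s) (v : ℝ → ℂ) (y : ℝ) :
    gaussOp c s v y = ∫ z, normalKernel (c * y) s z • v z :=
  integral_stdNormal_affine v (c * y) hs

theorem measurable_gaussOp (c s : ℝ) {v : ℝ → ℂ} (hv : Measurable v) :
    Measurable (gaussOp c s v) := by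
  have h1 : StronglyMeasurable (fun p : ℝ × ℝ => v (c * p.1 + s * p.2)) :=
    (hv.comp (by fun_prop)).stronglyMeasurable
  exact h1.integral_prod_right'.measurable

/-- Independent centred normals add up to a centred normal with the sum of the variances. This
closes the operators `gaussOp` under composition, so that their powers stay explicit. -/
theorem integral_stdNormal_prod {E : Type*} [NormedAddCommGroup E] [NormedSpace ℝ E]
    {v : ℝ → E} (hv : StronglyMeasurable v) {C : ℝ} (hC : ∀ y, ‖v y‖ ≤ C) (a p q r : ℝ)
    (hr : r ^ 2 = p ^ 2 + q ^ 2) :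
    ∫ x, ∫ z, v (a + p * x + q * z) ∂stdNormal ∂stdNormal = ∫ z, v (a + r * z) ∂stdNormal := by
  have hconv : (stdNormal.map (fun z => p * z)) ∗ (stdNormal.map (fun z => q * z))
      = stdNormal.map (fun z => r * z) := by
    rw [gaussianReal_map_const_mul, gaussianReal_map_const_mul, gaussianReal_map_const_mul,
      gaussianReal_conv_gaussianReal]
    congr 1
    · simp
    · ext; simp [hr]
  have hint : ∀ (μ : Measure ℝ) [IsFiniteMeasure μ] (b : ℝ), Integrable (fun z => v (b + z)) μ :=
    fun μ _ b => Integrable.of_bound (C := C)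
      (hv.comp_measurable (by fun_prop)).aestronglyMeasurable
      (Filter.Eventually.of_forall fun _ => hC _)
  have hsm : ∀ b : ℝ, StronglyMeasurable (fun z => v (b + z)) := fun b =>
    hv.comp_measurable (by fun_prop)
  have h1 : ∫ z, v (a + r * z) ∂stdNormal
      = ∫ z, v (a + z) ∂(stdNormal.map (fun z => r * z)) :=
    (integral_map (by fun_prop) (hsm a).aestronglyMeasurable).symm
  have hpm : IsProbabilityMeasure (stdNormal.map (fun z => p * z)) :=
    Measure.isProbabilityMeasure_map (by fun_prop)
  have hqm : IsProbabilityMeasure (stdNormal.map (fun z => q * z)) :=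
    Measure.isProbabilityMeasure_map (by fun_prop)
  rw [h1, ← hconv, integral_conv (hint _ a), integral_map (by fun_prop)]
  · congr 1; funext x
    rw [integral_map (by fun_prop)]
    · simp only [add_assoc]
    · have := (hsm (a + p * x))
      simp only [add_assoc] at this
      exact this.aestronglyMeasurable
  · have : StronglyMeasurable (fun w : ℝ × ℝ => v (a + (w.1 + w.2))) :=
      hv.comp_measurable (by fun_prop)
    exact this.integral_prod_right'.aestronglyMeasurable

theorem gaussOp_comp {v : ℝ → ℂ} (hv : Measurable v) {C : ℝ} (hC : ∀ y, ‖v y‖ ≤ C)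
    (c s c' s' r : ℝ) (hr : r ^ 2 = (c' * s) ^ 2 + s' ^ 2) :
    gaussOp c s (gaussOp c' s' v) = gaussOp (c' * c) r v := by
  funext y
  unfold gaussOp
  rw [← integral_stdNormal_prod hv.stronglyMeasurable hC (c' * c * y) (c' * s) s' r hr]
  congr 1; funext x
  congr 1; funext z
  congr 1; ring

/-- Shifting by noise of size at most `S|z|` costs at most the factor `exp (z² / 4)` in a
Gaussian weight, provided that the centre expands by the factor `b`. -/
theorem sq_weight_le {k b S D m z : ℝ} (hk : 0 < k) (hb : 1 + 4 * k * S ^ 2 ≤ b ^ 2)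
    (hb0 : 0 ≤ b) (hm : 0 ≤ m) (h : b * m ≤ D + S * |z|) :
    k * m ^ 2 ≤ k * D ^ 2 + z ^ 2 / 4 := by
  have h0 : 0 ≤ b * m := by positivity
  have h1 : (b * m) ^ 2 ≤ (D + S * |z|) ^ 2 := pow_le_pow_left₀ h0 h 2
  have h2 : k * (D + S * |z|) ^ 2 ≤ (1 + 4 * k * S ^ 2) * (k * D ^ 2 + z ^ 2 / 4) := by
    -- A quarter of this square is exactly the right side minus the left side.
    have : 0 ≤ (4 * k * S * D - |z|) ^ 2 := sq_nonneg _
    have hz : |z| ^ 2 = z ^ 2 := sq_abs z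
    nlinarith
  have h3 : 0 ≤ k * D ^ 2 + z ^ 2 / 4 := by positivity
  have hb2 : 0 < 1 + 4 * k * S ^ 2 := by positivity
  have h4 : (1 + 4 * k * S ^ 2) * (k * m ^ 2) ≤ (1 + 4 * k * S ^ 2) * (k * D ^ 2 + z ^ 2 / 4) := by
    calc (1 + 4 * k * S ^ 2) * (k * m ^ 2) ≤ b ^ 2 * (k * m ^ 2) := by gcongr
      _ = k * (b * m) ^ 2 := by ring
      _ ≤ k * (D + S * |z|) ^ 2 := by gcongr
      _ ≤ _ := h2
  exact le_of_mul_le_mul_left h4 hb2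

theorem integrable_pow_mul_exp_neg_mul_sq (n : ℕ) {b : ℝ} (hb : 0 < b) :
    Integrable (fun z : ℝ => |z| ^ n * Real.exp (-b * z ^ 2)) := by
  have h := (integrable_rpow_mul_exp_neg_mul_sq hb (s := n) (by
    have : (0 : ℝ) ≤ n := Nat.cast_nonneg n
    linarith)).norm
  refine h.congr (Filter.Eventually.of_forall fun z => ?_)
  simp [abs_of_pos (Real.exp_pos _)]

/-! ### Hermite functions and polynomials -/

theorem hasDerivAt_hermiteFun (n : ℕ) (x : ℝ) :
    HasDerivAt (hermiteFun n) (-hermiteFun (n + 1) x) x := by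
  have h1 : HasDerivAt (fun x : ℝ => Real.exp (-x ^ 2)) (Real.exp (-x ^ 2) * (-(2 * x))) x := by
    have := ((hasDerivAt_pow 2 x).neg).exp
    simpa using this
  have h2 := (hermitePoly n).hasDerivAt x
  refine HasDerivAt.congr_deriv (f := hermiteFun n) (h1.mul h2) ?_
  simp only [hermiteFun, hermitePoly, Polynomial.eval_sub, Polynomial.eval_mul,
    Polynomial.eval_X, Polynomial.eval_ofNat]
  ring

theorem continuous_hermiteFun (n : ℕ) : Continuous (hermiteFun n) :=
  continuous_iff_continuousAt.2 fun x => (hasDerivAt_hermiteFun n x).continuousAt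

theorem exists_abs_eval_le_exp (p : Polynomial ℝ) {a : ℝ} (ha : 0 < a) :
    ∃ C > 0, ∀ x : ℝ, |p.eval x| ≤ C * Real.exp (a * x ^ 2) := by
  induction p using Polynomial.induction_on' with
  | add p q hp hq =>
    obtain ⟨C, hC0, hC⟩ := hp
    obtain ⟨D, hD0, hD⟩ := hq
    refine ⟨C + D, by positivity, fun x => ?_⟩
    rw [Polynomial.eval_add, add_mul]
    exact (abs_add_le _ _).trans (add_le_add (hC x) (hD x))
  | monomial n c =>
    refine ⟨(|c| + 1) * (1 + (n.factorial : ℝ) / a ^ n), by positivity, fun x => ?_⟩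
    have h1 : (a * x ^ 2) ^ n / n.factorial ≤ Real.exp (a * x ^ 2) :=
      Real.pow_div_factorial_le_exp _ (by positivity) n
    have h2 : |x| ^ n ≤ 1 + (x ^ 2) ^ n := by
      have : (|x| ^ n - 1) ^ 2 ≥ 0 := sq_nonneg _
      have h3 : (x ^ 2) ^ n = (|x| ^ n) ^ 2 := by rw [← sq_abs, ← pow_mul, ← pow_mul, mul_comm]
      rw [h3]; nlinarith [sq_nonneg (|x| ^ n)]
    have h4 : (x ^ 2) ^ n ≤ (n.factorial : ℝ) / a ^ n * Real.exp (a * x ^ 2) := by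
      rw [mul_pow, div_le_iff₀ (by positivity)] at h1
      rw [div_mul_eq_mul_div, le_div_iff₀ (by positivity)]
      linarith
    have h5 : (1 : ℝ) ≤ Real.exp (a * x ^ 2) := Real.one_le_exp (by positivity)
    rw [Polynomial.eval_monomial, abs_mul, abs_pow]
    calc |c| * |x| ^ n ≤ (|c| + 1) * (1 + (x ^ 2) ^ n) := by
          apply mul_le_mul (by linarith) h2 (by positivity) (by positivity)
      _ ≤ (|c| + 1) * (Real.exp (a * x ^ 2) + (n.factorial : ℝ) / a ^ n * Real.exp (a * x ^ 2)) := by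
          gcongr
      _ = _ := by ring

theorem exists_abs_hermiteFun_le (n : ℕ) :
    ∃ C > 0, ∀ x : ℝ, |hermiteFun n x| ≤ C * Real.exp (-x ^ 2 / 2) := by
  obtain ⟨C, hC0, hC⟩ := exists_abs_eval_le_exp (hermitePoly n) (a := 1 / 2) (by norm_num)
  refine ⟨C, hC0, fun x => ?_⟩
  rw [hermiteFun, abs_mul, abs_of_pos (Real.exp_pos _)]
  calc Real.exp (-x ^ 2) * |(hermitePoly n).eval x|
      ≤ Real.exp (-x ^ 2) * (C * Real.exp (1 / 2 * x ^ 2)) := by gcongr; exact hC x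
    _ = C * (Real.exp (-x ^ 2) * Real.exp (1 / 2 * x ^ 2)) := by ring
    _ = _ := by rw [← Real.exp_add]; congr 2; ring

/-- Since h_i' = -h_{i+1}, the sum is the Taylor polynomial of t ↦ h_i(x - t) at 0. The t-derivative
of the remainder of order J + 1 for h_i is the remainder of order J for h_{i+1}; the mean value
inequality closes the induction, which therefore runs over all i at once. -/
theorem exists_hermiteFun_taylor_bound (J : ℕ) : ∀ i : ℕ, ∃ C > 0, ∀ x t : ℝ,
    |hermiteFun i (x - t) - ∑ j ∈ Finset.range J, hermiteFun (i + j) x * t ^ j / j.factorial|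
      ≤ C * |t| ^ J * Real.exp (-x ^ 2 / 4 + t ^ 2 / 2) := by
  induction J with
  | zero =>
    intro i
    obtain ⟨C, hC0, hC⟩ := exists_abs_hermiteFun_le i
    refine ⟨C, hC0, fun x t => ?_⟩
    simp only [Finset.range_zero, Finset.sum_empty, sub_zero, pow_zero, mul_one]
    refine (hC _).trans ?_
    gcongr
    -- The exponent -x²/4 + t²/2 exceeds -(x - t)²/2 by (x - 2t)²/4.
    nlinarith [sq_nonneg (x - 2 * t)]
  | succ J ih =>
    intro i
    obtain ⟨C, hC0, hC⟩ := ih (i + 1)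
    refine ⟨C, hC0, fun x t => ?_⟩
    set R : ℝ → ℝ := fun t => hermiteFun i (x - t)
      - ∑ j ∈ Finset.range (J + 1), hermiteFun (i + j) x * t ^ j / j.factorial with hR
    have hder : ∀ s, HasDerivAt R (hermiteFun (i + 1) (x - s)
        - ∑ j ∈ Finset.range J, hermiteFun (i + 1 + j) x * s ^ j / j.factorial) s := by
      intro s
      have h1 : HasDerivAt (fun t => hermiteFun i (x - t)) (hermiteFun (i + 1) (x - s)) s := by
        have := (hasDerivAt_hermiteFun i (x - s)).comp_const_sub x s
        simpa using this
      refine h1.sub ?_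
      have h2 : ∀ j ∈ Finset.range (J + 1), HasDerivAt
          (fun t : ℝ => hermiteFun (i + j) x * t ^ j / j.factorial)
          (hermiteFun (i + j) x * (j * s ^ (j - 1)) / j.factorial) s := fun j _ =>
        ((hasDerivAt_pow j s).const_mul _).div_const _
      have h3 := HasDerivAt.fun_sum h2
      refine h3.congr_deriv ?_
      rw [Finset.sum_range_succ']
      simp only [Nat.cast_zero, zero_mul, mul_zero, zero_div, add_zero]
      refine Finset.sum_congr rfl fun j _ => ?_
      rw [Nat.factorial_succ]
      push_cast
      have : ((j : ℝ) + 1) ≠ 0 := by positivity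
      have : (j.factorial : ℝ) ≠ 0 := by positivity
      rw [show i + 1 + j = i + (j + 1) by ring]
      field_simp
    have h0 : R 0 = 0 := by
      simp only [hR]
      rw [Finset.sum_range_succ']
      simp
    have hb : ∀ s ∈ Set.Icc (-|t|) |t|, ‖hermiteFun (i + 1) (x - s)
        - ∑ j ∈ Finset.range J, hermiteFun (i + 1 + j) x * s ^ j / j.factorial‖
        ≤ C * |t| ^ J * Real.exp (-x ^ 2 / 4 + t ^ 2 / 2) := by
      intro s hs
      have hs' : |s| ≤ |t| := abs_le.2 hs
      have hs2 : s ^ 2 ≤ t ^ 2 := sq_le_sq.2 hs'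
      refine (hC x s).trans ?_
      gcongr
    have := (convex_Icc (-|t|) |t|).norm_image_sub_le_of_norm_hasDerivWithin_le
      (fun s _ => (hder s).hasDerivWithinAt) hb
      (show (0 : ℝ) ∈ Set.Icc (-|t|) |t| by simp)
      (show t ∈ Set.Icc (-|t|) |t| from ⟨neg_abs_le t, le_abs_self t⟩)
    rw [h0, sub_zero, sub_zero] at this
    refine this.trans (le_of_eq ?_)
    rw [Real.norm_eq_abs]; ring

theorem eq_of_natDegree_hermitePoly (n : ℕ) :
    (hermitePoly n).natDegree = n ∧ (hermitePoly n).leadingCoeff = 2 ^ n := by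
  induction n with
  | zero => simp [hermitePoly]
  | succ n ih =>
    obtain ⟨h1, h2⟩ := ih
    have hne : hermitePoly n ≠ 0 := by
      intro h; rw [h] at h2; simp at h2
      exact absurd h2.symm (by positivity)
    have hc : (2 : Polynomial ℝ) = Polynomial.C 2 := rfl
    have hX : (2 * Polynomial.X : Polynomial ℝ).natDegree = 1 := by
      rw [hc, Polynomial.natDegree_C_mul_X _ (by norm_num)]
    have hX2 : (2 * Polynomial.X : Polynomial ℝ).leadingCoeff = 2 := by
      rw [hc, Polynomial.leadingCoeff_C_mul_X]
    have hX0 : (2 * Polynomial.X : Polynomial ℝ) ≠ 0 := by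
      intro h; rw [h] at hX; simp at hX
    have hd : (2 * Polynomial.X * hermitePoly n).natDegree = n + 1 := by
      rw [Polynomial.natDegree_mul hX0 hne, hX, h1]; ring
    have hlt : (Polynomial.derivative (hermitePoly n)).degree
        < (2 * Polynomial.X * hermitePoly n).degree := by
      have ha : (Polynomial.derivative (hermitePoly n)).degree ≤ (n : ℕ) :=
        (Polynomial.degree_derivative_le).trans (Polynomial.degree_le_of_natDegree_le h1.le)
      rw [Polynomial.degree_eq_natDegree (mul_ne_zero hX0 hne), hd]
      exact lt_of_le_of_lt ha (by exact_mod_cast Nat.lt_succ_self n)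
    constructor
    · rw [hermitePoly, Polynomial.natDegree_eq_of_degree_eq
        (Polynomial.degree_sub_eq_left_of_degree_lt hlt), hd]
    · rw [hermitePoly, Polynomial.leadingCoeff_sub_of_degree_lt hlt, Polynomial.leadingCoeff_mul,
        hX2, h2]; ring

/-- A property of real polynomials that is closed under linear combinations and holds for
`H_0, …, H_{J-1}` holds for all polynomials of degree less than `J`. -/
theorem Submodule.mem_of_hermitePoly_mem (W : Submodule ℝ (Polynomial ℝ)) {J : ℕ}
    (hW : ∀ j < J, hermitePoly j ∈ W) (p : Polynomial ℝ) (hp : p.natDegree < J) : p ∈ W := by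
  induction h : p.natDegree using Nat.strong_induction_on generalizing p with
  | _ d ih =>
    subst h
    set d := p.natDegree with hd
    obtain ⟨h1, h2⟩ := eq_of_natDegree_hermitePoly d
    have hcoef : (hermitePoly d).coeff d = 2 ^ d := by
      rw [← h2, Polynomial.leadingCoeff, h1]
    set a : ℝ := p.leadingCoeff / 2 ^ d with ha
    -- The multiple of `hermitePoly d` cancels the leading term, so the rest has smaller degree, or
    -- is zero if d = 0.
    have hdec : p = a • hermitePoly d + (p - a • hermitePoly d) := by ring
    rw [hdec]
    refine W.add_mem (W.smul_mem a (hW d hp)) ?_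
    have hcz : (p - a • hermitePoly d).coeff d = 0 := by
      rw [Polynomial.coeff_sub, Polynomial.coeff_smul, hcoef, ha, smul_eq_mul,
        div_mul_cancel₀ _ (by positivity), Polynomial.leadingCoeff, ← hd, sub_self]
    have hle : (p - a • hermitePoly d).natDegree ≤ d := by
      refine (Polynomial.natDegree_sub_le _ _).trans (max_le le_rfl ?_)
      exact (Polynomial.natDegree_smul_le _ _).trans h1.le
    rcases Nat.eq_zero_or_pos d with h0 | h0
    · have : p - a • hermitePoly d = 0 := by
        rw [Polynomial.eq_C_of_natDegree_le_zero (hle.trans h0.le), ← h0, hcz, Polynomial.C_0]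
      rw [this]; exact W.zero_mem
    · have hlt : (p - a • hermitePoly d).natDegree < d := by
        refine lt_of_le_of_ne hle fun he => ?_
        have : (p - a • hermitePoly d).leadingCoeff = 0 := by
          rw [Polynomial.leadingCoeff, he, hcz]
        rw [Polynomial.leadingCoeff_eq_zero] at this
        rw [this] at he
        simp at he
        omega
      exact ih _ hlt _ (hlt.trans hp) rfl

/-! ### The limit operator and its right eigenfunctions -/

/-- The eigenvalues `|c|⁻¹ c⁻ʲ` of `v ↦ E v (c y + s χ)` in spaces of rapidly decaying functions. -/
def limitEigenvalue (c : ℝ) (j : ℕ) : ℝ := |c|⁻¹ * (c ^ j)⁻¹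

theorem exists_abs_hermiteFun_le_const (n : ℕ) : ∃ C > 0, ∀ x : ℝ, |hermiteFun n x| ≤ C := by
  obtain ⟨C, hC0, hC⟩ := exists_abs_hermiteFun_le n
  refine ⟨C, hC0, fun x => (hC x).trans ?_⟩
  have : Real.exp (-x ^ 2 / 2) ≤ 1 := Real.exp_le_one_iff.2 (by nlinarith [sq_nonneg x])
  nlinarith

/-- The relation between c, s and β says 1/2 + β²s² = c²/2. Completing the square in z therefore
leaves a Gaussian of precision c², which integrates to the factor |c|⁻¹, times exp(-(βy)²). -/
theorem integral_exp_neg_sq_affine {c s β : ℝ} (hc : 1 < |c|) (hβ : c ^ 2 - 1 = 2 * β ^ 2 * s ^ 2)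
    (y : ℝ) :
    ∫ z, Real.exp (-(β * (c * y + s * z)) ^ 2) ∂stdNormal = |c|⁻¹ * Real.exp (-(β * y) ^ 2) := by
  have hc0 : c ≠ 0 := by rintro rfl; simp at hc; linarith
  have hc2 : 0 < c ^ 2 / 2 := by positivity
  rw [stdNormal, integral_gaussianReal_eq_integral_smul one_ne_zero]
  have h1 : ∀ z : ℝ, gaussianPDFReal 0 1 z • Real.exp (-(β * (c * y + s * z)) ^ 2)
      = ((Real.sqrt (2 * Real.pi))⁻¹ * Real.exp (-(β * y) ^ 2)) *
        Real.exp (-(c ^ 2 / 2) * (z + 2 * β ^ 2 * s * y / c) ^ 2) := by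
    intro z
    simp only [gaussianPDFReal, smul_eq_mul, NNReal.coe_one, mul_one, sub_zero]
    rw [mul_assoc, mul_assoc, ← Real.exp_add, ← Real.exp_add]
    congr 2
    have e1 : 2 * β ^ 2 * s * y / c * c = 2 * β ^ 2 * s * y := by field_simp
    set t := 2 * β ^ 2 * s * y / c
    have : c ^ 2 * t ^ 2 = (2 * β ^ 2 * s * y) ^ 2 := by rw [← e1]; ring
    have e2 : c ^ 2 * t = c * (2 * β ^ 2 * s * y) := by rw [← e1]; ring
    linear_combination (1/2) * this + z * e2 + (z ^ 2 / 2 - β ^ 2 * y ^ 2) * hβ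
  simp only [h1]
  rw [integral_const_mul, integral_add_right_eq_self (fun z => Real.exp (-(c ^ 2 / 2) * z ^ 2)),
    integral_gaussian]
  have h2 : Real.sqrt (Real.pi / (c ^ 2 / 2)) = Real.sqrt (2 * Real.pi) * |c|⁻¹ := by
    rw [show Real.pi / (c ^ 2 / 2) = (2 * Real.pi) * (|c|⁻¹) ^ 2 by
      rw [inv_pow, sq_abs]; field_simp]
    rw [Real.sqrt_mul (by positivity), Real.sqrt_sq (by positivity)]
  rw [h2]
  have : Real.sqrt (2 * Real.pi) ≠ 0 := by positivity
  field_simp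

/-- Differentiating the identity for j in y turns h_j into h_{j+1} on both sides; the chain rule
produces β c on the left and only β on the right, hence one more factor c⁻¹ in the eigenvalue. -/
theorem integral_hermiteFun_affine {c s β : ℝ} (hc : 1 < |c|) (hβ0 : 0 < β)
    (hβ : c ^ 2 - 1 = 2 * β ^ 2 * s ^ 2) (j : ℕ) :
    ∀ y, ∫ z, hermiteFun j (β * (c * y + s * z)) ∂stdNormal
      = limitEigenvalue c j * hermiteFun j (β * y) := by
  have hc0 : c ≠ 0 := by rintro rfl; simp at hc; linarith
  induction j with
  | zero =>
    intro y
    have := integral_exp_neg_sq_affine hc hβ y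
    simpa [limitEigenvalue, hermiteFun, hermitePoly] using this
  | succ j ih =>
    intro y
    obtain ⟨C, hC0, hC⟩ := exists_abs_hermiteFun_le_const j
    obtain ⟨D, hD0, hD⟩ := exists_abs_hermiteFun_le_const (j + 1)
    have hcont : ∀ (i : ℕ) (y : ℝ), Continuous (fun z => hermiteFun i (β * (c * y + s * z))) :=
      fun i y => (continuous_hermiteFun i).comp (by fun_prop)
    have h1 := (hasDerivAt_integral_of_dominated_loc_of_deriv_le (μ := stdNormal) (𝕜 := ℝ)
      (F := fun y z => hermiteFun j (β * (c * y + s * z)))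
      (F' := fun y z => -(hermiteFun (j + 1) (β * (c * y + s * z))) * (β * c))
      (bound := fun _ => D * |β * c|) (x₀ := y) (s := Set.univ) Filter.univ_mem
      (Filter.Eventually.of_forall fun y => (hcont j y).aestronglyMeasurable)
      (Integrable.of_bound (C := C) (hcont j y).aestronglyMeasurable
        (Filter.Eventually.of_forall fun z => hC _))
      (((hcont (j + 1) y).neg.mul continuous_const).aestronglyMeasurable)
      (Filter.Eventually.of_forall fun z y _ => by
        rw [norm_mul, norm_neg]
        exact mul_le_mul_of_nonneg_right (hD _) (norm_nonneg _))
      (integrable_const _)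
      (Filter.Eventually.of_forall fun z y _ => by
        have hin : HasDerivAt (fun y => β * (c * y + s * z)) (β * c) y := by
          have := (((hasDerivAt_id y).const_mul c).add_const (s * z)).const_mul β
          simpa using this
        exact (hasDerivAt_hermiteFun j _).comp y hin)).2
    have h2 : HasDerivAt (fun y => limitEigenvalue c j * hermiteFun j (β * y))
        (limitEigenvalue c j * (-hermiteFun (j + 1) (β * y) * β)) y := by
      have hin : HasDerivAt (fun y => β * y) β y := by
        simpa using (hasDerivAt_id y).const_mul β
      exact ((hasDerivAt_hermiteFun j _).comp y hin).const_mul _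
    have h3 : (fun y => ∫ z, hermiteFun j (β * (c * y + s * z)) ∂stdNormal)
        = fun y => limitEigenvalue c j * hermiteFun j (β * y) := funext ih
    rw [h3] at h1
    have h4 := h1.unique h2
    rw [integral_mul_const, integral_neg] at h4
    have h5 : limitEigenvalue c (j + 1) = limitEigenvalue c j * c⁻¹ := by
      unfold limitEigenvalue; rw [pow_succ, mul_inv, mul_assoc]
    rw [h5]
    field_simp at h4 ⊢
    linarith

/-- The rescaled Hermite function `y ↦ h_j (β y)`, complex valued. -/
def scaledHermite (β : ℝ) (j : ℕ) (y : ℝ) : ℂ := (hermiteFun j (β * y) : ℂ)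

theorem continuous_scaledHermite (β : ℝ) (j : ℕ) : Continuous (scaledHermite β j) :=
  Complex.continuous_ofReal.comp ((continuous_hermiteFun j).comp (by fun_prop))

theorem gaussOp_scaledHermite {c s β : ℝ} (hc : 1 < |c|) (hβ0 : 0 < β)
    (hβ : c ^ 2 - 1 = 2 * β ^ 2 * s ^ 2) (j : ℕ) (y : ℝ) :
    gaussOp c s (scaledHermite β j) y = limitEigenvalue c j * scaledHermite β j y := by
  unfold gaussOp scaledHermite
  rw [integral_complex_ofReal, integral_hermiteFun_affine hc hβ0 hβ]
  push_cast; rfl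

/-! ### The Hermite pairing and left eigenfunctions -/

/-- The pairing of `v` with the left eigenfunction `y ↦ H_j (β y)`. -/
def hermitePairing (β : ℝ) (j : ℕ) (v : ℝ → ℂ) : ℂ :=
  ∫ y, (((hermitePoly j).eval (β * y) : ℝ) : ℂ) * v y

theorem integrable_poly_mul_exp (p : Polynomial ℝ) (β : ℝ) {q : ℝ} (hq : 0 < q) :
    Integrable (fun y : ℝ => |p.eval (β * y)| * Real.exp (-q * y ^ 2)) := by
  obtain ⟨C, hC0, hC⟩ := exists_abs_eval_le_exp p (a := q / 2 / (β ^ 2 + 1)) (by positivity)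
  refine ((integrable_exp_neg_mul_sq (b := q / 2) (by positivity)).const_mul C).mono'
    (by fun_prop) (Filter.Eventually.of_forall fun y => ?_)
  rw [norm_mul, Real.norm_eq_abs, abs_abs, Real.norm_eq_abs, abs_of_pos (Real.exp_pos _)]
  calc |p.eval (β * y)| * Real.exp (-q * y ^ 2)
      ≤ C * Real.exp (q / 2 / (β ^ 2 + 1) * (β * y) ^ 2) * Real.exp (-q * y ^ 2) := by
        gcongr; exact hC _
    _ ≤ C * Real.exp (q / 2 * y ^ 2) * Real.exp (-q * y ^ 2) := by
        refine mul_le_mul_of_nonneg_right (mul_le_mul_of_nonneg_left (Real.exp_le_exp.2 ?_) hC0.le)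
          (Real.exp_pos _).le
        have : β ^ 2 / (β ^ 2 + 1) ≤ 1 := by rw [div_le_one (by positivity)]; linarith
        calc q / 2 / (β ^ 2 + 1) * (β * y) ^ 2 = (q / 2 * y ^ 2) * (β ^ 2 / (β ^ 2 + 1)) := by
              field_simp
          _ ≤ (q / 2 * y ^ 2) * 1 := by gcongr
          _ = _ := mul_one _
    _ = C * Real.exp (-(q / 2) * y ^ 2) := by
        rw [mul_assoc, ← Real.exp_add]; congr 2; ring

theorem integrable_poly_mul (p : Polynomial ℝ) (β : ℝ) {q M : ℝ} (hq : 0 < q) {v : ℝ → ℂ}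
    (hv : Measurable v) (hM : ∀ y, ‖v y‖ ≤ M * Real.exp (-q * y ^ 2)) :
    Integrable (fun y : ℝ => ((p.eval (β * y) : ℝ) : ℂ) * v y) := by
  refine ((integrable_poly_mul_exp p β hq).const_mul M).mono' ?_
    (Filter.Eventually.of_forall fun y => ?_)
  · have : Continuous (fun y : ℝ => ((p.eval (β * y) : ℝ) : ℂ)) := by fun_prop
    exact (this.measurable.mul hv).aestronglyMeasurable
  · rw [norm_mul, Complex.norm_real, Real.norm_eq_abs]
    calc |p.eval (β * y)| * ‖v y‖ ≤ |p.eval (β * y)| * (M * Real.exp (-q * y ^ 2)) := by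
          gcongr; exact hM y
      _ = _ := by ring

theorem exists_norm_hermitePairing_le (β : ℝ) (j : ℕ) {q : ℝ} (hq : 0 < q) :
    ∃ C > 0, ∀ (v : ℝ → ℂ) (M : ℝ), 0 ≤ M → (∀ y, ‖v y‖ ≤ M * Real.exp (-q * y ^ 2)) →
      ‖hermitePairing β j v‖ ≤ C * M := by
  set I := ∫ y : ℝ, |(hermitePoly j).eval (β * y)| * Real.exp (-q * y ^ 2)
  have hI : 0 ≤ I := integral_nonneg fun y => by positivity
  refine ⟨I + 1, by positivity, fun v M hM0 hM => ?_⟩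
  have : ‖hermitePairing β j v‖ ≤ ∫ y : ℝ, M * (|(hermitePoly j).eval (β * y)|
      * Real.exp (-q * y ^ 2)) := by
    refine norm_integral_le_of_norm_le ((integrable_poly_mul_exp _ β hq).const_mul M)
      (Filter.Eventually.of_forall fun y => ?_)
    rw [norm_mul, Complex.norm_real, Real.norm_eq_abs]
    calc |(hermitePoly j).eval (β * y)| * ‖v y‖
        ≤ |(hermitePoly j).eval (β * y)| * (M * Real.exp (-q * y ^ 2)) := by gcongr; exact hM y
      _ = _ := by ring
  rw [integral_const_mul] at this
  nlinarith

theorem hermitePairing_sub (β : ℝ) (j : ℕ) {q M M' : ℝ} (hq : 0 < q) {u v : ℝ → ℂ}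
    (hu : Measurable u) (hv : Measurable v) (hM : ∀ y, ‖u y‖ ≤ M * Real.exp (-q * y ^ 2))
    (hM' : ∀ y, ‖v y‖ ≤ M' * Real.exp (-q * y ^ 2)) :
    hermitePairing β j (fun y => u y - v y) = hermitePairing β j u - hermitePairing β j v := by
  unfold hermitePairing
  simp only [mul_sub]
  exact integral_sub (integrable_poly_mul _ β hq hu hM) (integrable_poly_mul _ β hq hv hM')

theorem hermitePairing_const_mul (β : ℝ) (j : ℕ) (a : ℂ) (v : ℝ → ℂ) :
    hermitePairing β j (fun y => a * v y) = a * hermitePairing β j v := by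
  unfold hermitePairing
  rw [← integral_const_mul]
  congr 1; funext y; ring

/-- The left side is the minimum of the right side over z, attained at z = A a / (A + k). It turns
decay of a function into decay of its Gaussian average. -/
theorem gaussian_tradeoff {A k : ℝ} (hA : 0 < A) (hk : 0 < k) (a z : ℝ) :
    A * k / (A + k) * a ^ 2 ≤ A * (z - a) ^ 2 + k * z ^ 2 := by
  rw [div_mul_eq_mul_div, div_le_iff₀ (by positivity)]
  nlinarith [sq_nonneg ((A + k) * z - A * a)]

/-- Detailed balance: the transition kernel is symmetric with respect to the density exp((βy)²).
This carries right eigenfunctions exp(-(βy)²) H_j(βy) to left eigenfunctions H_j(βy). -/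
theorem normalKernel_symm {c s β : ℝ} (hs : 0 < s) (hβ : c ^ 2 - 1 = 2 * β ^ 2 * s ^ 2) (y z : ℝ) :
    Real.exp ((β * y) ^ 2) * normalKernel (c * y) s z
      = Real.exp ((β * z) ^ 2) * normalKernel (c * z) s y := by
  unfold normalKernel
  rw [mul_left_comm, mul_left_comm (Real.exp ((β * z) ^ 2)), ← Real.exp_add, ← Real.exp_add]
  congr 2
  have hb : β ^ 2 = (c ^ 2 - 1) / (2 * s ^ 2) := by field_simp; linarith
  rw [mul_pow, mul_pow, hb]
  field_simp
  ring

/-- After Fubini, detailed balance turns the inner integral against H_j into the expectation of h_j,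
which is known. Most of the work is the absolute integrability that Fubini needs. -/
theorem hermitePairing_gaussOp {c s β q M : ℝ} (hc : 1 < |c|) (hs : 0 < s) (hβ0 : 0 < β)
    (hβ : c ^ 2 - 1 = 2 * β ^ 2 * s ^ 2) (j : ℕ) (hq : 0 < q) {v : ℝ → ℂ} (hv : Measurable v)
    (hM0 : 0 ≤ M) (hM : ∀ y, ‖v y‖ ≤ M * Real.exp (-q * y ^ 2)) :
    hermitePairing β j (gaussOp c s v) = limitEigenvalue c j * hermitePairing β j v := by
  have hc0 : c ≠ 0 := by rintro rfl; simp at hc; linarith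
  set p : ℝ → ℝ := fun y => (hermitePoly j).eval (β * y) with hp
  have hpc : Continuous p := by fun_prop
  have hint : Integrable (Function.uncurry fun y z : ℝ =>
      ((p y : ℝ) : ℂ) * (normalKernel (c * y) s z • v z)) (volume.prod volume) := by
    set A := 1 / (2 * s ^ 2) with hA
    have hA0 : 0 < A := by positivity
    -- Half of the decay of v is traded for decay in y at rate α; the other half is kept for
    -- integrability in z.
    set α := A * (q / 2) / (A + q / 2) * c ^ 2 with hα
    have hα0 : 0 < α := by positivity
    obtain ⟨C, hC0, hC⟩ := exists_abs_eval_le_exp (hermitePoly j) (a := α / 2 / β ^ 2)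
      (by positivity)
    have hdom : Integrable (fun x : ℝ × ℝ => (C * (Real.sqrt (2 * Real.pi) * s)⁻¹ * M) *
        (Real.exp (-(α / 2) * x.1 ^ 2) * Real.exp (-(q / 2) * x.2 ^ 2))) (volume.prod volume) :=
      ((integrable_exp_neg_mul_sq (b := α / 2) (by positivity)).mul_prod
        (integrable_exp_neg_mul_sq (b := q / 2) (by positivity))).const_mul _
    refine hdom.mono' ?_ (Filter.Eventually.of_forall fun x => ?_)
    · have h1 : Continuous (fun x : ℝ × ℝ => ((p x.1 : ℝ) : ℂ)) :=
        Complex.continuous_ofReal.comp (hpc.comp continuous_fst)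
      have h2 := continuous_normalKernel_uncurry c s
      exact (h1.measurable.mul
        (h2.measurable.smul (hv.comp measurable_snd))).aestronglyMeasurable
    · obtain ⟨y, z⟩ := x
      simp only [Function.uncurry]
      rw [norm_mul, norm_smul, Complex.norm_real, Real.norm_eq_abs, Real.norm_eq_abs,
        abs_of_nonneg (normalKernel_nonneg _ _ hs)]
      have e1 : |p y| ≤ C * Real.exp (α / 2 * y ^ 2) := by
        refine (hC (β * y)).trans (le_of_eq ?_)
        congr 2; field_simp
      have e2 : normalKernel (c * y) s z * Real.exp (-q * z ^ 2) ≤ (Real.sqrt (2 * Real.pi) * s)⁻¹ *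
          (Real.exp (-α * y ^ 2) * Real.exp (-(q / 2) * z ^ 2)) := by
        unfold normalKernel
        rw [mul_assoc, ← Real.exp_add, ← Real.exp_add]
        refine mul_le_mul_of_nonneg_left (Real.exp_le_exp.2 ?_) (by positivity)
        have := gaussian_tradeoff hA0 (half_pos hq) (c * y) z
        have e : -(z - c * y) ^ 2 / (2 * s ^ 2) = -(A * (z - c * y) ^ 2) := by
          rw [hA]; ring
        rw [e]
        have e' : α * y ^ 2 = A * (q / 2) / (A + q / 2) * (c * y) ^ 2 := by rw [hα]; ring
        nlinarith
      calc |p y| * (normalKernel (c * y) s z * ‖v z‖)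
          ≤ (C * Real.exp (α / 2 * y ^ 2)) *
            (normalKernel (c * y) s z * (M * Real.exp (-q * z ^ 2))) := by
            have := normalKernel_nonneg (c * y) z hs
            gcongr; exact hM z
        _ = (C * Real.exp (α / 2 * y ^ 2)) * M *
            (normalKernel (c * y) s z * Real.exp (-q * z ^ 2)) := by ring
        _ ≤ (C * Real.exp (α / 2 * y ^ 2)) * M * ((Real.sqrt (2 * Real.pi) * s)⁻¹ *
          (Real.exp (-α * y ^ 2) * Real.exp (-(q / 2) * z ^ 2))) := by gcongr
        _ = (C * (Real.sqrt (2 * Real.pi) * s)⁻¹ * M) * ((Real.exp (α / 2 * y ^ 2) *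
            Real.exp (-α * y ^ 2)) * Real.exp (-(q / 2) * z ^ 2)) := by ring
        _ = _ := by
            rw [← Real.exp_add (α / 2 * y ^ 2)]
            congr 4; ring
  have h1 : hermitePairing β j (gaussOp c s v)
      = ∫ y, ∫ z, ((p y : ℝ) : ℂ) * (normalKernel (c * y) s z • v z) := by
    unfold hermitePairing
    congr 1; funext y
    rw [gaussOp_eq_kernel c hs, integral_const_mul]
  rw [h1, integral_integral_swap hint]
  unfold hermitePairing
  rw [← integral_const_mul]
  congr 1; funext z
  have h2 : ∀ y, ((p y : ℝ) : ℂ) * (normalKernel (c * y) s z • v z)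
      = (((normalKernel (c * z) s y * hermiteFun j (β * y) : ℝ) : ℂ)) *
        (((Real.exp ((β * z) ^ 2) : ℝ) : ℂ) * v z) := by
    intro y
    have h3 : p y * normalKernel (c * y) s z
        = normalKernel (c * z) s y * hermiteFun j (β * y) * Real.exp ((β * z) ^ 2) := by
      have hk := normalKernel_symm hs hβ y z
      have h4 : p y = Real.exp ((β * y) ^ 2) * hermiteFun j (β * y) := by
        rw [hermiteFun, ← mul_assoc, ← Real.exp_add]; simp [hp]
      rw [h4]
      linear_combination hermiteFun j (β * y) * hk
    rw [Complex.real_smul, ← mul_assoc, ← mul_assoc, ← Complex.ofReal_mul, ← Complex.ofReal_mul, h3]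
  simp only [h2]
  rw [integral_mul_const, integral_complex_ofReal]
  have h5 := integral_stdNormal_affine (fun y => hermiteFun j (β * y)) (c * z) hs
  simp only [smul_eq_mul] at h5
  rw [← h5, integral_hermiteFun_affine hc hβ0 hβ]
  have h6 : hermiteFun j (β * z) * Real.exp ((β * z) ^ 2) = (hermitePoly j).eval (β * z) := by
    rw [hermiteFun, mul_right_comm, ← Real.exp_add]; simp
  rw [← h6]; push_cast; ring

/-! ### Contraction on functions orthogonal to the first Hermite polynomials -/

theorem integral_poly_mul_eq_zero {β q M : ℝ} (hq : 0 < q) {u : ℝ → ℂ}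
    (hu : Measurable u) (hM : ∀ y, ‖u y‖ ≤ M * Real.exp (-q * y ^ 2)) {J : ℕ}
    (horth : ∀ j < J, hermitePairing β j u = 0) (p : Polynomial ℝ) (hp : p.natDegree < J) :
    ∫ y, ((p.eval (β * y) : ℝ) : ℂ) * u y = 0 := by
  let W : Submodule ℝ (Polynomial ℝ) :=
    { carrier := {p | ∫ y, ((p.eval (β * y) : ℝ) : ℂ) * u y = 0}
      zero_mem' := by simp
      add_mem' := by
        intro p₁ p₂ h1 h2
        simp only [Set.mem_ofPred_eq, Polynomial.eval_add, Complex.ofReal_add, add_mul] at *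
        rw [integral_add (integrable_poly_mul p₁ β hq hu hM) (integrable_poly_mul p₂ β hq hu hM),
          h1, h2, add_zero]
      smul_mem' := by
        intro a p₁ h1
        simp only [Set.mem_ofPred_eq, Polynomial.eval_smul, smul_eq_mul, Complex.ofReal_mul,
          mul_assoc] at *
        rw [integral_const_mul, h1, mul_zero] }
  exact W.mem_of_hermitePoly_mem (J := J) (fun j hj => horth j hj) p hp

/-- With κ = 1/(√2 s), the kernel is a constant times h_0(κcy - κz). Its Taylor polynomial in κz of
degree below J integrates to zero against u, and the remainder is of order (κ|z|)^J. Both κ and the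
normalising constant are at most 2β/|c|, which yields J + 1 factors |c|⁻¹. The constant A does not
depend on c and s, so the bound can be used for all high iterates with the same β. -/
theorem exists_norm_gaussOp_le_of_orthogonal (J : ℕ) {β q : ℝ} (hβ0 : 0 < β) (hq : 0 < q) :
    ∃ A > 0, ∀ (c s : ℝ), 0 < s → c ^ 2 - 1 = 2 * β ^ 2 * s ^ 2 → 2 ≤ c ^ 2 →
      2 * β ^ 2 / c ^ 2 ≤ q → ∀ (u : ℝ → ℂ) (U : ℝ), Measurable u → 0 ≤ U →
      (∀ y, ‖u y‖ ≤ U * Real.exp (-q * y ^ 2)) → (∀ j < J, hermitePairing β j u = 0) →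
      ∀ y, ‖gaussOp c s u y‖ ≤ A * (|c|⁻¹) ^ (J + 1) * U * Real.exp (-(β ^ 2 / 4) * y ^ 2) := by
  obtain ⟨C, hC0, hC⟩ := exists_hermiteFun_taylor_bound J 0
  set I := ∫ z : ℝ, |z| ^ J * Real.exp (-(q / 2) * z ^ 2) with hI
  have hI0 : 0 ≤ I := integral_nonneg fun z => by positivity
  refine ⟨C * (2 * β) ^ (J + 1) * (I + 1), by positivity, ?_⟩
  intro c s hs hβ hc2 hcq u U hu hU0 hU horth y
  have hc0 : c ≠ 0 := by rintro rfl; norm_num at hc2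
  have hca : 0 < |c| := abs_pos.2 hc0
  set κ : ℝ := (Real.sqrt 2 * s)⁻¹ with hκ
  have hκ0 : 0 < κ := by positivity
  have h22 : Real.sqrt 2 ^ 2 = 2 := Real.sq_sqrt (by norm_num)
  have hκ2 : κ ^ 2 = 1 / (2 * s ^ 2) := by rw [hκ, inv_pow, mul_pow, h22, one_div]
  have hκβ : κ ^ 2 * (c ^ 2 - 1) = β ^ 2 := by rw [hκ2, hβ]; field_simp
  have hκc : κ ^ 2 * c ^ 2 ≤ 2 * β ^ 2 := by nlinarith [sq_nonneg κ]
  have hκle : κ * |c| ≤ Real.sqrt 2 * β := by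
    refine abs_le_of_sq_le_sq' ?_ (by positivity) |>.2
    rw [mul_pow, mul_pow, sq_abs, h22]; exact hκc
  have hs2 : Real.sqrt 2 ≤ 2 := by nlinarith [Real.sqrt_nonneg 2]
  have hκ1 : κ ≤ 2 * β * |c|⁻¹ := by
    rw [← div_eq_mul_inv, le_div_iff₀ hca]; nlinarith
  have hpre : (Real.sqrt (2 * Real.pi) * s)⁻¹ ≤ 2 * β * |c|⁻¹ := by
    have : (Real.sqrt (2 * Real.pi) * s)⁻¹ ≤ κ := by
      rw [hκ]
      gcongr
      nlinarith [Real.pi_gt_three]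
    exact this.trans hκ1
  -- the Taylor polynomial of the kernel is orthogonal to `u`
  set P : ℝ → ℝ := fun z => ∑ j ∈ Finset.range J, hermiteFun (0 + j) (κ * c * y) * (κ * z) ^ j
    / j.factorial with hP
  have hPint : ∀ j : ℕ, Integrable (fun z : ℝ =>
      ((hermiteFun (0 + j) (κ * c * y) * (κ * z) ^ j / j.factorial : ℝ) : ℂ) * u z) := by
    intro j
    have := integrable_poly_mul (Polynomial.C (hermiteFun (0 + j) (κ * c * y) / j.factorial)
      * Polynomial.X ^ j) κ hq hu hU
    refine this.congr (Filter.Eventually.of_forall fun z => ?_)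
    simp only [Polynomial.eval_mul, Polynomial.eval_C, Polynomial.eval_pow, Polynomial.eval_X]
    congr 2; ring
  have hPsum : ∀ z, ((P z : ℝ) : ℂ) * u z = ∑ j ∈ Finset.range J,
      ((hermiteFun (0 + j) (κ * c * y) * (κ * z) ^ j / j.factorial : ℝ) : ℂ) * u z := by
    intro z; rw [hP, Complex.ofReal_sum, Finset.sum_mul]
  have hPi : Integrable (fun z => ((P z : ℝ) : ℂ) * u z) := by
    simp only [hPsum]
    exact integrable_finsetSum _ fun j _ => hPint j
  have hP0 : ∫ z, ((P z : ℝ) : ℂ) * u z = 0 := by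
    simp only [hPsum]
    rw [integral_finsetSum _ fun j _ => hPint j]
    refine Finset.sum_eq_zero fun j hj => ?_
    have := integral_poly_mul_eq_zero hq hu hU horth
      (Polynomial.C (hermiteFun (0 + j) (κ * c * y) * (κ / β) ^ j / j.factorial)
        * Polynomial.X ^ j)
      (lt_of_le_of_lt (Polynomial.natDegree_C_mul_X_pow_le _ _) (Finset.mem_range.1 hj))
    rw [← this]
    congr 1; funext z
    simp only [Polynomial.eval_mul, Polynomial.eval_C, Polynomial.eval_pow, Polynomial.eval_X]
    congr 2
    rw [mul_pow, mul_pow, div_pow]; field_simp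
  have hker : ∀ z, normalKernel (c * y) s z
      = (Real.sqrt (2 * Real.pi) * s)⁻¹ * hermiteFun 0 (κ * c * y - κ * z) := by
    intro z
    simp only [normalKernel, hermiteFun, hermitePoly, Polynomial.eval_one, mul_one]
    congr 2
    have : (κ * c * y - κ * z) ^ 2 = κ ^ 2 * (z - c * y) ^ 2 := by ring
    rw [this, hκ2]; ring
  have hui : Integrable u := by
    refine ((integrable_exp_neg_mul_sq hq).const_mul U).mono' hu.aestronglyMeasurable
      (Filter.Eventually.of_forall hU)
  have hGi : Integrable (fun z => ((hermiteFun 0 (κ * c * y - κ * z) : ℝ) : ℂ) * u z) := by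
    obtain ⟨D, hD0, hD⟩ := exists_abs_hermiteFun_le_const 0
    refine Integrable.bdd_mul (c := D) hui ?_ (Filter.Eventually.of_forall fun z => ?_)
    · exact (Complex.continuous_ofReal.comp
        ((continuous_hermiteFun 0).comp (by fun_prop))).aestronglyMeasurable
    · rw [Complex.norm_real]; exact hD _
  have hrep : gaussOp c s u y = (((Real.sqrt (2 * Real.pi) * s)⁻¹ : ℝ) : ℂ) *
      ∫ z, (((hermiteFun 0 (κ * c * y - κ * z) - P z : ℝ)) : ℂ) * u z := by
    rw [gaussOp_eq_kernel c hs]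
    have : ∫ z, (((hermiteFun 0 (κ * c * y - κ * z) - P z : ℝ)) : ℂ) * u z
        = ∫ z, ((hermiteFun 0 (κ * c * y - κ * z) : ℝ) : ℂ) * u z := by
      simp only [Complex.ofReal_sub, sub_mul]
      rw [integral_sub hGi hPi, hP0, sub_zero]
    rw [this, ← integral_const_mul]
    congr 1; funext z
    rw [hker z, Complex.real_smul]; push_cast; ring
  have hbound : ‖∫ z, (((hermiteFun 0 (κ * c * y - κ * z) - P z : ℝ)) : ℂ) * u z‖
      ≤ ∫ z, (C * κ ^ J * U * Real.exp (-(β ^ 2 / 4) * y ^ 2)) *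
        (|z| ^ J * Real.exp (-(q / 2) * z ^ 2)) := by
    refine norm_integral_le_of_norm_le
      ((integrable_pow_mul_exp_neg_mul_sq J (half_pos hq)).const_mul _)
      (Filter.Eventually.of_forall fun z => ?_)
    rw [norm_mul, Complex.norm_real, Real.norm_eq_abs]
    have h1 := hC (κ * c * y) (κ * z)
    have h2 : -(κ * c * y) ^ 2 / 4 + (κ * z) ^ 2 / 2 ≤ -(β ^ 2 / 4) * y ^ 2 + q / 2 * z ^ 2 := by
      have e1 : β ^ 2 * y ^ 2 ≤ (κ * c * y) ^ 2 := by
        rw [← hκβ]; nlinarith [sq_nonneg (κ * y)]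
      -- Here |c| has to be large compared with q: half of the decay of u pays for the factor
      -- exp((κz)²/2) of the Taylor bound.
      have e2 : κ ^ 2 ≤ q := by
        refine le_trans ?_ hcq
        rw [le_div_iff₀ (by positivity)]; exact hκc
      have e3 : (κ * z) ^ 2 ≤ q * z ^ 2 := by rw [mul_pow]; gcongr
      linarith
    calc |hermiteFun 0 (κ * c * y - κ * z) - P z| * ‖u z‖
        ≤ (C * |κ * z| ^ J * Real.exp (-(κ * c * y) ^ 2 / 4 + (κ * z) ^ 2 / 2)) *
          (U * Real.exp (-q * z ^ 2)) := by gcongr; exact hU z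
      _ ≤ (C * |κ * z| ^ J * Real.exp (-(β ^ 2 / 4) * y ^ 2 + q / 2 * z ^ 2)) *
          (U * Real.exp (-q * z ^ 2)) := by
          gcongr
      _ = (C * κ ^ J * U * |z| ^ J) * (Real.exp (-(β ^ 2 / 4) * y ^ 2 + q / 2 * z ^ 2) *
          Real.exp (-q * z ^ 2)) := by
          rw [abs_mul, mul_pow, abs_of_pos hκ0]; ring
      _ = (C * κ ^ J * U * |z| ^ J) * (Real.exp (-(β ^ 2 / 4) * y ^ 2) *
          Real.exp (-(q / 2) * z ^ 2)) := by
          rw [← Real.exp_add, ← Real.exp_add]; congr 2; ring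
      _ = _ := by ring
  rw [integral_const_mul, ← hI] at hbound
  rw [hrep, norm_mul, Complex.norm_real, Real.norm_eq_abs, abs_of_pos (by positivity)]
  calc (Real.sqrt (2 * Real.pi) * s)⁻¹ *
        ‖∫ z, (((hermiteFun 0 (κ * c * y - κ * z) - P z : ℝ)) : ℂ) * u z‖
      ≤ (2 * β * |c|⁻¹) * (C * (2 * β * |c|⁻¹) ^ J * U * Real.exp (-(β ^ 2 / 4) * y ^ 2)
          * (I + 1)) := by
        refine mul_le_mul hpre (hbound.trans ?_) (norm_nonneg _) (by positivity)
        gcongr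
        linarith
    _ = _ := by rw [mul_pow, pow_succ, pow_succ]; ring

/-- Composition multiplies the slopes and adds the propagated variances, in such a way that β stays
the same. So the contraction estimate applies to iterates, where the slope is as large as desired.
-/
theorem exists_gaussOp_iterate {c s β : ℝ} (hs : 0 < s)
    (hβ : c ^ 2 - 1 = 2 * β ^ 2 * s ^ 2) (n : ℕ) :
    ∃ t > 0, (c ^ (n + 1)) ^ 2 - 1 = 2 * β ^ 2 * t ^ 2 ∧
      ∀ (u : ℝ → ℂ) (C : ℝ), Measurable u → (∀ y, ‖u y‖ ≤ C) →
        (gaussOp c s)^[n + 1] u = gaussOp (c ^ (n + 1)) t u := by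
  induction n with
  | zero => exact ⟨s, hs, by simpa using hβ, fun u C _ _ => by simp⟩
  | succ n ih =>
    obtain ⟨t, ht, h1, h2⟩ := ih
    refine ⟨Real.sqrt ((c ^ (n + 1) * s) ^ 2 + t ^ 2), by positivity, ?_, fun u C hu hC => ?_⟩
    · rw [Real.sq_sqrt (by positivity)]
      have : (c ^ (n + 1 + 1)) ^ 2 = (c ^ (n + 1)) ^ 2 * c ^ 2 := by ring
      rw [this]
      linear_combination (c ^ (n + 1)) ^ 2 * hβ + h1
    · rw [Function.iterate_succ_apply', h2 u C hu hC,
        gaussOp_comp hu hC c s _ t _ (Real.sq_sqrt (by positivity)), ← pow_succ]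

/-! ### Weighted bounds -/

/-- A weight adapted to the operator `gaussOp c s`: it lies between two Gaussians and its
expectation is controlled by the constant `C₀`. -/
structure AdmissibleWeight (c s k q C₀ : ℝ) (w : ℝ → ℝ) : Prop where
  measurable : Measurable w
  lower : ∀ y, Real.exp (-k * y ^ 2) ≤ w y
  upper : ∀ y, w y ≤ 2 * Real.exp (-q * y ^ 2)
  expect : ∀ y, ∫ z, w (c * y + s * z) ∂stdNormal ≤ C₀ * w y

namespace AdmissibleWeight

variable {c s k q C₀ : ℝ} {w : ℝ → ℝ}

theorem pos (hw : AdmissibleWeight c s k q C₀ w) (y : ℝ) : 0 < w y :=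
  (Real.exp_pos _).trans_le (hw.lower y)

theorem le_two (hw : AdmissibleWeight c s k q C₀ w) (hq : 0 ≤ q) (y : ℝ) : w y ≤ 2 := by
  have h1 := hw.upper y
  have h2 : Real.exp (-q * y ^ 2) ≤ 1 := Real.exp_le_one_iff.2 (by nlinarith [sq_nonneg y])
  linarith

theorem norm_le_exp (hw : AdmissibleWeight c s k q C₀ w) {M : ℝ} (hM : 0 ≤ M) {v : ℝ → ℂ}
    (hv : ∀ y, ‖v y‖ ≤ M * w y) (y : ℝ) : ‖v y‖ ≤ (2 * M) * Real.exp (-q * y ^ 2) :=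
  (hv y).trans (by nlinarith [mul_le_mul_of_nonneg_left (hw.upper y) hM])

theorem norm_le_const (hw : AdmissibleWeight c s k q C₀ w) (hq : 0 ≤ q) {M : ℝ} (hM : 0 ≤ M)
    {v : ℝ → ℂ} (hv : ∀ y, ‖v y‖ ≤ M * w y) (y : ℝ) : ‖v y‖ ≤ M * 2 :=
  (hv y).trans (mul_le_mul_of_nonneg_left (hw.le_two hq y) hM)

theorem norm_gaussOp_le (hw : AdmissibleWeight c s k q C₀ w) (hq : 0 ≤ q) {M : ℝ} (hM : 0 ≤ M)
    {v : ℝ → ℂ} (hv : ∀ y, ‖v y‖ ≤ M * w y) (y : ℝ) : ‖gaussOp c s v y‖ ≤ C₀ * M * w y := by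
  have hi : Integrable (fun z => w (c * y + s * z)) stdNormal :=
    integrable_stdNormal_affine (C := 2) _ _ hw.measurable.stronglyMeasurable fun y => by
      rw [Real.norm_eq_abs, abs_of_pos (hw.pos y)]; exact hw.le_two hq y
  refine (norm_integral_le_of_norm_le (hi.const_mul M)
    (Filter.Eventually.of_forall fun z => hv _)).trans ?_
  rw [integral_const_mul]
  nlinarith [mul_le_mul_of_nonneg_left (hw.expect y) hM]

/-- The errors of the single steps add up, each amplified by at most a power of C₀. The constant D
is chosen before w, so it will not depend on ε. -/
theorem exists_norm_iterate_sub_le (c s k q C₀ : ℝ) (hq : 0 ≤ q) (hC₀ : 0 ≤ C₀) (n : ℕ) :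
    ∃ D > 0, ∀ (w : ℝ → ℝ), AdmissibleWeight c s k q C₀ w → ∀ (u : ℝ → ℂ) (μ : ℂ) (U E : ℝ),
      Measurable u → 0 ≤ U → 0 ≤ E → (∀ y, ‖u y‖ ≤ U * w y) → ‖μ‖ ≤ 1 →
      (∀ y, ‖gaussOp c s u y - μ * u y‖ ≤ E * w y) →
      Measurable ((gaussOp c s)^[n] u) ∧
      (∀ y, ‖(gaussOp c s)^[n] u y - μ ^ n * u y‖ ≤ D * E * w y) := by
  induction n with
  | zero =>
    refine ⟨1, one_pos, fun w hw u μ U E hu _ hE _ _ _ => ⟨hu, fun y => ?_⟩⟩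
    have := (hw.pos y).le
    simp only [Function.iterate_zero, id, pow_zero, one_mul, sub_self, norm_zero]
    positivity
  | succ n ih =>
    obtain ⟨D, hD0, hD⟩ := ih
    refine ⟨C₀ * D + 1, by positivity, fun w hw u μ U E hu hU0 hE hU hμ he => ?_⟩
    obtain ⟨hm, hd⟩ := hD w hw u μ U E hu hU0 hE hU hμ he
    rw [Function.iterate_succ_apply']
    set g := (gaussOp c s)^[n] u with hg
    refine ⟨measurable_gaussOp c s hm, fun y => ?_⟩
    have hub := hw.norm_le_const hq hU0 hU
    have hdb := hw.norm_le_const hq (by positivity) hd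
    have hgb : ∀ y, ‖g y‖ ≤ D * E * 2 + U * 2 := fun y => by
      have h1 : g y = (g y - μ ^ n * u y) + μ ^ n * u y := by ring
      rw [h1]
      refine (norm_add_le _ _).trans (add_le_add (hdb y) ?_)
      rw [norm_mul, norm_pow]
      exact (mul_le_of_le_one_left (norm_nonneg _) (pow_le_one₀ (norm_nonneg _) hμ)).trans (hub y)
    have hdec : gaussOp c s g y
        = gaussOp c s (fun y => g y - μ ^ n * u y) y + μ ^ n * gaussOp c s u y := by
      unfold gaussOp
      rw [integral_sub (integrable_stdNormal_affine _ _ hm.stronglyMeasurable hgb)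
        ((integrable_stdNormal_affine _ _ hu.stronglyMeasurable hub).const_mul _),
        integral_const_mul]
      ring
    have h2 := hw.norm_gaussOp_le hq (by positivity) hd y
    have h3 : gaussOp c s g y - μ ^ (n + 1) * u y
        = gaussOp c s (fun y => g y - μ ^ n * u y) y + μ ^ n * (gaussOp c s u y - μ * u y) := by
      rw [hdec]; ring
    rw [h3]
    refine (norm_add_le _ _).trans ?_
    rw [norm_mul, norm_pow]
    have h4 : ‖μ‖ ^ n * ‖gaussOp c s u y - μ * u y‖ ≤ E * w y :=
      (mul_le_of_le_one_left (norm_nonneg _) (pow_le_one₀ (norm_nonneg _) hμ)).trans (he y)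
    calc _ ≤ C₀ * (D * E) * w y + E * w y := add_le_add h2 h4
      _ = _ := by ring

end AdmissibleWeight

/-- The a priori bound U enters only through its finiteness: iterating U ↦ U/2 + b converges to 2b.
This permits the use of bounds that are useless in size, such as one that explodes as ε → 0. -/
theorem norm_le_of_halving {u : ℝ → ℂ} {w : ℝ → ℝ} {U b : ℝ} (hw : ∀ y, 0 < w y)
    (hU0 : 0 ≤ U) (hU : ∀ y, ‖u y‖ ≤ U * w y) (hb : 0 ≤ b)
    (h : ∀ U, 0 ≤ U → (∀ y, ‖u y‖ ≤ U * w y) → ∀ y, ‖u y‖ ≤ (U / 2 + b) * w y) (y : ℝ) :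
    ‖u y‖ ≤ 2 * b * w y := by
  have hn : ∀ n : ℕ, ∀ y, ‖u y‖ ≤ (U * (1 / 2) ^ n + 2 * b) * w y := by
    intro n
    induction n with
    | zero => intro y; nlinarith [hU y, hw y, mul_nonneg hb (hw y).le]
    | succ n ih =>
      intro y
      refine (h _ (by positivity) ih y).trans (le_of_eq ?_)
      rw [pow_succ]; ring
  have ht : Filter.Tendsto (fun n : ℕ => (U * (1 / 2 : ℝ) ^ n + 2 * b) * w y) Filter.atTop
      (nhds ((U * 0 + 2 * b) * w y)) :=
    (((tendsto_pow_atTop_nhds_zero_of_lt_one (by norm_num) (by norm_num)).const_mul U).add_const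
      _).mul_const _
  simp only [mul_zero, zero_add] at ht
  exact ge_of_tendsto' ht fun n => hn n y

/-! ### Rigidity of approximate eigenfunctions of the limit operator -/

theorem limitEigenvalue_injective {c : ℝ} (hc : 1 < |c|) {i j : ℕ}
    (h : limitEigenvalue c i = limitEigenvalue c j) : i = j := by
  have hc0 : |c|⁻¹ ≠ 0 := inv_ne_zero (by linarith)
  have h1 : c ^ i = c ^ j := inv_injective (mul_left_cancel₀ hc0 h)
  have h2 : |c| ^ i = |c| ^ j := by rw [← abs_pow, ← abs_pow, h1]
  exact (pow_right_strictMono₀ hc).injective h2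

theorem exists_limitEigenvalue_gap {c : ℝ} (hc : 1 < |c|) (J : ℕ) :
    ∃ g > 0, ∀ i < J, ∀ j < J, i ≠ j → g ≤ |limitEigenvalue c i - limitEigenvalue c j| := by
  have key : ∀ S : Finset (ℕ × ℕ), (∀ p ∈ S, p.1 ≠ p.2) →
      ∃ g > 0, ∀ p ∈ S, g ≤ |limitEigenvalue c p.1 - limitEigenvalue c p.2| := by
    intro S
    induction S using Finset.induction_on with
    | empty => exact fun _ => ⟨1, one_pos, by simp⟩
    | insert a S _ ih =>
      intro h
      obtain ⟨g, hg, hS⟩ := ih fun p hp => h p (Finset.mem_insert_of_mem hp)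
      have ha : 0 < |limitEigenvalue c a.1 - limitEigenvalue c a.2| := by
        rw [abs_pos, sub_ne_zero]
        exact fun he => h a (Finset.mem_insert_self a S) (limitEigenvalue_injective hc he)
      refine ⟨min g _, lt_min hg ha, fun p hp => ?_⟩
      rcases Finset.mem_insert.1 hp with rfl | hp
      · exact min_le_right _ _
      · exact (min_le_left _ _).trans (hS p hp)
  obtain ⟨g, hg, h⟩ := key
    ((Finset.range J ×ˢ Finset.range J).filter fun p => p.1 ≠ p.2) (by simp)
  exact ⟨g, hg, fun i hi j hj hij => h (i, j) (by simp [hi, hj, hij])⟩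

theorem exists_norm_scaledHermite_le (β : ℝ) (j : ℕ) :
    ∃ C > 0, ∀ y : ℝ, ‖scaledHermite β j y‖ ≤ C * Real.exp (-(β ^ 2 / 4) * y ^ 2) := by
  obtain ⟨C, hC0, hC⟩ := exists_abs_hermiteFun_le j
  refine ⟨C, hC0, fun y => ?_⟩
  rw [scaledHermite, Complex.norm_real, Real.norm_eq_abs]
  refine (hC _).trans ?_
  gcongr
  nlinarith [sq_nonneg (β * y)]

/-- Evaluating the pairing of H_i with the image of h_j from either side gives the factors λ_i and
λ_j, which differ. -/
theorem hermitePairing_scaledHermite_of_ne {c s β : ℝ} (hc : 1 < |c|) (hs : 0 < s) (hβ0 : 0 < β)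
    (hβ : c ^ 2 - 1 = 2 * β ^ 2 * s ^ 2) {i j : ℕ} (hij : i ≠ j) :
    hermitePairing β i (scaledHermite β j) = 0 := by
  obtain ⟨C, hC0, hC⟩ := exists_norm_scaledHermite_le β j
  have h1 := hermitePairing_gaussOp hc hs hβ0 hβ i (q := β ^ 2 / 4) (by positivity)
    (continuous_scaledHermite β j).measurable hC0.le hC
  have h2 : gaussOp c s (scaledHermite β j)
      = fun y => (limitEigenvalue c j : ℂ) * scaledHermite β j y :=
    funext (gaussOp_scaledHermite hc hβ0 hβ j)
  rw [h2, hermitePairing_const_mul] at h1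
  by_contra hne
  have h3 := mul_right_cancel₀ hne h1
  exact hij (limitEigenvalue_injective hc (by exact_mod_cast h3.symm))

theorem hermitePairing_scaledHermite_self_ne_zero {β : ℝ} (hβ0 : 0 < β) (j : ℕ) :
    hermitePairing β j (scaledHermite β j) ≠ 0 := by
  set f : ℝ → ℝ := fun y => (hermitePoly j).eval (β * y) * hermiteFun j (β * y) with hf
  have h1 : hermitePairing β j (scaledHermite β j) = ((∫ y, f y : ℝ) : ℂ) := by
    rw [← integral_complex_ofReal]
    unfold hermitePairing scaledHermite
    congr 1; funext y
    simp [hf]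
  have hfe : ∀ y, f y = Real.exp (-(β * y) ^ 2) * (hermitePoly j).eval (β * y) ^ 2 := by
    intro y; simp only [hf, hermiteFun]; ring
  have hcont : Continuous f := by
    refine Continuous.mul (by fun_prop) ((continuous_hermiteFun j).comp (by fun_prop))
  have hint : Integrable f := by
    obtain ⟨C, hC0, hC⟩ := exists_norm_scaledHermite_le β j
    have := integrable_poly_mul (hermitePoly j) β (q := β ^ 2 / 4) (by positivity)
      (continuous_scaledHermite β j).measurable hC
    refine this.re.congr (Filter.Eventually.of_forall fun y => ?_)
    simp [hf, scaledHermite]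
  have hnn : ∀ y, 0 ≤ f y := fun y => by rw [hfe]; positivity
  obtain ⟨y₀, hy₀⟩ : ∃ y₀, f y₀ ≠ 0 := by
    by_contra! h
    obtain ⟨h1, h2⟩ := eq_of_natDegree_hermitePoly j
    have hz : hermitePoly j = 0 := by
      refine Polynomial.funext fun x => ?_
      have := h (x / β)
      rw [hfe, mul_div_cancel₀ _ hβ0.ne'] at this
      simpa [Real.exp_ne_zero] using this
    rw [hz] at h2
    simp at h2
    exact absurd h2.symm (by positivity)
  have hpos : 0 < ∫ y, f y := by
    rw [integral_pos_iff_support_of_nonneg hnn hint]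
    exact (hcont.isOpen_support).measure_pos _ ⟨y₀, hy₀⟩
  rw [h1]
  exact_mod_cast hpos.ne'

/-- The coefficient of `y ↦ h_j (β y)` in the Hermite expansion of `v`. -/
def hermiteCoeff (β : ℝ) (j : ℕ) (v : ℝ → ℂ) : ℂ :=
  (hermitePairing β j (scaledHermite β j))⁻¹ * hermitePairing β j v

theorem exists_norm_hermiteCoeff_le (c s k C₀ β : ℝ) (j : ℕ) {q : ℝ} (hq : 0 < q) :
    ∃ C > 0, ∀ w, AdmissibleWeight c s k q C₀ w → ∀ (v : ℝ → ℂ) (M : ℝ), 0 ≤ M →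
      (∀ y, ‖v y‖ ≤ M * w y) → ‖hermiteCoeff β j v‖ ≤ C * M := by
  obtain ⟨C, hC0, hC⟩ := exists_norm_hermitePairing_le β j hq
  refine ⟨(‖(hermitePairing β j (scaledHermite β j))⁻¹‖ + 1) * (C * 2), by positivity,
    fun w hw v M hM0 hM => ?_⟩
  have := hC v (2 * M) (by positivity) (hw.norm_le_exp hM0 hM)
  rw [hermiteCoeff, norm_mul]
  calc _ ≤ (‖(hermitePairing β j (scaledHermite β j))⁻¹‖ + 1) * (C * (2 * M)) := by
        gcongr; linarith
    _ = _ := by ring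

/-- The coefficient functional is a left eigenvector. A small residual therefore forces a small
coefficient unless μ is near λ_j. -/
theorem hermiteCoeff_gaussOp_sub {c s k q C₀ β : ℝ} (hc : 1 < |c|) (hs : 0 < s) (hβ0 : 0 < β)
    (hβ : c ^ 2 - 1 = 2 * β ^ 2 * s ^ 2) (j : ℕ) (hq : 0 < q) (hC₀ : 0 ≤ C₀) {w : ℝ → ℝ}
    (hw : AdmissibleWeight c s k q C₀ w) {v : ℝ → ℂ} (hv : Measurable v) {M : ℝ} (hM0 : 0 ≤ M)
    (hM : ∀ y, ‖v y‖ ≤ M * w y) (μ : ℂ) :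
    hermiteCoeff β j (fun y => gaussOp c s v y - μ * v y)
      = (limitEigenvalue c j - μ) * hermiteCoeff β j v := by
  have h1 := hw.norm_le_exp hM0 hM
  have h2 := hw.norm_le_exp (by positivity) (hw.norm_gaussOp_le hq.le hM0 hM)
  have h3 : ∀ y, ‖μ * v y‖ ≤ (‖μ‖ * (2 * M)) * Real.exp (-q * y ^ 2) := fun y => by
    rw [norm_mul, mul_assoc]
    exact mul_le_mul_of_nonneg_left (h1 y) (norm_nonneg _)
  unfold hermiteCoeff
  rw [hermitePairing_sub β j hq (measurable_gaussOp c s hv) (hv.const_mul μ) h2 h3,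
    hermitePairing_gaussOp hc hs hβ0 hβ j hq hv (by positivity) h1, hermitePairing_const_mul]
  ring

/-- J is taken with |c|^{-J} < r/2. The part u of v orthogonal to H_0, …, H_{J-1} is again an
approximate eigenfunction; a high power of the operator contracts it like (r/2)^{n+1} while
reproducing it like μ^{n+1}, up to the error. As |μ| > r, u is controlled by half of its own bound
plus the error. -/
theorem exists_hermite_expansion_bound {c s k q C₀ β r : ℝ} (hc : 1 < |c|) (hs : 0 < s)
    (hβ0 : 0 < β) (hβ : c ^ 2 - 1 = 2 * β ^ 2 * s ^ 2) (hq : 0 < q) (hk : k ≤ β ^ 2 / 4)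
    (hC₀ : 0 ≤ C₀) (hr : 0 < r) :
    ∃ (J : ℕ) (C : ℝ), 0 < C ∧ ∀ w, AdmissibleWeight c s k q C₀ w →
      ∀ (v : ℝ → ℂ) (μ : ℂ) (M η : ℝ), Measurable v → 0 ≤ M → 0 ≤ η → (∀ y, ‖v y‖ ≤ M * w y) →
      r < ‖μ‖ → ‖μ‖ ≤ 1 → (∀ y, ‖gaussOp c s v y - μ * v y‖ ≤ η * M * w y) →
      (∀ j < J, ‖μ - limitEigenvalue c j‖ * ‖hermiteCoeff β j v‖ ≤ C * (η * M)) ∧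
      ∀ y, ‖v y - ∑ j ∈ Finset.range J, hermiteCoeff β j v * scaledHermite β j y‖
        ≤ C * (η * M) * w y := by
  have hc1 : |c|⁻¹ < 1 := inv_lt_one_of_one_lt₀ hc
  have hcpos : 0 < |c| := by linarith
  obtain ⟨J, hJ⟩ : ∃ J : ℕ, (|c|⁻¹) ^ J < r / 2 := exists_pow_lt_of_lt_one (by positivity) hc1
  have hJ' : (|c|⁻¹) ^ (J + 1) ≤ r / 2 :=
    (pow_le_pow_of_le_one (by positivity) hc1.le (Nat.le_succ J)).trans hJ.le
  obtain ⟨A, hA0, hA⟩ := exists_norm_gaussOp_le_of_orthogonal J hβ0 hq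
  choose Cm hCm0 hCm using fun j => exists_norm_hermiteCoeff_le c s k C₀ β j hq
  choose Ch hCh0 hCh using exists_norm_scaledHermite_le β
  -- a large number of steps
  obtain ⟨n, hn1, hn2, hn3⟩ : ∃ n : ℕ, A * 2 * (1 / 2) ^ (n + 1) ≤ 1 / 2 ∧
      2 ≤ (c ^ (n + 1)) ^ 2 ∧ 2 * β ^ 2 / (c ^ (n + 1)) ^ 2 ≤ q := by
    have t1 : Filter.Tendsto (fun n : ℕ => A * 2 * (1 / 2 : ℝ) ^ (n + 1)) Filter.atTop
        (nhds (A * 2 * 0)) :=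
      (((tendsto_pow_atTop_nhds_zero_of_lt_one (by norm_num) (by norm_num)).comp
        (Filter.tendsto_add_atTop_nat 1)).const_mul _)
    have t2 : Filter.Tendsto (fun n : ℕ => (c ^ (n + 1)) ^ 2) Filter.atTop Filter.atTop := by
      have : ∀ n : ℕ, (c ^ (n + 1)) ^ 2 = (c ^ 2) ^ (n + 1) := fun n => by ring
      simp only [this]
      have hc2 : 1 < c ^ 2 := by
        rw [← sq_abs]; exact one_lt_pow₀ hc (by norm_num)
      exact (tendsto_pow_atTop_atTop_of_one_lt hc2).comp (Filter.tendsto_add_atTop_nat 1)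
    have e1 := t1.eventually_le_const (show A * 2 * 0 < 1 / 2 by norm_num)
    have e2 := t2.eventually_ge_atTop 2
    have e3 := t2.eventually_ge_atTop (2 * β ^ 2 / q)
    obtain ⟨n, h1, h2, h3⟩ := (e1.and (e2.and e3)).exists
    refine ⟨n, h1, h2, ?_⟩
    rw [div_le_iff₀ (by linarith)]
    rw [div_le_iff₀ hq] at h3
    linarith
  obtain ⟨t, ht0, ht, htn⟩ := exists_gaussOp_iterate hs hβ n
  obtain ⟨D, hD0, hD⟩ := AdmissibleWeight.exists_norm_iterate_sub_le c s k q C₀ hq.le hC₀ (n + 1)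
  set C1 : ℝ := 1 + ∑ j ∈ Finset.range J, Cm j * Ch j with hC1
  have hC1p : 0 < C1 := by
    have : 0 ≤ ∑ j ∈ Finset.range J, Cm j * Ch j :=
      Finset.sum_nonneg fun j _ => (mul_pos (hCm0 j) (hCh0 j)).le
    linarith
  set C2 : ℝ := 2 * (D * C1 / r ^ (n + 1)) with hC2
  have hC2p : 0 < C2 := by positivity
  set C3 : ℝ := ∑ j ∈ Finset.range J, Cm j with hC3
  have hC3p : 0 ≤ C3 := Finset.sum_nonneg fun j _ => (hCm0 j).le
  refine ⟨J, C2 + C3, by positivity, fun w hw v μ M η hv hM0 hη hM hμr hμ1 he => ?_⟩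
  set m : ℕ → ℂ := fun j => hermiteCoeff β j v with hm
  set h : ℕ → ℝ → ℂ := scaledHermite β with hh
  have hhw : ∀ j y, ‖h j y‖ ≤ Ch j * w y := fun j y => by
    refine (hCh j y).trans (mul_le_mul_of_nonneg_left (le_trans ?_ (hw.lower y)) (hCh0 j).le)
    apply Real.exp_le_exp.2
    nlinarith [sq_nonneg y]
  have hml : ∀ j, ‖μ - limitEigenvalue c j‖ * ‖m j‖ ≤ Cm j * (η * M) := fun j => by
    have h1 := hCm j w hw _ (η * M) (by positivity) he
    rw [hermiteCoeff_gaussOp_sub hc hs hβ0 hβ j hq hC₀ hw hv hM0 hM, norm_mul, norm_sub_rev] at h1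
    exact h1
  refine ⟨fun j hj => (hml j).trans ?_, ?_⟩
  · have : Cm j ≤ C3 := Finset.single_le_sum (f := Cm) (fun i _ => (hCm0 i).le)
      (Finset.mem_range.2 hj)
    exact mul_le_mul_of_nonneg_right (by linarith) (by positivity)
  set u : ℝ → ℂ := fun y => v y - ∑ j ∈ Finset.range J, m j * h j y with hu
  have hhm : ∀ j, Measurable (h j) := fun j => (continuous_scaledHermite β j).measurable
  have hum : Measurable u :=
    hv.sub (Finset.measurable_sum _ fun j _ => (hhm j).const_mul _)
  set U₀ : ℝ := M + ∑ j ∈ Finset.range J, ‖m j‖ * Ch j with hU₀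
  have hU₀p : 0 ≤ U₀ := add_nonneg hM0
    (Finset.sum_nonneg fun j _ => mul_nonneg (norm_nonneg _) (hCh0 j).le)
  have hub : ∀ y, ‖u y‖ ≤ U₀ * w y := fun y => by
    refine (norm_sub_le _ _).trans ?_
    rw [hU₀, add_mul, Finset.sum_mul]
    refine add_le_add (hM y) ((norm_sum_le _ _).trans (Finset.sum_le_sum fun j _ => ?_))
    rw [norm_mul, mul_assoc]
    exact mul_le_mul_of_nonneg_left (hhw j y) (norm_nonneg _)
  -- integrability helpers
  have hvi : ∀ y, Integrable (fun z => v (c * y + s * z)) stdNormal := fun y =>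
    integrable_stdNormal_affine _ _ hv.stronglyMeasurable (hw.norm_le_const hq.le hM0 hM)
  have hhi : ∀ j y, Integrable (fun z => m j * h j (c * y + s * z)) stdNormal := fun j y =>
    (integrable_stdNormal_affine _ _ (hhm j).stronglyMeasurable
      (hw.norm_le_const hq.le (hCh0 j).le (hhw j))).const_mul _
  have hTu : ∀ y, gaussOp c s u y - μ * u y = (gaussOp c s v y - μ * v y)
      + ∑ j ∈ Finset.range J, (μ - limitEigenvalue c j) * m j * h j y := by
    intro y
    have h1 : gaussOp c s u y = gaussOp c s v y
        - ∑ j ∈ Finset.range J, m j * (limitEigenvalue c j * h j y) := by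
      have h2 : ∀ j, ∫ z, m j * h j (c * y + s * z) ∂stdNormal
          = m j * (limitEigenvalue c j * h j y) := fun j => by
        rw [integral_const_mul, ← gaussOp_scaledHermite hc hβ0 hβ j y]; rfl
      unfold gaussOp
      simp only [hu]
      rw [integral_sub (hvi y) (integrable_finsetSum _ fun j _ => hhi j y),
        integral_finsetSum _ fun j _ => hhi j y]
      simp only [h2]
    rw [h1]
    simp only [hu, mul_sub, sub_mul, Finset.mul_sum, Finset.sum_sub_distrib]
    have e1 : ∀ j, m j * ((limitEigenvalue c j : ℂ) * h j y)
        = (limitEigenvalue c j : ℂ) * m j * h j y := fun j => by ring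
    simp only [e1, mul_assoc]
    ring
  have hTub : ∀ y, ‖gaussOp c s u y - μ * u y‖ ≤ (C1 * (η * M)) * w y := by
    intro y
    rw [hTu y]
    refine (norm_add_le _ _).trans ?_
    rw [hC1]
    have e : (1 + ∑ j ∈ Finset.range J, Cm j * Ch j) * (η * M) * w y
        = η * M * w y + ∑ j ∈ Finset.range J, (Cm j * (η * M)) * (Ch j * w y) := by
      rw [add_mul, add_mul, one_mul, Finset.sum_mul, Finset.sum_mul]
      congr 1
      exact Finset.sum_congr rfl fun j _ => by ring
    rw [e]
    refine add_le_add (he y) ((norm_sum_le _ _).trans (Finset.sum_le_sum fun j _ => ?_))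
    rw [norm_mul, norm_mul]
    exact mul_le_mul (hml j) (hhw j y) (norm_nonneg _) (mul_nonneg (hCm0 j).le (by positivity))
  have horth : ∀ j < J, hermitePairing β j u = 0 := by
    intro j hj
    have hne := hermitePairing_scaledHermite_self_ne_zero hβ0 j
    have hi1 : ∀ i, Integrable (fun y => (((hermitePoly j).eval (β * y) : ℝ) : ℂ)
        * (m i * h i y)) := fun i => by
      have := (integrable_poly_mul (hermitePoly j) β hq (hhm i)
        (hw.norm_le_exp (hCh0 i).le (hhw i))).const_mul (m i)
      refine this.congr (Filter.Eventually.of_forall fun y => ?_)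
      simp only []; ring
    have h1 : hermitePairing β j u = hermitePairing β j v
        - ∑ i ∈ Finset.range J, m i * hermitePairing β j (h i) := by
      have h2 : ∀ i, ∫ y, (((hermitePoly j).eval (β * y) : ℝ) : ℂ) * (m i * h i y)
          = m i * hermitePairing β j (h i) := fun i => hermitePairing_const_mul β j (m i) (h i)
      simp only [← h2]
      unfold hermitePairing
      simp only [hu, mul_sub, Finset.mul_sum]
      rw [integral_sub (integrable_poly_mul _ β hq hv (hw.norm_le_exp hM0 hM))
        (integrable_finsetSum _ fun i _ => hi1 i), integral_finsetSum _ fun i _ => hi1 i]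
    rw [h1, Finset.sum_eq_single j]
    · simp only [hm, hermiteCoeff, hh]
      rw [mul_comm (_⁻¹), mul_assoc, inv_mul_cancel₀ hne, mul_one, sub_self]
    · intro i _ hij
      simp only [hh]
      rw [hermitePairing_scaledHermite_of_ne hc hs hβ0 hβ hij.symm, mul_zero]
    · intro hj'; exact absurd (Finset.mem_range.2 hj) hj'
  have hr1 : r ^ (n + 1) ≤ ‖μ‖ ^ (n + 1) := pow_le_pow_left₀ hr.le hμr.le _
  have hrp : 0 < r ^ (n + 1) := by positivity
  have hfin := norm_le_of_halving (u := u) (w := w) (b := D * C1 / r ^ (n + 1) * (η * M)) hw.pos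
    hU₀p hub (by positivity) ?_
  · intro y
    refine (hfin y).trans ?_
    refine mul_le_mul_of_nonneg_right ?_ (hw.pos y).le
    rw [hC2]
    have : 0 ≤ C3 * (η * M) := by positivity
    nlinarith
  intro U hU0 hU y
  have h1 := (hD w hw u μ U (C1 * (η * M)) hum hU0 (by positivity) hU hμ1 hTub).2 y
  rw [htn u (U * 2) hum (hw.norm_le_const hq.le hU0 hU)] at h1
  have h2 := hA (c ^ (n + 1)) t ht0 ht hn2 hn3 u (2 * U) hum (by positivity)
    (hw.norm_le_exp hU0 hU) horth y
  have h3 : Real.exp (-(β ^ 2 / 4) * y ^ 2) ≤ w y := by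
    refine le_trans ?_ (hw.lower y)
    apply Real.exp_le_exp.2; nlinarith [sq_nonneg y]
  -- The factor r per step is matched by |μ|; the factor 1/2 per step pays, by the choice of n, for
  -- the constant of the contraction estimate.
  have h4 : (|c ^ (n + 1)|⁻¹) ^ (J + 1) ≤ r ^ (n + 1) * (1 / 2) ^ (n + 1) := by
    rw [abs_pow, ← inv_pow, ← pow_mul, mul_comm (n + 1), pow_mul, ← mul_pow]
    exact pow_le_pow_left₀ (by positivity) (by linarith) _
  have h5 : ‖gaussOp (c ^ (n + 1)) t u y‖ ≤ r ^ (n + 1) * (U / 2) * w y := by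
    refine h2.trans ?_
    calc A * (|c ^ (n + 1)|⁻¹) ^ (J + 1) * (2 * U) * Real.exp (-(β ^ 2 / 4) * y ^ 2)
        ≤ A * (r ^ (n + 1) * (1 / 2) ^ (n + 1)) * (2 * U) * w y := by gcongr
      _ = r ^ (n + 1) * U * w y * (A * 2 * (1 / 2) ^ (n + 1)) := by ring
      _ ≤ r ^ (n + 1) * U * w y * (1 / 2) := by
          have := (hw.pos y).le
          gcongr
      _ = _ := by ring
  have h6 : ‖μ ^ (n + 1) * u y‖ ≤ r ^ (n + 1) * (U / 2) * w y + D * (C1 * (η * M)) * w y := by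
    have : μ ^ (n + 1) * u y = gaussOp (c ^ (n + 1)) t u y
        - (gaussOp (c ^ (n + 1)) t u y - μ ^ (n + 1) * u y) := by ring
    rw [this]
    exact (norm_sub_le _ _).trans (add_le_add h5 h1)
  rw [norm_mul, norm_pow] at h6
  have h7 : r ^ (n + 1) * ‖u y‖ ≤ r ^ (n + 1) * ((U / 2 + D * C1 / r ^ (n + 1) * (η * M)) * w y) := by
    refine (mul_le_mul_of_nonneg_right hr1 (norm_nonneg _)).trans (h6.trans (le_of_eq ?_))
    field_simp
  exact le_of_mul_le_mul_left h7 hrp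

/-- An approximate eigenfunction, with relative error `η`, is dominated by a single Hermite
function, and its approximate eigenvalue is close to the corresponding eigenvalue. -/
theorem exists_hermite_dominates {c s k q C₀ β r : ℝ} (hc : 1 < |c|) (hs : 0 < s)
    (hβ0 : 0 < β) (hβ : c ^ 2 - 1 = 2 * β ^ 2 * s ^ 2) (hq : 0 < q) (hk : k ≤ β ^ 2 / 4)
    (hC₀ : 0 ≤ C₀) (hr : 0 < r) :
    ∃ (J : ℕ) (C η₀ g : ℝ), 0 < C ∧ 0 < η₀ ∧ 0 < g ∧ ∀ w, AdmissibleWeight c s k q C₀ w →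
      ∀ (v : ℝ → ℂ) (μ : ℂ) (η : ℝ), Measurable v → 0 ≤ η → η ≤ η₀ →
      (∃ M, 0 ≤ M ∧ ∀ y, ‖v y‖ ≤ M * w y) → (∃ y, v y ≠ 0) → r < ‖μ‖ → ‖μ‖ ≤ 1 →
      (∀ M, 0 ≤ M → (∀ y, ‖v y‖ ≤ M * w y) →
        ∀ y, ‖gaussOp c s v y - μ * v y‖ ≤ η * M * w y) →
      ∃ j < J, hermiteCoeff β j v ≠ 0 ∧ ‖μ - limitEigenvalue c j‖ ≤ C * η ∧
        (∀ y, ‖v y - hermiteCoeff β j v * scaledHermite β j y‖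
          ≤ C * η * ‖hermiteCoeff β j v‖ * w y) ∧
        ∀ i < J, ‖μ - limitEigenvalue c i‖ < g → i = j := by
  obtain ⟨J, C1, hC1, hexp⟩ := exists_hermite_expansion_bound hc hs hβ0 hβ hq hk hC₀ hr
  obtain ⟨g, hg, hgap⟩ := exists_limitEigenvalue_gap hc J
  choose Ch' hCh0' hCh' using exists_norm_scaledHermite_le β
  obtain ⟨Ch, hCh0, hChle⟩ : ∃ Ch > 0, ∀ j < J, Ch' j ≤ Ch :=
    ⟨1 + ∑ j ∈ Finset.range J, Ch' j, by
      have : 0 ≤ ∑ j ∈ Finset.range J, Ch' j := Finset.sum_nonneg fun j _ => (hCh0' j).le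
      linarith, fun j hj => by
      have := Finset.single_le_sum (f := Ch') (fun i _ => (hCh0' i).le) (Finset.mem_range.2 hj)
      linarith⟩
  set B : ℝ := 2 * (Ch * (J + 1)) with hB
  have hB0 : 0 < B := by positivity
  set C2 : ℝ := C1 * B with hC2
  have hC20 : 0 < C2 := by positivity
  set C3 : ℝ := C2 + J * (2 / g * C2 * Ch) with hC3
  have hC3' : C2 ≤ C3 := by
    have : 0 ≤ (J : ℝ) * (2 / g * C2 * Ch) := by positivity
    linarith
  -- The first bound on η makes the halving argument work; the second puts μ within g/2 of its λ_j,
  -- hence at distance at least g/2 from the other λ_i with i < J.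
  refine ⟨J, C3, min (1 / (2 * C1)) (g / (2 * C2)), g / 2, by linarith,
    lt_min (by positivity) (by positivity), by positivity, ?_⟩
  intro w hw v μ η hv hη0 hη hMex hv0 hμr hμ1 he
  have hη1 : C1 * η ≤ 1 / 2 := by
    have := hη.trans (min_le_left _ _)
    rw [le_div_iff₀ (by positivity)] at this
    linarith
  have hη2 : C2 * η ≤ g / 2 := by
    have := hη.trans (min_le_right _ _)
    rw [le_div_iff₀ (by positivity)] at this
    linarith
  set m : ℕ → ℂ := fun j => hermiteCoeff β j v with hm
  set h : ℕ → ℝ → ℂ := scaledHermite β with hh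
  have hhw : ∀ j < J, ∀ y, ‖h j y‖ ≤ Ch * w y := fun j hj y => by
    refine (hCh' j y).trans (mul_le_mul (hChle j hj) (le_trans ?_ (hw.lower y))
      (Real.exp_pos _).le hCh0.le)
    apply Real.exp_le_exp.2
    nlinarith [sq_nonneg y]
  obtain ⟨M₀, hM₀, hM₀b⟩ := hMex
  have hb0 : 0 ≤ ∑ j ∈ Finset.range J, ‖m j‖ * Ch :=
    Finset.sum_nonneg fun j _ => mul_nonneg (norm_nonneg _) hCh0.le
  -- The bound M on v is replaced by one in terms of the Hermite coefficients alone.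
  have hvb := norm_le_of_halving (u := v) (w := w) (b := ∑ j ∈ Finset.range J, ‖m j‖ * Ch) hw.pos
    hM₀ hM₀b hb0 (by
      intro M hM0 hM y
      have h1 := (hexp w hw v μ M η hv hM0 hη0 hM hμr hμ1 (he M hM0 hM)).2 y
      have h2 : ‖∑ j ∈ Finset.range J, m j * h j y‖
          ≤ (∑ j ∈ Finset.range J, ‖m j‖ * Ch) * w y := by
        rw [Finset.sum_mul]
        refine (norm_sum_le _ _).trans (Finset.sum_le_sum fun j hj => ?_)
        rw [norm_mul, mul_assoc]
        exact mul_le_mul_of_nonneg_left (hhw j (Finset.mem_range.1 hj) y) (norm_nonneg _)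
      have h3 : v y = (v y - ∑ j ∈ Finset.range J, m j * h j y)
        + ∑ j ∈ Finset.range J, m j * h j y := by ring
      rw [h3]
      refine (norm_add_le _ _).trans ((add_le_add h1 h2).trans ?_)
      rw [← add_mul]
      refine mul_le_mul_of_nonneg_right ?_ (hw.pos y).le
      nlinarith)
  obtain ⟨y₀, hy₀⟩ := hv0
  have hJ : (Finset.range J).Nonempty := by
    rw [Finset.nonempty_iff_ne_empty]
    intro hempty
    have := hvb y₀
    rw [hempty] at this
    simp at this
    exact hy₀ this
  -- For the largest coefficient the error is O(η) relative to that coefficient itself, so |μ - λ_j|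
  -- = O(η); then the gap makes every other coefficient O(η) relative to it.
  obtain ⟨j, hj, hmax⟩ := Finset.exists_max_image (Finset.range J) (fun j => ‖m j‖) hJ
  have hjJ := Finset.mem_range.1 hj
  have hvj : ∀ y, ‖v y‖ ≤ (B * ‖m j‖) * w y := fun y => by
    refine (hvb y).trans (mul_le_mul_of_nonneg_right ?_ (hw.pos y).le)
    have h1 : ∑ i ∈ Finset.range J, ‖m i‖ * Ch ≤ ∑ _i ∈ Finset.range J, ‖m j‖ * Ch :=
      Finset.sum_le_sum fun i hi => mul_le_mul_of_nonneg_right (hmax i hi) hCh0.le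
    rw [Finset.sum_const, Finset.card_range, nsmul_eq_mul] at h1
    have : 0 ≤ ‖m j‖ * Ch := by positivity
    rw [hB]; nlinarith
  have hmj : m j ≠ 0 := by
    intro h0
    have := hvj y₀
    rw [h0, norm_zero, mul_zero, zero_mul] at this
    exact hy₀ (norm_le_zero_iff.1 this)
  have hmjp : 0 < ‖m j‖ := norm_pos_iff.2 hmj
  obtain ⟨hA, hBd⟩ := hexp w hw v μ (B * ‖m j‖) η hv (by positivity) hη0 hvj hμr hμ1
    (he _ (by positivity) hvj)
  have hnear : ‖μ - limitEigenvalue c j‖ ≤ C2 * η := by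
    have := hA j hjJ
    have e : C1 * (η * (B * ‖m j‖)) = (C2 * η) * ‖m j‖ := by rw [hC2]; ring
    rw [e] at this
    exact le_of_mul_le_mul_right this hmjp
  have hfar : ∀ i < J, i ≠ j → g / 2 ≤ ‖μ - limitEigenvalue c i‖ := by
    intro i hi hij
    have h1 := hgap i hi j hjJ hij
    have h2 : ‖((limitEigenvalue c i : ℂ)) - limitEigenvalue c j‖
        = |limitEigenvalue c i - limitEigenvalue c j| := by
      rw [← Complex.ofReal_sub, Complex.norm_real, Real.norm_eq_abs]
    have h3 : ((limitEigenvalue c i : ℂ)) - limitEigenvalue c j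
        = (μ - limitEigenvalue c j) - (μ - limitEigenvalue c i) := by ring
    have h4 := norm_sub_le (μ - (limitEigenvalue c j : ℂ)) (μ - limitEigenvalue c i)
    rw [← h3, h2] at h4
    linarith
  refine ⟨j, hjJ, hmj, hnear.trans (by gcongr), fun y => ?_, fun i hi hlt => ?_⟩
  · have hmi : ∀ i < J, i ≠ j → ‖m i‖ ≤ 2 / g * (C2 * η * ‖m j‖) := by
      intro i hi hij
      have h1 := hA i hi
      have h2 := hfar i hi hij
      have e : C1 * (η * (B * ‖m j‖)) = C2 * η * ‖m j‖ := by rw [hC2]; ring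
      rw [e] at h1
      have h3 : g / 2 * ‖m i‖ ≤ C2 * η * ‖m j‖ :=
        (mul_le_mul_of_nonneg_right h2 (norm_nonneg _)).trans h1
      rw [div_mul_eq_mul_div, le_div_iff₀ hg]
      linarith
    have hsplit : v y - m j * h j y = (v y - ∑ i ∈ Finset.range J, m i * h i y)
        + ∑ i ∈ (Finset.range J).erase j, m i * h i y := by
      rw [← Finset.add_sum_erase _ _ hj]; ring
    rw [hsplit]
    have h1 : ‖∑ i ∈ (Finset.range J).erase j, m i * h i y‖
        ≤ J * (2 / g * (C2 * η * ‖m j‖) * (Ch * w y)) := by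
      refine (norm_sum_le_of_le _ (f := fun i => m i * h i y)
        (n := fun _ => 2 / g * (C2 * η * ‖m j‖) * (Ch * w y)) fun i hi => ?_).trans ?_
      · have hi' := Finset.mem_erase.1 hi
        rw [norm_mul]
        exact mul_le_mul (hmi i (Finset.mem_range.1 hi'.2) hi'.1)
          (hhw i (Finset.mem_range.1 hi'.2) y) (norm_nonneg _) (by positivity)
      · rw [Finset.sum_const, nsmul_eq_mul]
        have : (((Finset.range J).erase j).card : ℝ) ≤ J := by
          have := Finset.card_erase_le (s := Finset.range J) (a := j)
          rw [Finset.card_range] at this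
          exact_mod_cast this
        have := (hw.pos y).le
        gcongr
    refine (norm_add_le _ _).trans ((add_le_add (hBd y) h1).trans (le_of_eq ?_))
    rw [hC3, hC2]; ring
  · by_contra hij
    exact absurd (hfar i hi hij) (not_le.2 hlt)

/-! ### Robust escape along pseudo-orbits -/

section Escape

variable {X : Type*} [PseudoMetricSpace X]

/-- The points from which every `θ`-pseudo-orbit of length `n` visits the complement of `V`. -/
def escapeSet (f : X → X) (V : Set X) (θ : ℝ) : ℕ → Set X
  | 0 => Vᶜ
  | n + 1 => Vᶜ ∪ {x | Metric.closedBall (f x) θ ⊆ escapeSet f V θ n}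

theorem escapeSet_anti (f : X → X) (V : Set X) {θ θ' : ℝ} (h : θ ≤ θ') (n : ℕ) :
    escapeSet f V θ' n ⊆ escapeSet f V θ n := by
  induction n with
  | zero => exact le_rfl
  | succ n ih =>
    exact Set.union_subset_union_right _ fun x hx =>
      ((Metric.closedBall_subset_closedBall h).trans hx).trans ih

theorem escapeSet_subset_succ (f : X → X) (V : Set X) (θ : ℝ) (n : ℕ) :
    escapeSet f V θ n ⊆ escapeSet f V θ (n + 1) := by
  induction n with
  | zero => exact Set.subset_union_left
  | succ n ih =>
    exact Set.union_subset_union_right _ fun x hx => Set.Subset.trans hx ih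

theorem escapeSet_mono (f : X → X) (V : Set X) (θ : ℝ) {m n : ℕ} (h : m ≤ n) :
    escapeSet f V θ m ⊆ escapeSet f V θ n :=
  monotone_nat_of_le_succ (f := escapeSet f V θ) (escapeSet_subset_succ f V θ) h

/-- If the true orbit enters the interior of the complement at time n, continuity gives room for a
small error at each of the n steps: r/3 for moving the starting point and r/3 for the noise. -/
theorem exists_mem_nhds_subset_escapeSet {f : X → X} (hf : Continuous f) (V : Set X) (n : ℕ) :
    ∀ x, f^[n] x ∈ interior Vᶜ → ∃ θ > 0, escapeSet f V θ n ∈ nhds x := by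
  induction n with
  | zero =>
    exact fun x hx => ⟨1, one_pos, mem_interior_iff_mem_nhds.1 hx⟩
  | succ n ih =>
    intro x hx
    rw [Function.iterate_succ_apply] at hx
    obtain ⟨θ', hθ', hn⟩ := ih (f x) hx
    obtain ⟨r, hr, hb⟩ := Metric.mem_nhds_iff.1 hn
    refine ⟨min θ' (r / 3), lt_min hθ' (by positivity), ?_⟩
    have h1 : f ⁻¹' Metric.ball (f x) (r / 3) ∈ nhds x :=
      hf.continuousAt.preimage_mem_nhds (Metric.ball_mem_nhds _ (by positivity))
    refine Filter.mem_of_superset h1 fun y hy => Or.inr fun z hz => ?_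
    refine escapeSet_anti f V (min_le_left _ _) n (hb ?_)
    rw [Metric.mem_ball]
    have h2 : dist z (f y) ≤ r / 3 := (Metric.mem_closedBall.1 hz).trans (min_le_right _ _)
    have h3 : dist (f y) (f x) < r / 3 := hy
    have := dist_triangle z (f y) (f x)
    linarith

theorem IsCompact.exists_subset_escapeSet {f : X → X} (hf : Continuous f) (V : Set X) {K : Set X}
    (hK : IsCompact K) (h : ∀ x ∈ K, ∃ n, f^[n] x ∈ interior Vᶜ) :
    ∃ n : ℕ, ∃ θ > 0, K ⊆ escapeSet f V θ n := by
  refine hK.induction_on (p := fun s => ∃ n : ℕ, ∃ θ > 0, s ⊆ escapeSet f V θ n)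
    ⟨0, 1, one_pos, Set.empty_subset _⟩ ?_ ?_ ?_
  · rintro s t hst ⟨n, θ, hθ, ht⟩
    exact ⟨n, θ, hθ, hst.trans ht⟩
  · rintro s t ⟨n, θ, hθ, hs⟩ ⟨n', θ', hθ', ht⟩
    refine ⟨max n n', min θ θ', lt_min hθ hθ', Set.union_subset ?_ ?_⟩
    · exact (hs.trans (escapeSet_anti f V (min_le_left _ _) n)).trans
        (escapeSet_mono f V _ (le_max_left _ _))
    · exact (ht.trans (escapeSet_anti f V (min_le_right _ _) n')).trans
        (escapeSet_mono f V _ (le_max_right _ _))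
  · intro x hx
    obtain ⟨n, hn⟩ := h x hx
    obtain ⟨θ, hθ, hs⟩ := exists_mem_nhds_subset_escapeSet hf V n x hn
    exact ⟨_, mem_nhdsWithin_of_mem_nhds hs, n, θ, hθ, le_rfl⟩

end Escape

/-- The exponential Markov inequality in pointwise form: it lets the event |z| ≥ b enter an
expectation at the cost exp(-b²/4) E exp(χ²/4). -/
theorem one_le_exp_of_le_abs {b z : ℝ} (hb : 0 ≤ b) (h : b ≤ |z|) :
    1 ≤ Real.exp (-(b ^ 2 / 4)) * Real.exp (z ^ 2 / 4) := by
  rw [← Real.exp_add]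
  apply Real.one_le_exp
  have := pow_le_pow_left₀ hb h 2
  rw [sq_abs] at this
  linarith

theorem S1.norm_coe_le_abs (x : ℝ) : ‖(x : S1)‖ ≤ |x| := QuotientAddGroup.norm_mk_le_norm

/-! ### The block operator on the ball -/

namespace NoisyCircleMap

variable (S : NoisyCircleMap) (ε : ℝ) (a : S1) (δ : ℝ)

/-- The extension by zero of a function on the ball to the circle. -/
abbrev ext0 (a : S1) (δ : ℝ) (φ : BddMeas (Metric.ball a δ)) : S1 → ℂ :=
  (extendByZero (Metric.ball a δ) measurableSet_ball φ).1

theorem ext0_of_mem (φ : BddMeas (Metric.ball a δ)) {x : S1} (hx : x ∈ Metric.ball a δ) :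
    ext0 a δ φ x = φ.1 ⟨x, hx⟩ := dif_pos hx

theorem ext0_of_notMem (φ : BddMeas (Metric.ball a δ)) {x : S1} (hx : x ∉ Metric.ball a δ) :
    ext0 a δ φ x = 0 := dif_neg hx

theorem measurable_ext0 (φ : BddMeas (Metric.ball a δ)) : Measurable (ext0 a δ φ) :=
  (extendByZero (Metric.ball a δ) measurableSet_ball φ).2.1

theorem localBlock_apply (φ : BddMeas (Metric.ball a δ)) (x : Metric.ball a δ) :
    (S.localBlock ε a δ φ).1 x = ∫ z, ext0 a δ φ (S.step ε x z) ∂stdNormal := rfl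

theorem norm_ext0_le {φ : BddMeas (Metric.ball a δ)} {M : ℝ} (hM0 : 0 ≤ M)
    (hM : ∀ x, ‖φ.1 x‖ ≤ M) (x : S1) : ‖ext0 a δ φ x‖ ≤ M := by
  by_cases hx : x ∈ Metric.ball a δ
  · rw [ext0_of_mem a δ φ hx]; exact hM _
  · rw [ext0_of_notMem a δ φ hx, norm_zero]; exact hM0

theorem norm_localBlock_pow_le {φ : BddMeas (Metric.ball a δ)} {M : ℝ} (hM0 : 0 ≤ M)
    (hM : ∀ x, ‖φ.1 x‖ ≤ M) (n : ℕ) : ∀ x, ‖((S.localBlock ε a δ ^ n) φ).1 x‖ ≤ M := by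
  induction n with
  | zero => exact hM
  | succ n ih =>
    intro x
    rw [pow_succ', Module.End.mul_apply, localBlock_apply]
    have := norm_integral_le_of_norm_le_const (μ := stdNormal)
      (Filter.Eventually.of_forall fun z => norm_ext0_le a δ hM0 ih (S.step ε x z))
    simpa using this

theorem dist_step_le (hε : 0 ≤ ε) {B : ℝ} (hB : ∀ x, S.σ x ≤ B) (x : S1) (z : ℝ) :
    dist (S.step ε x z) (S.f x) ≤ ε * B * |z| := by
  rw [step, dist_eq_norm, add_sub_cancel_left]
  refine (S1.norm_coe_le_abs _).trans ?_
  have := (S.σ_pos x).le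
  rw [abs_mul, abs_mul, abs_of_nonneg hε, abs_of_nonneg this]
  have := hB x
  gcongr

/-- A block function started in an escape set is killed up to an exponentially small error. -/
theorem norm_localBlock_pow_le_of_mem_escapeSet {ε B θ : ℝ} (hε : 0 < ε) (hB0 : 0 < B)
    (hB : ∀ x, S.σ x ≤ B) (hθ : 0 ≤ θ) {φ : BddMeas (Metric.ball a δ)} {M : ℝ} (hM0 : 0 ≤ M)
    (hM : ∀ x, ‖φ.1 x‖ ≤ M) (n : ℕ) : ∀ x : Metric.ball a δ,
      x.1 ∈ escapeSet S.f (Metric.ball a δ) θ n → ‖((S.localBlock ε a δ ^ n) φ).1 x‖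
        ≤ n * (M * (normalExpMoment * Real.exp (-((θ / (ε * B)) ^ 2 / 4)))) := by
  have hm := one_le_normalExpMoment
  induction n with
  | zero => exact fun x hx => absurd x.2 hx
  | succ n ih =>
    intro x hx
    rw [pow_succ', Module.End.mul_apply, localBlock_apply]
    have hx' : Metric.closedBall (S.f x) θ ⊆ escapeSet S.f (Metric.ball a δ) θ n :=
      hx.resolve_left fun h => h x.2
    set P := normalExpMoment * Real.exp (-((θ / (ε * B)) ^ 2 / 4)) with hP
    have hP0 : 0 ≤ P := by positivity
    refine (norm_integral_stdNormal_le _ (A := M * Real.exp (-((θ / (ε * B)) ^ 2 / 4)))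
      (D := n * (M * P)) fun z => ?_).trans (le_of_eq ?_)
    -- A step with noise at most θ lands in the previous escape set, or outside the ball where the
    -- function is zero; a longer step needs |z| ≥ θ/(εB).
    · by_cases hz : S.step ε x z ∈ Metric.closedBall (S.f x) θ
      · have h0 : 0 ≤ M * Real.exp (-((θ / (ε * B)) ^ 2 / 4)) * Real.exp (z ^ 2 / 4) := by
          positivity
        have h1 : 0 ≤ (n : ℝ) * (M * P) := by positivity
        by_cases hV : S.step ε x z ∈ Metric.ball a δ
        · rw [ext0_of_mem a δ _ hV]
          have := ih ⟨_, hV⟩ (hx' hz)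
          linarith
        · rw [ext0_of_notMem a δ _ hV, norm_zero]; positivity
      · have h1 : 0 ≤ (n : ℝ) * (M * P) := by positivity
        have h2 : θ / (ε * B) ≤ |z| := by
          rw [div_le_iff₀ (by positivity)]
          rw [Metric.mem_closedBall, not_le] at hz
          have := S.dist_step_le ε hε.le hB x z
          linarith
        have h3 := one_le_exp_of_le_abs (by positivity) h2
        have h4 := norm_ext0_le a δ hM0 (S.norm_localBlock_pow_le ε a δ hM0 hM n) (S.step ε x z)
        have h5 : M * 1 ≤ M * (Real.exp (-((θ / (ε * B)) ^ 2 / 4)) * Real.exp (z ^ 2 / 4)) :=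
          mul_le_mul_of_nonneg_left h3 hM0
        linarith
    · rw [hP]; push_cast; ring

variable {ε a δ}

theorem localBlock_pow_of_eigen {φ : BddMeas (Metric.ball a δ)} {μ : ℂ}
    (h : S.localBlock ε a δ φ = μ • φ) (n : ℕ) : (S.localBlock ε a δ ^ n) φ = μ ^ n • φ := by
  induction n with
  | zero => simp
  | succ n ih => rw [pow_succ', Module.End.mul_apply, ih, map_smul, h, smul_smul, pow_succ]

theorem norm_eigenvalue_le_one {φ : BddMeas (Metric.ball a δ)} {μ : ℂ}
    (h : S.localBlock ε a δ φ = μ • φ) (hφ : φ ≠ 0) : ‖μ‖ ≤ 1 := by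
  obtain ⟨x, hx⟩ : ∃ x, φ.1 x ≠ 0 := by
    by_contra! h0
    exact hφ (Subtype.ext (funext h0))
  obtain ⟨_, M, hM⟩ := φ.2
  have hM0 : 0 ≤ M := (norm_nonneg _).trans (hM x)
  by_contra! hlt
  obtain ⟨n, hn⟩ := pow_unbounded_of_one_lt (M / ‖φ.1 x‖) hlt
  have h1 := S.norm_localBlock_pow_le ε a δ hM0 hM n x
  rw [S.localBlock_pow_of_eigen h n] at h1
  have h2 : (μ ^ n • φ).1 x = μ ^ n * φ.1 x := rfl
  rw [h2, norm_mul, norm_pow] at h1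
  rw [div_lt_iff₀ (norm_pos_iff.2 hx)] at hn
  linarith

/-- On the span of φ and v the operator is triangular. The coefficient d is the sum of the n
products μ'^i μ^{n-1-i}, each of modulus at most one. -/
theorem exists_localBlock_pow_of_chain {φ v : BddMeas (Metric.ball a δ)} {μ μ' b : ℂ}
    (hφ : S.localBlock ε a δ φ = μ • φ) (hv : S.localBlock ε a δ v = μ' • v + b • φ)
    (hμ : ‖μ‖ ≤ 1) (hμ' : ‖μ'‖ ≤ 1) (n : ℕ) :
    ∃ d : ℂ, ‖d‖ ≤ n ∧ (S.localBlock ε a δ ^ n) v = μ' ^ n • v + (b * d) • φ := by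
  induction n with
  | zero => exact ⟨0, by simp, by simp⟩
  | succ n ih =>
    obtain ⟨d, hd, h⟩ := ih
    refine ⟨μ' ^ n + d * μ, ?_, ?_⟩
    · refine (norm_add_le _ _).trans ?_
      rw [norm_pow, norm_mul]
      have h1 : ‖μ'‖ ^ n ≤ 1 := pow_le_one₀ (norm_nonneg _) hμ'
      have h2 : ‖d‖ * ‖μ‖ ≤ n * 1 := mul_le_mul hd hμ (norm_nonneg _) (Nat.cast_nonneg n)
      push_cast; linarith
    · rw [pow_succ', Module.End.mul_apply, h, map_add, map_smul, map_smul, hφ, hv, smul_add,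
        smul_smul, smul_smul, smul_smul, add_assoc, ← add_smul]
      congr 2
      ring

end NoisyCircleMap

/-! ### Comparison of normal densities -/

theorem mul_exp_neg_le {κ t : ℝ} (hκ : 0 < κ) : t * Real.exp (-(κ * t)) ≤ 1 / κ := by
  rw [Real.exp_neg, ← div_eq_mul_inv, div_le_div_iff₀ (Real.exp_pos _) hκ]
  have := Real.add_one_le_exp (κ * t)
  linarith

theorem one_add_mul_exp_neg_le {κ t : ℝ} (hκ : 0 < κ) (ht : 0 ≤ t) :
    (1 + t) * Real.exp (-(κ * t)) ≤ 1 + 1 / κ := by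
  have h1 := mul_exp_neg_le (t := t) hκ
  have h2 : Real.exp (-(κ * t)) ≤ 1 := Real.exp_le_one_iff.2 (by nlinarith)
  nlinarith

/-- Mean value theorem along the segment from Y to X; the factor |ξ| from the derivative is absorbed
by half of the exponent. -/
theorem exists_abs_exp_neg_sq_sub_le (X Y : ℝ) :
    ∃ θ ∈ Set.Icc (0 : ℝ) 1, |Real.exp (-X ^ 2 / 2) - Real.exp (-Y ^ 2 / 2)|
      ≤ |X - Y| * Real.exp (-(θ * X + (1 - θ) * Y) ^ 2 / 4) := by
  have hder : ∀ t : ℝ, HasDerivAt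
      (fun t : ℝ => Real.exp (-(Y + t * (X - Y)) ^ 2 / 2))
      (Real.exp (-(Y + t * (X - Y)) ^ 2 / 2) * (-((Y + t * (X - Y)) * (X - Y)))) t := by
    intro t
    have h1 : HasDerivAt (fun t : ℝ => Y + t * (X - Y)) (X - Y) t := by
      simpa using ((hasDerivAt_id t).mul_const (X - Y)).const_add Y
    have h2 := ((h1.pow 2).neg.div_const 2).exp
    refine h2.congr_deriv ?_
    simp only [Pi.neg_apply, Pi.pow_apply]
    push_cast; ring
  obtain ⟨θ, hθ, h⟩ := exists_hasDerivAt_eq_slope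
    (fun t : ℝ => Real.exp (-(Y + t * (X - Y)) ^ 2 / 2)) _ (zero_lt_one)
    (fun t _ => (hder t).continuousAt.continuousWithinAt) (fun t _ => hder t)
  refine ⟨θ, ⟨hθ.1.le, hθ.2.le⟩, ?_⟩
  set ξ := θ * X + (1 - θ) * Y with hξ
  have e1 : Y + θ * (X - Y) = ξ := by rw [hξ]; ring
  simp only [e1] at h
  have e2 : Real.exp (-X ^ 2 / 2) - Real.exp (-Y ^ 2 / 2)
      = Real.exp (-ξ ^ 2 / 2) * (-(ξ * (X - Y))) := by
    rw [h]; simp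
  rw [e2, abs_mul, abs_neg, abs_mul, abs_of_pos (Real.exp_pos _)]
  have h3 : |ξ| ≤ Real.exp (ξ ^ 2 / 4) := by
    have := Real.add_one_le_exp (ξ ^ 2 / 4)
    have h4 : |ξ| ^ 2 = ξ ^ 2 := sq_abs ξ
    nlinarith [sq_nonneg (|ξ| - 2)]
  have h5 : Real.exp (-ξ ^ 2 / 2) * Real.exp (ξ ^ 2 / 4) = Real.exp (-ξ ^ 2 / 4) := by
    rw [← Real.exp_add]; congr 1; ring
  calc Real.exp (-ξ ^ 2 / 2) * (|ξ| * |X - Y|)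
      ≤ Real.exp (-ξ ^ 2 / 2) * (Real.exp (ξ ^ 2 / 4) * |X - Y|) := by gcongr
    _ = |X - Y| * (Real.exp (-ξ ^ 2 / 2) * Real.exp (ξ ^ 2 / 4)) := by ring
    _ = _ := by rw [h5]

theorem normalKernel_eq (a s z : ℝ) :
    normalKernel a s z = (Real.sqrt (2 * Real.pi))⁻¹ *
      (s⁻¹ * Real.exp (-(s⁻¹ * (z - a)) ^ 2 / 2)) := by
  rw [normalKernel, mul_inv, mul_assoc]
  congr 3
  rw [mul_pow, inv_pow]
  ring

/-- Two normal densities differ by at most a Gaussian that is centred between their means. -/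
theorem exists_abs_normalKernel_sub_le {a a₀ s s₀ B : ℝ} (hs : 0 < s) (hs₀ : 0 < s₀)
    (hsB : s ≤ B) (hs₀B : s₀ ≤ B) (z : ℝ) :
    ∃ t ∈ Set.Icc (0 : ℝ) 1, |normalKernel a s z - normalKernel a₀ s₀ z| ≤
      (|s⁻¹ - s₀⁻¹| + s₀⁻¹ * |s⁻¹ * (z - a) - s₀⁻¹ * (z - a₀)|) *
        Real.exp (-(1 / (4 * B ^ 2) * (z - (a₀ + t * (a - a₀))) ^ 2)) := by
  have hB : 0 < B := hs.trans_le hsB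
  set X := s⁻¹ * (z - a) with hX
  set Y := s₀⁻¹ * (z - a₀) with hY
  obtain ⟨θ, ⟨hθ0, hθ1⟩, hθ⟩ := exists_abs_exp_neg_sq_sub_le X Y
  set u := s⁻¹ with hu
  set u₀ := s₀⁻¹ with hu₀
  have hup : 0 < u := inv_pos.2 hs
  have hu₀p : 0 < u₀ := inv_pos.2 hs₀
  have huB : B⁻¹ ≤ u := inv_anti₀ hs hsB
  have hu₀B : B⁻¹ ≤ u₀ := inv_anti₀ hs₀ hs₀B
  have hBp : 0 < B⁻¹ := inv_pos.2 hB
  set U := θ * u + (1 - θ) * u₀ with hU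
  have hUB : B⁻¹ ≤ U := by rw [hU]; nlinarith
  have hUp : 0 < U := hBp.trans_le hUB
  have hsq : ∀ (p r : ℝ), B⁻¹ ≤ p → 1 / (4 * B ^ 2) * r ^ 2 ≤ (p * r) ^ 2 / 4 := by
    intro p r hp
    have h1 : (B⁻¹) ^ 2 ≤ p ^ 2 := pow_le_pow_left₀ hBp.le hp 2
    have h2 : 1 / (4 * B ^ 2) = (B⁻¹) ^ 2 / 4 := by rw [inv_pow]; field_simp
    rw [h2, mul_pow]
    nlinarith [sq_nonneg r]
  have hsqrt : (Real.sqrt (2 * Real.pi))⁻¹ ≤ 1 := by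
    apply inv_le_one_of_one_le₀
    rw [Real.one_le_sqrt]
    nlinarith [Real.pi_gt_three]
  have hmain : |normalKernel a s z - normalKernel a₀ s₀ z| ≤
      |u - u₀| * Real.exp (-X ^ 2 / 2) + u₀ * (|X - Y| *
        Real.exp (-(θ * X + (1 - θ) * Y) ^ 2 / 4)) := by
    rw [normalKernel_eq, normalKernel_eq, ← mul_sub, abs_mul,
      abs_of_pos (by positivity : 0 < (Real.sqrt (2 * Real.pi))⁻¹)]
    refine (mul_le_of_le_one_left (abs_nonneg _) hsqrt).trans ?_
    have e : u * Real.exp (-X ^ 2 / 2) - u₀ * Real.exp (-Y ^ 2 / 2)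
        = (u - u₀) * Real.exp (-X ^ 2 / 2)
          + u₀ * (Real.exp (-X ^ 2 / 2) - Real.exp (-Y ^ 2 / 2)) := by ring
    rw [e]
    refine (abs_add_le _ _).trans ?_
    rw [abs_mul, abs_mul, abs_of_pos (Real.exp_pos _), abs_of_pos hu₀p]
    gcongr
  -- An interpolation of the two standardised variables is a multiple of z minus a point between the
  -- means; t is the barycentric weight of that point.
  set t := θ * u / U with ht
  have ht0 : 0 ≤ t := by positivity
  have ht1 : t ≤ 1 := by
    rw [ht, div_le_one hUp, hU]; nlinarith
  have hξ : θ * X + (1 - θ) * Y = U * (z - (a₀ + t * (a - a₀))) := by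
    have : t * U = θ * u := by rw [ht]; field_simp
    rw [hX, hY]
    have e : U * (z - (a₀ + t * (a - a₀))) = U * z - U * a₀ - (t * U) * (a - a₀) := by ring
    rw [e, this, hU]; ring
  have hE1 : Real.exp (-X ^ 2 / 2) ≤ Real.exp (-(1 / (4 * B ^ 2) * (z - a) ^ 2)) := by
    apply Real.exp_le_exp.2
    have := hsq u (z - a) huB
    rw [hX]; nlinarith [sq_nonneg (u * (z - a))]
  have hE2 : Real.exp (-(θ * X + (1 - θ) * Y) ^ 2 / 4)
      ≤ Real.exp (-(1 / (4 * B ^ 2) * (z - (a₀ + t * (a - a₀))) ^ 2)) := by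
    apply Real.exp_le_exp.2
    have := hsq U (z - (a₀ + t * (a - a₀))) hUB
    rw [hξ]; linarith
  have hcomb : ∀ E : ℝ, Real.exp (-(1 / (4 * B ^ 2) * (z - a) ^ 2)) ≤ E →
      Real.exp (-(1 / (4 * B ^ 2) * (z - (a₀ + t * (a - a₀))) ^ 2)) ≤ E →
      |normalKernel a s z - normalKernel a₀ s₀ z| ≤ (|u - u₀| + u₀ * |X - Y|) * E := by
    intro E h1 h2
    refine hmain.trans ?_
    rw [add_mul, mul_assoc]
    have := hE1.trans h1
    have := hE2.trans h2
    gcongr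
  -- Two Gaussians occur, centred at a and at the intermediate point. The larger one serves for
  -- both, and the centre a is the case t = 1.
  rcases le_total (Real.exp (-(1 / (4 * B ^ 2) * (z - a) ^ 2)))
    (Real.exp (-(1 / (4 * B ^ 2) * (z - (a₀ + t * (a - a₀))) ^ 2))) with h | h
  · exact ⟨t, ⟨ht0, ht1⟩, hcomb _ h le_rfl⟩
  · refine ⟨1, ⟨zero_le_one, le_rfl⟩, ?_⟩
    have e : a₀ + 1 * (a - a₀) = a := by ring
    rw [e]
    exact hcomb _ le_rfl h

/-- Expansion by b > 1 leaves slack: only the fraction x of k, with b²x halfway between 1 and b², is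
traded for decay in y, and still the rate obtained exceeds k. The gain k₂ - k absorbs polynomial
factors in y, and the unused part k₃ those in z. -/
theorem exists_gaussian_tradeoff_gain {A b k : ℝ} (hA : 0 < A) (hb : 1 < b) (hk : 0 < k)
    (hkA : k ≤ A * (b ^ 2 - 1) / 4) :
    ∃ k₂ > k, ∃ k₃ > 0, ∀ y a z : ℝ, b * |y| ≤ |a| →
      k₂ * y ^ 2 + k₃ * z ^ 2 ≤ A * (z - a) ^ 2 + k * z ^ 2 := by
  have hB1 : 1 < b ^ 2 := one_lt_pow₀ hb (by norm_num)
  set x := (1 + b ^ 2) / (2 * b ^ 2) with hx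
  have hx0 : 0 < x := by positivity
  have hx1 : x < 1 := by rw [hx, div_lt_one (by positivity)]; linarith
  have hbx : b ^ 2 * x = (1 + b ^ 2) / 2 := by rw [hx]; field_simp
  have hkx : 0 < k * x := by positivity
  refine ⟨A * (k * x) / (A + k * x) * b ^ 2, ?_, k * (1 - x), mul_pos hk (by linarith), ?_⟩
  · rw [gt_iff_lt, div_mul_eq_mul_div, lt_div_iff₀ (by positivity)]
    have : A * (k * x) * b ^ 2 = k * (A * ((1 + b ^ 2) / 2)) := by rw [← hbx]; ring
    rw [this]
    apply mul_lt_mul_of_pos_left _ hk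
    nlinarith
  · intro y a z h
    have h1 := gaussian_tradeoff hA hkx a z
    have h2 : b ^ 2 * y ^ 2 ≤ a ^ 2 := by
      have := pow_le_pow_left₀ (by positivity) h 2
      rwa [mul_pow, sq_abs, sq_abs] at this
    have h3 : A * (k * x) / (A + k * x) * (b ^ 2 * y ^ 2) ≤ A * (k * x) / (A + k * x) * a ^ 2 := by
      gcongr
    nlinarith

/-! ### The plateau weight and the linearisation error -/

/-- The weight `exp (-k y²) + min (exp (-k R²)) (exp (-q y²))`. -/
def plateauWeight (k q R y : ℝ) : ℝ :=
  Real.exp (-k * y ^ 2) + min (Real.exp (-k * R ^ 2)) (Real.exp (-q * y ^ 2))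

theorem continuous_plateauWeight (k q R : ℝ) : Continuous (plateauWeight k q R) := by
  unfold plateauWeight; fun_prop

/-- The minimum of two positive numbers is at most any weighted geometric mean of them, here with
weights 3/4 and 1/4. -/
theorem plateauWeight_le (k q R z : ℝ) :
    plateauWeight k q R z ≤ Real.exp (-k * z ^ 2)
      + Real.exp (-(3 / 4 * k) * R ^ 2) * Real.exp (-(q / 4) * z ^ 2) := by
  unfold plateauWeight
  rw [← Real.exp_add]
  refine add_le_add le_rfl ?_
  rcases le_total (k * R ^ 2) (q * z ^ 2) with h | h
  · refine (min_le_right _ _).trans (Real.exp_le_exp.2 ?_)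
    linarith
  · refine (min_le_left _ _).trans (Real.exp_le_exp.2 ?_)
    linarith

set_option maxHeartbeats 800000 in
/-- Replacing a normal law whose mean and deviation depend on `y` by the linearised one changes
expectations, in the inner region `|y| ≤ R / 2`, by a relative error of order `ε`. -/
theorem exists_norm_integral_sub_le {c σ₀ b σm B L k q : ℝ} (hb : 1 < b)
    (hσm : 0 < σm) (hσ₀m : σm ≤ σ₀) (hσ₀B : σ₀ ≤ B) (hL : 0 ≤ L) (hk : 0 < k) (hq : 0 < q)
    (hkA : k ≤ 1 / (4 * B ^ 2) * (b ^ 2 - 1) / 4) :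
    ∃ C > 0, ∀ (ε R y a s M : ℝ) (v : ℝ → ℂ), 0 < ε → 0 ≤ M → |y| ≤ R / 2 →
      σm ≤ s → s ≤ B → |s - σ₀| ≤ L * ε * |y| → |a - c * y| ≤ L * ε * y ^ 2 → |a| ≤ L * |y| →
      |a - c * y| ≤ (|c| - b) * |y| → Measurable v → (∀ z, ‖v z‖ ≤ M * plateauWeight k q R z) →
      ‖∫ z, v (a + s * z) ∂stdNormal - ∫ z, v (c * y + σ₀ * z) ∂stdNormal‖
        ≤ C * ε * M * Real.exp (-k * y ^ 2) := by
  have hB : 0 < B := by linarith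
  have hσ₀ : 0 < σ₀ := by linarith
  obtain ⟨k₂, hk₂, k₃, hk₃, htr⟩ := exists_gaussian_tradeoff_gain
    (A := 1 / (4 * B ^ 2)) (by positivity) hb hk hkA
  have hIb : ∀ b : ℝ, 0 < b → Integrable (fun z : ℝ => (1 + |z|) * Real.exp (-b * z ^ 2)) := by
    intro b hb
    have h0 := integrable_pow_mul_exp_neg_mul_sq 0 hb
    have h1 := integrable_pow_mul_exp_neg_mul_sq 1 hb
    refine (h0.add h1).congr (Filter.Eventually.of_forall fun z => ?_)
    simp only [Pi.add_apply]; ring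
  set I : ℝ → ℝ := fun b => ∫ z : ℝ, (1 + |z|) * Real.exp (-b * z ^ 2) with hI
  have hI0 : ∀ b, 0 ≤ I b := fun b => integral_nonneg fun z => by positivity
  set D : ℝ := L / σm ^ 2 + σm⁻¹ * (L / σm ^ 2 * (1 + L) + σm⁻¹ * L) with hD
  have hD0 : 0 ≤ D := by positivity
  have hk2k : 0 < k₂ - k := by linarith
  refine ⟨D * ((1 + 1 / (k₂ - k)) * I k₃ + (1 + 1 / (k / 2)) * I (q / 4)) + 1, ?_, ?_⟩
  · have := hI0 k₃
    have := hI0 (q / 4)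
    positivity
  intro ε R y a s M v hε hM0 hyR hsm hsB hsσ hac haL hacb hv hM
  have hs : 0 < s := by linarith
  have hy1 : |y| ≤ 1 + y ^ 2 := by nlinarith [sq_nonneg (|y| - 1), sq_abs y]
  have hvC : ∀ z, ‖v z‖ ≤ M * 2 := fun z => (hM z).trans (mul_le_mul_of_nonneg_left (by
    unfold plateauWeight
    have h1 : Real.exp (-k * z ^ 2) ≤ 1 := Real.exp_le_one_iff.2 (by nlinarith [sq_nonneg z])
    have h2 : Real.exp (-k * R ^ 2) ≤ 1 := Real.exp_le_one_iff.2 (by nlinarith [sq_nonneg R])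
    have := min_le_left (Real.exp (-k * R ^ 2)) (Real.exp (-q * z ^ 2))
    linarith) hM0)
  have hKi : ∀ (a s : ℝ), 0 < s → Integrable (fun z => normalKernel a s z • v z) := by
    intro a s hs
    have hK : Integrable (fun z => normalKernel a s z) := by
      have h1 := (integrable_exp_neg_mul_sq (b := 1 / (2 * s ^ 2)) (by positivity)).comp_sub_right a
      refine (h1.const_mul (Real.sqrt (2 * Real.pi) * s)⁻¹).congr
        (Filter.Eventually.of_forall fun z => ?_)
      simp only [normalKernel]
      congr 2; ring
    exact hK.smul_bdd (M * 2) hv.aestronglyMeasurable (Filter.Eventually.of_forall hvC)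
  rw [integral_stdNormal_affine v a hs, integral_stdNormal_affine v (c * y) hσ₀,
    ← integral_sub (hKi a s hs) (hKi (c * y) σ₀ hσ₀)]
  -- pointwise bound of the difference of the densities
  have hpt : ∀ z, ‖normalKernel a s z • v z - normalKernel (c * y) σ₀ z • v z‖ ≤
      D * ε * M * ((1 + y ^ 2) * Real.exp (-k₂ * y ^ 2)) * ((1 + |z|) * Real.exp (-k₃ * z ^ 2))
      + D * ε * M * ((1 + y ^ 2) * Real.exp (-(3 / 4 * k) * R ^ 2)) *
        ((1 + |z|) * Real.exp (-(q / 4) * z ^ 2)) := by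
    intro z
    obtain ⟨t, ⟨ht0, ht1⟩, ht⟩ := exists_abs_normalKernel_sub_le (a := a) (a₀ := c * y)
      hs hσ₀ hsB hσ₀B z
    set a' := c * y + t * (a - c * y) with ha'
    have ha'y : b * |y| ≤ |a'| := by
      have h1 : |c * y| - |t * (a - c * y)| ≤ |a'| := by
        have := abs_sub_abs_le_abs_sub (c * y) (-(t * (a - c * y)))
        rwa [abs_neg, sub_neg_eq_add] at this
      have h2 : |t * (a - c * y)| ≤ |a - c * y| := by
        rw [abs_mul, abs_of_nonneg ht0]
        exact mul_le_of_le_one_left (abs_nonneg _) ht1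
      rw [abs_mul] at h1
      linarith
    have hus : |s⁻¹ - σ₀⁻¹| ≤ L / σm ^ 2 * ε * |y| := by
      have e : s⁻¹ - σ₀⁻¹ = (σ₀ - s) / (s * σ₀) := by field_simp
      rw [e, abs_div, abs_sub_comm, abs_of_pos (by positivity : 0 < s * σ₀),
        div_le_iff₀ (by positivity)]
      have h1 : σm ^ 2 ≤ s * σ₀ := by rw [sq]; gcongr
      calc |s - σ₀| ≤ L * ε * |y| := hsσ
        _ = L / σm ^ 2 * ε * |y| * σm ^ 2 := by field_simp
        _ ≤ _ := by gcongr
    have hu0 : σ₀⁻¹ ≤ σm⁻¹ := inv_anti₀ hσm hσ₀m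
    have hQ1 : 1 + y ^ 2 ≤ (1 + y ^ 2) * (1 + |z|) :=
      le_mul_of_one_le_right (by positivity) (by linarith [abs_nonneg z])
    have h5 : y ^ 2 ≤ (1 + y ^ 2) * (1 + |z|) := by linarith
    have h6 : |y| ≤ (1 + y ^ 2) * (1 + |z|) := hy1.trans hQ1
    have hXY : |s⁻¹ * (z - a) - σ₀⁻¹ * (z - c * y)|
        ≤ (L / σm ^ 2 * (1 + L) + σm⁻¹ * L) * ε * ((1 + y ^ 2) * (1 + |z|)) := by
      have e : s⁻¹ * (z - a) - σ₀⁻¹ * (z - c * y)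
          = (s⁻¹ - σ₀⁻¹) * (z - a) - σ₀⁻¹ * (a - c * y) := by ring
      rw [e]
      refine (abs_sub _ _).trans ?_
      rw [abs_mul, abs_mul, abs_of_pos (inv_pos.2 hσ₀)]
      have h1 : |z - a| ≤ |z| + L * |y| := (abs_sub _ _).trans (by linarith)
      have h2 : |y| * (|z| + L * |y|) ≤ (1 + L) * ((1 + y ^ 2) * (1 + |z|)) := by
        have e3 : |y| * |y| = y ^ 2 := by rw [← sq, sq_abs]
        have h3 : |y| * |z| ≤ (1 + y ^ 2) * (1 + |z|) := by
          apply mul_le_mul hy1 (by linarith [abs_nonneg z]) (abs_nonneg _) (by positivity)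
        have h4 : L * (|y| * |y|) ≤ L * ((1 + y ^ 2) * (1 + |z|)) := by
          rw [e3]
          exact mul_le_mul_of_nonneg_left h5 hL
        rw [mul_add, mul_left_comm |y| L, add_mul, one_mul]
        exact add_le_add h3 h4
      calc |s⁻¹ - σ₀⁻¹| * |z - a| + σ₀⁻¹ * |a - c * y|
          ≤ (L / σm ^ 2 * ε * |y|) * (|z| + L * |y|) + σm⁻¹ * (L * ε * y ^ 2) := by
            gcongr
        _ = L / σm ^ 2 * ε * (|y| * (|z| + L * |y|)) + σm⁻¹ * L * ε * y ^ 2 := by ring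
        _ ≤ L / σm ^ 2 * ε * ((1 + L) * ((1 + y ^ 2) * (1 + |z|)))
            + σm⁻¹ * L * ε * ((1 + y ^ 2) * (1 + |z|)) := by gcongr
        _ = _ := by ring
    have hDb : |s⁻¹ - σ₀⁻¹| + σ₀⁻¹ * |s⁻¹ * (z - a) - σ₀⁻¹ * (z - c * y)|
        ≤ D * ε * ((1 + y ^ 2) * (1 + |z|)) := by
      calc _ ≤ L / σm ^ 2 * ε * ((1 + y ^ 2) * (1 + |z|)) + σm⁻¹ *
            ((L / σm ^ 2 * (1 + L) + σm⁻¹ * L) * ε * ((1 + y ^ 2) * (1 + |z|))) := by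
            refine add_le_add (hus.trans ?_) ?_
            · gcongr
            · exact mul_le_mul hu0 hXY (abs_nonneg _) (by positivity)
        _ = _ := by rw [hD]; ring
    rw [← sub_smul, norm_smul, Real.norm_eq_abs]
    set E := Real.exp (-(1 / (4 * B ^ 2) * (z - a') ^ 2)) with hE
    have hE1 : E ≤ 1 := Real.exp_le_one_iff.2 (by
      have : 0 ≤ 1 / (4 * B ^ 2) * (z - a') ^ 2 := by positivity
      linarith)
    have hEk : E * Real.exp (-k * z ^ 2) ≤ Real.exp (-k₂ * y ^ 2) * Real.exp (-k₃ * z ^ 2) := by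
      rw [hE, ← Real.exp_add, ← Real.exp_add]
      apply Real.exp_le_exp.2
      have := htr y a' z ha'y
      linarith
    have hEw : E * plateauWeight k q R z ≤ Real.exp (-k₂ * y ^ 2) * Real.exp (-k₃ * z ^ 2)
        + Real.exp (-(3 / 4 * k) * R ^ 2) * Real.exp (-(q / 4) * z ^ 2) := by
      have h0 := plateauWeight_le k q R z
      calc E * plateauWeight k q R z ≤ E * (Real.exp (-k * z ^ 2)
            + Real.exp (-(3 / 4 * k) * R ^ 2) * Real.exp (-(q / 4) * z ^ 2)) := by gcongr
        _ = E * Real.exp (-k * z ^ 2)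
            + E * (Real.exp (-(3 / 4 * k) * R ^ 2) * Real.exp (-(q / 4) * z ^ 2)) := by ring
        _ ≤ _ := add_le_add hEk (mul_le_of_le_one_left (by positivity) hE1)
    calc |normalKernel a s z - normalKernel (c * y) σ₀ z| * ‖v z‖
        ≤ (D * ε * ((1 + y ^ 2) * (1 + |z|)) * E) * (M * plateauWeight k q R z) := by
          refine mul_le_mul (ht.trans ?_) (hM z) (norm_nonneg _) (by positivity)
          gcongr
      _ = D * ε * M * ((1 + y ^ 2) * (1 + |z|)) * (E * plateauWeight k q R z) := by ring
      _ ≤ D * ε * M * ((1 + y ^ 2) * (1 + |z|)) *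
          (Real.exp (-k₂ * y ^ 2) * Real.exp (-k₃ * z ^ 2)
            + Real.exp (-(3 / 4 * k) * R ^ 2) * Real.exp (-(q / 4) * z ^ 2)) := by gcongr
      _ = _ := by ring
  refine (norm_integral_le_of_norm_le (((hIb k₃ hk₃).const_mul _).add
    ((hIb (q / 4) (by positivity)).const_mul _)) (Filter.Eventually.of_forall hpt)).trans ?_
  simp only [Pi.add_apply]
  rw [integral_add ((hIb k₃ hk₃).const_mul _) ((hIb (q / 4) (by positivity)).const_mul _),
    integral_const_mul, integral_const_mul]
  -- The strict gain k₂ > k pays for the factor 1 + y² of the linearisation error.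
  have hf1 : (1 + y ^ 2) * Real.exp (-k₂ * y ^ 2)
      ≤ (1 + 1 / (k₂ - k)) * Real.exp (-k * y ^ 2) := by
    have h1 := one_add_mul_exp_neg_le hk2k (sq_nonneg y)
    have h2 : Real.exp (-k₂ * y ^ 2)
        = Real.exp (-((k₂ - k) * y ^ 2)) * Real.exp (-k * y ^ 2) := by
      rw [← Real.exp_add]; congr 1; ring
    rw [h2, ← mul_assoc]
    gcongr
  have hyR2 : y ^ 2 ≤ R ^ 2 / 4 := by
    have := pow_le_pow_left₀ (abs_nonneg y) hyR 2
    rw [sq_abs] at this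
    linarith
  -- Split 3/4 = 1/2 + 1/4: since |y| ≤ R/2, the quarter gives exp(-k y²), and the half absorbs 1 +
  -- y² ≤ 1 + R².
  have hf2 : (1 + y ^ 2) * Real.exp (-(3 / 4 * k) * R ^ 2)
      ≤ (1 + 1 / (k / 2)) * Real.exp (-k * y ^ 2) := by
    have h1 := one_add_mul_exp_neg_le (half_pos hk) (sq_nonneg R)
    have h2 : Real.exp (-(3 / 4 * k) * R ^ 2)
        = Real.exp (-(k / 2 * R ^ 2)) * Real.exp (-(k / 4) * R ^ 2) := by
      rw [← Real.exp_add]; congr 1; ring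
    have h3 : Real.exp (-(k / 4) * R ^ 2) ≤ Real.exp (-k * y ^ 2) :=
      Real.exp_le_exp.2 (by nlinarith)
    rw [h2, ← mul_assoc]
    refine mul_le_mul (le_trans ?_ h1) h3 (Real.exp_pos _).le (by positivity)
    exact mul_le_mul_of_nonneg_right (by linarith [sq_nonneg R]) (Real.exp_pos _).le
  have hi1 := hI0 k₃
  have hi2 := hI0 (q / 4)
  calc _ ≤ D * ε * M * ((1 + 1 / (k₂ - k)) * Real.exp (-k * y ^ 2)) * I k₃
      + D * ε * M * ((1 + 1 / (k / 2)) * Real.exp (-k * y ^ 2)) * I (q / 4) := by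
        gcongr
    _ = D * ((1 + 1 / (k₂ - k)) * I k₃ + (1 + 1 / (k / 2)) * I (q / 4)) * ε * M
          * Real.exp (-k * y ^ 2) := by ring
    _ ≤ _ := by
        generalize D * ((1 + 1 / (k₂ - k)) * I k₃ + (1 + 1 / (k / 2)) * I (q / 4)) = F
        gcongr
        linarith

/-- Each of the two Gaussians satisfies the bound by `sq_weight_le`, and the constant floor does
trivially. The cost exp(z²/4) is independent of R, which makes the weight admissible uniformly in ε.
-/
theorem plateauWeight_affine_le {c s k q R : ℝ} (hk : 0 < k) (hq : 0 < q) (hqk : q ≤ k)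
    (hcs : 1 + 4 * k * s ^ 2 ≤ c ^ 2) (hs : 0 ≤ s) (y z : ℝ) :
    plateauWeight k q R (c * y + s * z) ≤ Real.exp (z ^ 2 / 4) * plateauWeight k q R y := by
  have h0 : |c| * |y| ≤ |c * y + s * z| + s * |z| := by
    have := abs_sub_abs_le_abs_sub (c * y) (-(s * z))
    rw [abs_neg, sub_neg_eq_add, abs_mul, abs_mul, abs_of_nonneg hs] at this
    linarith
  have hcs2 : 1 + 4 * k * s ^ 2 ≤ |c| ^ 2 := by rwa [sq_abs]
  have hcs3 : 1 + 4 * q * s ^ 2 ≤ |c| ^ 2 := le_trans (by gcongr) hcs2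
  have h1 := sq_weight_le hk hcs2 (abs_nonneg c) (abs_nonneg y) h0
  have h2 := sq_weight_le hq hcs3 (abs_nonneg c) (abs_nonneg y) h0
  rw [sq_abs, sq_abs] at h1 h2
  have hz : 1 ≤ Real.exp (z ^ 2 / 4) := Real.one_le_exp (by positivity)
  unfold plateauWeight
  rw [mul_add, mul_min_of_nonneg _ _ (Real.exp_pos _).le]
  refine add_le_add ?_ (min_le_min ?_ ?_)
  · rw [← Real.exp_add]; exact Real.exp_le_exp.2 (by linarith)
  · exact le_mul_of_one_le_left (Real.exp_pos _).le hz
  · rw [← Real.exp_add]; exact Real.exp_le_exp.2 (by linarith)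

theorem plateauWeight_pos (k q R y : ℝ) : 0 < plateauWeight k q R y := by
  unfold plateauWeight
  have := lt_min (Real.exp_pos (-k * R ^ 2)) (Real.exp_pos (-q * y ^ 2))
  positivity

theorem admissibleWeight_plateauWeight {c s k q : ℝ} (R : ℝ) (hk : 0 < k) (hq : 0 < q)
    (hqk : q ≤ k) (hcs : 1 + 4 * k * s ^ 2 ≤ c ^ 2) (hs : 0 ≤ s) :
    AdmissibleWeight c s k q normalExpMoment (plateauWeight k q R) where
  measurable := (continuous_plateauWeight k q R).measurable
  lower y := by
    unfold plateauWeight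
    have := lt_min (Real.exp_pos (-k * R ^ 2)) (Real.exp_pos (-q * y ^ 2))
    linarith
  upper y := by
    unfold plateauWeight
    have h1 := min_le_right (Real.exp (-k * R ^ 2)) (Real.exp (-q * y ^ 2))
    have h2 : Real.exp (-k * y ^ 2) ≤ Real.exp (-q * y ^ 2) :=
      Real.exp_le_exp.2 (by nlinarith [sq_nonneg y])
    linarith
  expect y := by
    have := norm_integral_stdNormal_le (fun z => plateauWeight k q R (c * y + s * z))
      (A := plateauWeight k q R y) (D := 0) fun z => by
        rw [Real.norm_eq_abs, abs_of_pos (plateauWeight_pos _ _ _ _), add_zero,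
          mul_comm (plateauWeight k q R y)]
        exact plateauWeight_affine_le hk hq hqk hcs hs y z
    rw [add_zero, mul_comm (plateauWeight k q R y)] at this
    exact (le_abs_self _).trans this

/-- An exponential in `1 / ε²` beats a smaller one with room for a factor `ε`. -/
theorem exp_neg_div_sq_le {ε κ p P : ℝ} (hε : 0 < ε) (hε1 : ε ≤ 1) (hκ : 0 < κ) (h : κ + p ≤ P) :
    Real.exp (-(P / ε ^ 2)) ≤ 1 / κ * ε * Real.exp (-(p / ε ^ 2)) := by
  have h1 : Real.exp (-(P / ε ^ 2)) ≤ Real.exp (-(κ * (1 / ε ^ 2))) * Real.exp (-(p / ε ^ 2)) := by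
    rw [← Real.exp_add]
    apply Real.exp_le_exp.2
    rw [mul_one_div, ← neg_add, ← add_div]
    apply neg_le_neg
    gcongr
  refine h1.trans (mul_le_mul_of_nonneg_right ?_ (Real.exp_pos _).le)
  have h2 := mul_exp_neg_le (t := 1 / ε ^ 2) hκ
  rw [one_div_mul_eq_div, div_le_iff₀ (by positivity)] at h2
  refine h2.trans ?_
  gcongr
  nlinarith

/-! ### Coordinates on the circle and the rescaled line -/

theorem S1.norm_coe_eq_abs {t : ℝ} (ht : |t| ≤ Real.pi) : ‖(t : S1)‖ = |t| := by
  rw [AddCircle.norm_coe_eq_abs_iff _ Real.two_pi_pos.ne', abs_of_pos Real.two_pi_pos]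
  linarith

theorem coe_signedRep (x : S1) : ((signedRep x : ℝ) : S1) = x := AddCircle.coe_equivIoc

theorem abs_signedRep_le (x : S1) : |signedRep x| ≤ Real.pi := by
  have h : signedRep x ∈ Set.Ioc (-Real.pi) (-Real.pi + 2 * Real.pi) :=
    (AddCircle.equivIoc (2 * Real.pi) (-Real.pi) x).2
  exact abs_le.2 ⟨h.1.le, by linarith [h.2]⟩

theorem abs_signedRep (x : S1) : |signedRep x| = ‖x‖ := by
  rw [← S1.norm_coe_eq_abs (abs_signedRep_le x), coe_signedRep]

theorem signedRep_coe {t : ℝ} (ht : |t| < Real.pi) : signedRep (t : S1) = t := by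
  have := abs_lt.1 ht
  exact AddCircle.equivIoc_coe_of_mem ⟨this.1, by linarith⟩

theorem S1.dist_add_coe (a : S1) (t : ℝ) : dist (a + (t : S1)) a = ‖(t : S1)‖ := by
  rw [dist_eq_norm, add_sub_cancel_left]

namespace NoisyCircleMap

variable (S : NoisyCircleMap) (ε : ℝ) (a : S1) (δ : ℝ)

/-- A block function, read in the rescaled coordinate `y`, `x = a + ε y`, and extended by zero. -/
def lineLift (φ : BddMeas (Metric.ball a δ)) (y : ℝ) : ℂ :=
  if |ε * y| < δ then ext0 a δ φ (a + ((ε * y : ℝ) : S1)) else 0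

theorem measurable_lineLift (φ : BddMeas (Metric.ball a δ)) : Measurable (lineLift ε a δ φ) := by
  unfold lineLift
  refine Measurable.ite (measurableSet_lt (by fun_prop) measurable_const) ?_ measurable_const
  have h : Continuous (fun t : ℝ => a + ((ε * t : ℝ) : S1)) :=
    continuous_const.add ((AddCircle.continuous_mk' _).comp (by fun_prop))
  exact (measurable_ext0 a δ φ).comp h.measurable

/-- Up to half a turn the circle distance to a is |εy|, so the cut-off on the line agrees with the
extension by zero on the circle. Beyond that the circle wraps around while the line lift stays zero.
-/
theorem lineLift_of_abs_le {φ : BddMeas (Metric.ball a δ)} {y : ℝ} (h : |ε * y| ≤ Real.pi) :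
    lineLift ε a δ φ y = ext0 a δ φ (a + ((ε * y : ℝ) : S1)) := by
  unfold lineLift
  split_ifs with h1
  · rfl
  · rw [ext0_of_notMem]
    rw [Metric.mem_ball, S1.dist_add_coe, S1.norm_coe_eq_abs h]
    exact h1

theorem norm_lineLift_le {φ : BddMeas (Metric.ball a δ)} {M : ℝ} (hM0 : 0 ≤ M)
    (hM : ∀ x, ‖φ.1 x‖ ≤ M) (y : ℝ) : ‖lineLift ε a δ φ y‖ ≤ M := by
  unfold lineLift
  split_ifs
  · exact norm_ext0_le a δ hM0 hM _
  · simpa using hM0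

theorem add_coe_mem_ball {t : ℝ} (h : |t| < δ) : a + (t : S1) ∈ Metric.ball a δ := by
  rw [Metric.mem_ball, S1.dist_add_coe]
  exact (S1.norm_coe_le_abs _).trans_lt h

theorem lineLift_of_lt (φ : BddMeas (Metric.ball a δ)) {y : ℝ} (h : |ε * y| < δ) :
    lineLift ε a δ φ y = φ.1 ⟨a + ((ε * y : ℝ) : S1), add_coe_mem_ball a δ h⟩ := by
  rw [lineLift, if_pos h, ext0_of_mem]

theorem lineLift_of_ge (φ : BddMeas (Metric.ball a δ)) {y : ℝ} (h : δ ≤ |ε * y|) :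
    lineLift ε a δ φ y = 0 := if_neg (not_lt.2 h)

variable {ε a δ}

theorem apply_eq_lineLift (hε : 0 < ε) (φ : BddMeas (Metric.ball a δ)) (x : Metric.ball a δ) :
    φ.1 x = lineLift ε a δ φ (signedRep (x.1 - a) / ε) := by
  have e : ε * (signedRep (x.1 - a) / ε) = signedRep (x.1 - a) := by field_simp
  have h : |ε * (signedRep (x.1 - a) / ε)| < δ := by
    rw [e, abs_signedRep, ← dist_eq_norm]; exact x.2
  rw [lineLift_of_lt ε a δ φ h]
  refine congrArg φ.1 (Subtype.ext ?_)
  simp only [e, coe_signedRep, add_sub_cancel]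

/-- The two expectations differ only when the lifted endpoint passes half a turn. Starting from |g|
≤ π/2 this needs |z| ≥ π/(2εB), a tail event. -/
theorem norm_localBlock_sub_integral_le {B M g : ℝ} (hε : 0 < ε) (hB : ∀ x, S.σ x ≤ B)
    {φ : BddMeas (Metric.ball a δ)} (hM0 : 0 ≤ M) (hM : ∀ x, ‖φ.1 x‖ ≤ M)
    (x : Metric.ball a δ) (hx : S.f x = a + (g : S1)) (hg : |g| ≤ Real.pi / 2) :
    ‖(S.localBlock ε a δ φ).1 x - ∫ z, lineLift ε a δ φ (g / ε + S.σ x * z) ∂stdNormal‖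
      ≤ 2 * M * Real.exp (-((Real.pi / (2 * (ε * B))) ^ 2 / 4)) * normalExpMoment := by
  have hσ := S.σ_pos x
  have hB0 : 0 < B := hσ.trans_le (hB x)
  rw [localBlock_apply, ← integral_sub]
  · refine (norm_integral_stdNormal_le _
      (A := 2 * M * Real.exp (-((Real.pi / (2 * (ε * B))) ^ 2 / 4))) (D := 0)
      fun z => ?_).trans (le_of_eq (add_zero _))
    have hst : S.step ε x z = a + ((ε * (g / ε + S.σ x * z) : ℝ) : S1) := by
      have e : ε * (g / ε + S.σ x * z) = g + ε * S.σ x * z := by field_simp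
      rw [step, hx, e, AddCircle.coe_add, add_assoc]
    rw [add_zero, hst]
    by_cases h : |ε * (g / ε + S.σ x * z)| ≤ Real.pi
    · rw [lineLift_of_abs_le ε a δ h, sub_self, norm_zero]
      positivity
    · have h1 : Real.pi / (2 * (ε * B)) ≤ |z| := by
        rw [div_le_iff₀ (by positivity)]
        have e : ε * (g / ε + S.σ x * z) = g + ε * S.σ x * z := by field_simp
        rw [e, not_le] at h
        have h2 := h.trans_le (abs_add_le _ _)
        rw [abs_mul, abs_mul, abs_of_pos hε, abs_of_pos hσ] at h2
        have h3 : ε * S.σ x * |z| ≤ ε * B * |z| := by have := hB x; gcongr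
        linarith
      have h2 := one_le_exp_of_le_abs (by positivity) h1
      have h3 := norm_ext0_le a δ hM0 hM (a + ((ε * (g / ε + S.σ x * z) : ℝ) : S1))
      have h4 := norm_lineLift_le ε a δ hM0 hM (g / ε + S.σ x * z)
      calc _ ≤ M + M := (norm_sub_le _ _).trans (add_le_add h3 h4)
        _ = 2 * M * 1 := by ring
        _ ≤ 2 * M * (Real.exp (-((Real.pi / (2 * (ε * B))) ^ 2 / 4)) * Real.exp (z ^ 2 / 4)) := by
            gcongr
        _ = _ := by ring
  · exact S.integrable_step ε _ x
  · exact integrable_stdNormal_affine _ _ (measurable_lineLift ε a δ φ).stronglyMeasurable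
      (norm_lineLift_le ε a δ hM0 hM)

end NoisyCircleMap

/-! ### Linearisation at the fixed point and escape from it -/

theorem exists_abs_sub_le_mul_abs {g : ℝ → ℝ} (hg : ContDiff ℝ 1 g) :
    ∃ K > 0, ∀ t : ℝ, |t| ≤ 1 → |g t - g 0| ≤ K * |t| := by
  obtain ⟨K, hK⟩ := isCompact_Icc.exists_bound_of_continuousOn
    (s := Set.Icc (-1 : ℝ) 1) (hg.continuous_deriv le_rfl).continuousOn
  refine ⟨|K| + 1, by positivity, fun t ht => ?_⟩
  have h := (convex_Icc (-1 : ℝ) 1).norm_image_sub_le_of_norm_deriv_le (f := g) (C := |K| + 1)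
    (fun x _ => (hg.differentiable one_ne_zero).differentiableAt)
    (fun x hx => (hK x hx).trans (by linarith [le_abs_self K]))
    (show (0 : ℝ) ∈ Set.Icc (-1 : ℝ) 1 by simp) (show t ∈ Set.Icc (-1 : ℝ) 1 from abs_le.1 ht)
  simpa using h

theorem exists_abs_sub_linear_le {g : ℝ → ℝ} (hg : ContDiff ℝ 2 g) :
    ∃ K > 0, ∀ t : ℝ, |t| ≤ 1 → |g t - g 0 - deriv g 0 * t| ≤ K * t ^ 2 := by
  have hd : ContDiff ℝ 1 (deriv g) := by
    have : ContDiff ℝ (1 + 1) g := by rw [one_add_one_eq_two]; exact hg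
    exact (contDiff_succ_iff_deriv.1 this).2.2
  obtain ⟨K, hK0, hK⟩ := exists_abs_sub_le_mul_abs hd
  refine ⟨K, hK0, fun t ht => ?_⟩
  have hdiff : ∀ x, HasDerivAt (fun t => g t - deriv g 0 * t) (deriv g x - deriv g 0) x := fun x => by
    have h1 := ((hg.differentiable two_ne_zero).differentiableAt (x := x)).hasDerivAt
    have h2 : HasDerivAt (fun t => deriv g 0 * t) (deriv g 0) x := by
      simpa using (hasDerivAt_id x).const_mul (deriv g 0)
    exact h1.sub h2
  have h := (convex_Icc (-|t|) |t|).norm_image_sub_le_of_norm_hasDerivWithin_le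
    (f := fun t => g t - deriv g 0 * t) (C := K * |t|)
    (fun x _ => (hdiff x).hasDerivWithinAt)
    (fun x hx => by
      have hx' : |x| ≤ |t| := abs_le.2 hx
      exact (hK x (hx'.trans ht)).trans (by gcongr))
    (show (0 : ℝ) ∈ Set.Icc (-|t|) |t| by simp)
    (show t ∈ Set.Icc (-|t|) |t| from ⟨neg_abs_le t, le_abs_self t⟩)
  simp only [mul_zero, sub_zero, Real.norm_eq_abs] at h
  have e : K * |t| * |t| = K * t ^ 2 := by rw [mul_assoc, ← sq, sq_abs]
  rw [e] at h
  have e2 : g t - deriv g 0 * t - g 0 = g t - g 0 - deriv g 0 * t := by ring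
  rwa [e2] at h

namespace NoisyCircleMap

variable (S : NoisyCircleMap) {a : S1}

theorem exists_lift_at_fixed_point (ha : S.f a = a) :
    ∃ G : ℝ → ℝ, ContDiff ℝ ∞ G ∧ G 0 = 0 ∧ (∀ t : ℝ, S.f (a + (t : S1)) = a + (G t : S1)) ∧
      deriv G 0 = circleDeriv S.f a := by
  obtain ⟨F, hF, hfF⟩ := S.smooth_f
  obtain ⟨t₀, rfl⟩ := QuotientAddGroup.mk_surjective a
  change S.f (t₀ : S1) = (t₀ : S1) at ha
  set G : ℝ → ℝ := fun t => F (t₀ + t) - F t₀ with hG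
  have hGc : ContDiff ℝ ∞ G := by
    have : ContDiff ℝ ∞ (fun t : ℝ => t₀ + t) := contDiff_const.add contDiff_id
    exact (hF.comp this).sub contDiff_const
  have hf : ∀ t : ℝ, S.f ((t₀ : S1) + (t : S1)) = (t₀ : S1) + (G t : S1) := by
    intro t
    rw [← AddCircle.coe_add, hfF, hG]
    simp only
    rw [AddCircle.coe_sub, ← hfF t₀, ha]
    abel
  refine ⟨G, hGc, by simp [hG], hf, ?_⟩
  change deriv G 0 = deriv (fun s : ℝ => signedRep (S.f ((t₀ : S1) + (s : S1)) - S.f (t₀ : S1))) 0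
  apply Filter.EventuallyEq.deriv_eq
  have h0 : ∀ᶠ t in nhds (0 : ℝ), |G t| < Real.pi := by
    have : Filter.Tendsto (fun t => |G t|) (nhds 0) (nhds |G 0|) :=
      (hGc.continuous.abs).tendsto 0
    refine this.eventually_lt_const ?_
    simp [hG, Real.pi_pos]
  filter_upwards [h0] with t ht
  rw [hf, ha, add_sub_cancel_left, signedRep_coe ht]

theorem exists_sigma_bounds : ∃ σm > 0, ∃ B, ∀ x, σm ≤ S.σ x ∧ S.σ x ≤ B := by
  obtain ⟨x, _, hx⟩ := isCompact_univ.exists_isMinOn (Set.univ_nonempty (α := S1))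
    S.continuous_σ.continuousOn
  obtain ⟨x', _, hx'⟩ := isCompact_univ.exists_isMaxOn (Set.univ_nonempty (α := S1))
    S.continuous_σ.continuousOn
  exact ⟨S.σ x, S.σ_pos x, S.σ x', fun y => ⟨hx (Set.mem_univ y), hx' (Set.mem_univ y)⟩⟩

/-- Quantitative linearisation of the chain near an unstable fixed point. -/
theorem exists_linearisation (ha : S.f a = a) {b : ℝ} (hb : b < |circleDeriv S.f a|) :
    ∃ (G : ℝ → ℝ) (L ρ₀ : ℝ), 0 < L ∧ 0 < ρ₀ ∧
      (∀ t : ℝ, S.f (a + (t : S1)) = a + (G t : S1)) ∧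
      ∀ t : ℝ, |t| ≤ ρ₀ → |G t - circleDeriv S.f a * t| ≤ L * t ^ 2 ∧
        |S.σ (a + (t : S1)) - S.σ a| ≤ L * |t| ∧ |G t| ≤ L * |t| ∧
        |G t - circleDeriv S.f a * t| ≤ (|circleDeriv S.f a| - b) * |t| ∧ |G t| ≤ Real.pi / 2 := by
  obtain ⟨G, hG, hG0, hf, hd⟩ := S.exists_lift_at_fixed_point ha
  obtain ⟨K₁, hK₁, h₁⟩ := exists_abs_sub_linear_le (hG.of_le (WithTop.coe_le_coe.2 le_top) :
    ContDiff ℝ 2 G)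
  obtain ⟨K₂, hK₂, h₂⟩ := exists_abs_sub_le_mul_abs (hG.of_le (by exact_mod_cast le_top) :
    ContDiff ℝ 1 G)
  have hσ : ContDiff ℝ 1 (fun t : ℝ => S.σ (a + (t : S1))) := by
    obtain ⟨t₀, rfl⟩ := QuotientAddGroup.mk_surjective a
    have h : ContDiff ℝ ∞ (fun t : ℝ => t₀ + t) := contDiff_const.add contDiff_id
    have := (S.smooth_σ.comp h).of_le (show (1 : WithTop ℕ∞) ≤ ∞ by exact_mod_cast le_top)
    exact this
  obtain ⟨K₃, hK₃, h₃⟩ := exists_abs_sub_le_mul_abs hσ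
  set c := circleDeriv S.f a with hc
  -- The radius keeps the quadratic error below (|c| - b)|t|, so that all means between G(t) and ct
  -- still expand by b, and keeps |G(t)| below a quarter turn.
  refine ⟨G, max K₁ (max K₂ K₃), min 1 (min ((|c| - b) / K₁) (Real.pi / 2 / K₂)),
    lt_max_of_lt_left hK₁, ?_, hf, fun t ht => ?_⟩
  · have : 0 < |c| - b := by linarith
    have := Real.pi_pos
    positivity
  have ht1 : |t| ≤ 1 := ht.trans (min_le_left _ _)
  have ht2 : |t| ≤ (|c| - b) / K₁ := ht.trans ((min_le_right _ _).trans (min_le_left _ _))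
  have ht3 : |t| ≤ Real.pi / 2 / K₂ := ht.trans ((min_le_right _ _).trans (min_le_right _ _))
  rw [le_div_iff₀ hK₁] at ht2
  rw [le_div_iff₀ hK₂] at ht3
  have e1 := h₁ t ht1
  have e2 := h₂ t ht1
  have e3 := h₃ t ht1
  rw [hG0, sub_zero] at e2
  rw [hG0, sub_zero, hd] at e1
  simp only [AddCircle.coe_zero, add_zero] at e3
  have m1 : K₁ ≤ max K₁ (max K₂ K₃) := le_max_left _ _
  have m2 : K₂ ≤ max K₁ (max K₂ K₃) := (le_max_left _ _).trans (le_max_right _ _)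
  have m3 : K₃ ≤ max K₁ (max K₂ K₃) := (le_max_right _ _).trans (le_max_right _ _)
  refine ⟨e1.trans (by gcongr), e3.trans (by gcongr), e2.trans (by gcongr), e1.trans ?_,
    e2.trans (by linarith)⟩
  rw [← sq_abs t, sq, ← mul_assoc]
  exact mul_le_mul_of_nonneg_right (by linarith) (abs_nonneg t)

/-- All points away from `a` leave the ball about `a` in uniformly many steps, robustly. -/
theorem exists_escape {xs : S1} {δ ρ : ℝ} (hδ : 0 < δ) (hρ : 0 < ρ) (hxs : S.f xs = xs)
    (hsep : xs ∉ Metric.ball a δ)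
    (hconv : ∀ x, x ≠ a → Filter.Tendsto (fun n : ℕ => S.f^[n] x) Filter.atTop (nhds xs))
    (hV : ∃ η > 0, ∀ x, x ∉ Metric.ball a δ → η < Metric.infDist (S.f x) (Metric.ball a δ)) :
    ∃ N : ℕ, ∃ θ > 0, ∀ x, ρ ≤ dist x a → x ∈ escapeSet S.f (Metric.ball a δ) θ N := by
  -- The separation hypothesis at the fixed point xs itself puts xs at positive distance from the
  -- ball, so the convergent orbits enter an open part of the complement.
  have hint : xs ∈ interior (Metric.ball a δ)ᶜ := by
    obtain ⟨η, hη, h⟩ := hV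
    have h1 := h xs hsep
    rw [hxs] at h1
    rw [interior_compl, Set.mem_compl_iff,
      Metric.mem_closure_iff_infDist_zero ⟨a, Metric.mem_ball_self hδ⟩]
    linarith
  have hK : IsCompact {x : S1 | ρ ≤ dist x a} :=
    (isClosed_le continuous_const (continuous_id.dist continuous_const)).isCompact
  obtain ⟨N, θ, hθ, h⟩ := hK.exists_subset_escapeSet S.continuous_f (Metric.ball a δ) (fun x hx => by
    have hxa : x ≠ a := by
      rintro rfl
      have : ρ ≤ dist x x := hx
      rw [dist_self] at this
      linarith
    exact ((hconv x hxa).eventually (isOpen_interior.mem_nhds hint)).exists)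
  exact ⟨N, θ, hθ, fun x hx => h hx⟩

end NoisyCircleMap

/-! ### From the block operator to the Gaussian operator on the line -/

namespace NoisyCircleMap

variable (S : NoisyCircleMap) {a : S1}

/-- After N steps the N-th power is exponentially small at x, while the chain relations express it
as μ'^N v plus a multiple of φ. Dividing by powers of modulus at least r^N, first for φ and then for
v, transfers the smallness to v itself. -/
theorem norm_apply_le_of_mem_escapeSet {ε δ B θ r : ℝ} (hε : 0 < ε) (hB0 : 0 < B)
    (hB : ∀ x, S.σ x ≤ B) (hθ : 0 ≤ θ) (hr : 0 < r) {φ v : BddMeas (Metric.ball a δ)} {μ μ' b : ℂ}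
    (hφ : S.localBlock ε a δ φ = μ • φ) (hv : S.localBlock ε a δ v = μ' • v + b • φ)
    (hμr : r < ‖μ‖) (hμ : ‖μ‖ ≤ 1) (hμr' : r < ‖μ'‖) (hμ' : ‖μ'‖ ≤ 1) {Mφ Mv : ℝ}
    (hMφ0 : 0 ≤ Mφ) (hMv0 : 0 ≤ Mv) (hMφ : ∀ x, ‖φ.1 x‖ ≤ Mφ) (hMv : ∀ x, ‖v.1 x‖ ≤ Mv) {N : ℕ}
    {x : Metric.ball a δ} (hx : x.1 ∈ escapeSet S.f (Metric.ball a δ) θ N) :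
    ‖v.1 x‖ ≤ (r ^ N)⁻¹ * N * (1 + N * (r ^ N)⁻¹) * normalExpMoment *
      Real.exp (-((θ / (ε * B)) ^ 2 / 4)) * (Mv + ‖b‖ * Mφ) := by
  set P := normalExpMoment * Real.exp (-((θ / (ε * B)) ^ 2 / 4)) with hP
  have hm := one_le_normalExpMoment
  have hP0 : 0 ≤ P := by positivity
  have h1 := S.norm_localBlock_pow_le_of_mem_escapeSet a δ hε hB0 hB hθ hMφ0 hMφ N x hx
  have h2 := S.norm_localBlock_pow_le_of_mem_escapeSet a δ hε hB0 hB hθ hMv0 hMv N x hx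
  obtain ⟨d, hd, hN⟩ := S.exists_localBlock_pow_of_chain hφ hv hμ hμ' N
  rw [S.localBlock_pow_of_eigen hφ N] at h1
  have e1 : (μ ^ N • φ).1 x = μ ^ N * φ.1 x := rfl
  have e2 : ((S.localBlock ε a δ ^ N) v).1 x = μ' ^ N * v.1 x + b * d * φ.1 x := by rw [hN]; rfl
  rw [e1, norm_mul, norm_pow] at h1
  rw [← hP] at h1 h2
  have hrN : 0 < r ^ N := by positivity
  have p1 : r ^ N ≤ ‖μ‖ ^ N := pow_le_pow_left₀ hr.le hμr.le N
  have p2 : r ^ N ≤ ‖μ'‖ ^ N := pow_le_pow_left₀ hr.le hμr'.le N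
  have h3 : ‖φ.1 x‖ ≤ (r ^ N)⁻¹ * (N * (Mφ * P)) := by
    rw [← div_eq_inv_mul, le_div_iff₀ hrN, mul_comm]
    exact (mul_le_mul_of_nonneg_right p1 (norm_nonneg _)).trans h1
  have h4 : ‖μ' ^ N * v.1 x‖ ≤ N * (Mv * P) + ‖b‖ * N * ((r ^ N)⁻¹ * (N * (Mφ * P))) := by
    have e3 : μ' ^ N * v.1 x = ((S.localBlock ε a δ ^ N) v).1 x - b * d * φ.1 x := by
      rw [e2]; ring
    rw [e3]
    refine (norm_sub_le _ _).trans (add_le_add h2 ?_)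
    rw [norm_mul, norm_mul]
    gcongr
  rw [norm_mul, norm_pow] at h4
  have h5 : ‖v.1 x‖ ≤ (r ^ N)⁻¹ *
      (N * (Mv * P) + ‖b‖ * N * ((r ^ N)⁻¹ * (N * (Mφ * P)))) := by
    rw [← div_eq_inv_mul, le_div_iff₀ hrN, mul_comm]
    exact (mul_le_mul_of_nonneg_right p2 (norm_nonneg _)).trans h4
  refine h5.trans ?_
  -- These nonnegative terms are added so that the bound factors with Mv + ‖b‖ * Mφ.
  have h6 : 0 ≤ (r ^ N)⁻¹ * (‖b‖ * (N * (Mφ * P)) + N * (N * (r ^ N)⁻¹) * (Mv * P)) := by positivity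
  calc _ ≤ (r ^ N)⁻¹ * (N * (Mv * P) + ‖b‖ * N * ((r ^ N)⁻¹ * (N * (Mφ * P))))
        + (r ^ N)⁻¹ * (‖b‖ * (N * (Mφ * P)) + N * (N * (r ^ N)⁻¹) * (Mv * P)) :=
        le_add_of_nonneg_right h6
    _ = _ := by rw [hP]; ring

set_option maxHeartbeats 800000 in
/-- In the rescaled coordinate, Jordan chains of the block operator are approximate Jordan chains
of the linearised Gaussian operator on the whole line. -/
theorem exists_norm_gaussOp_lineLift_sub_le {xs : S1} {δ β c r : ℝ} (hxs : S.f xs = xs)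
    (ha : S.f a = a) (hc : c = circleDeriv S.f a) (hc1 : 1 < |c|)
    (hconv : ∀ x, x ≠ a → Filter.Tendsto (fun n : ℕ => S.f^[n] x) Filter.atTop (nhds xs))
    (hδ : 0 < δ) (hδπ : δ ≤ Real.pi) (hsep : xs ∉ Metric.ball a δ)
    (hV : ∃ η > 0, ∀ x, x ∉ Metric.ball a δ → η < Metric.infDist (S.f x) (Metric.ball a δ))
    (hβ : 0 < β) (hr : 0 < r) :
    ∃ k q ρ C : ℝ, 0 < k ∧ 0 < q ∧ q ≤ k ∧ k ≤ β ^ 2 / 4 ∧ 1 + 4 * k * S.σ a ^ 2 ≤ c ^ 2 ∧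
      0 < C ∧ ∀ (ε : ℝ), 0 < ε → ε ≤ 1 → ∀ (φ v : BddMeas (Metric.ball a δ)) (μ μ' b : ℂ)
      (Mφ Mv : ℝ), S.localBlock ε a δ φ = μ • φ → S.localBlock ε a δ v = μ' • v + b • φ →
      r < ‖μ‖ → ‖μ‖ ≤ 1 → r < ‖μ'‖ → ‖μ'‖ ≤ 1 → 0 ≤ Mφ → 0 ≤ Mv →
      (∀ y, ‖lineLift ε a δ φ y‖ ≤ Mφ * plateauWeight k q (ρ / ε) y) →
      (∀ y, ‖lineLift ε a δ v y‖ ≤ Mv * plateauWeight k q (ρ / ε) y) →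
      ∀ y, ‖gaussOp c (S.σ a) (lineLift ε a δ v) y - μ' * lineLift ε a δ v y
        - b * lineLift ε a δ φ y‖ ≤ C * ε * (Mv + ‖b‖ * Mφ) * plateauWeight k q (ρ / ε) y := by
  obtain ⟨σm, hσm, B, hσ⟩ := S.exists_sigma_bounds
  have hB : ∀ x, S.σ x ≤ B := fun x => (hσ x).2
  have hσa := S.σ_pos a
  have hB0 : 0 < B := hσa.trans_le (hB a)
  set b₁ : ℝ := (1 + |c|) / 2 with hb₁
  have hb1 : 1 < b₁ := by rw [hb₁]; linarith
  have hbc : b₁ < |c| := by rw [hb₁]; linarith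
  obtain ⟨G, L, ρ₀, hL, hρ₀, hG, hlin⟩ := S.exists_linearisation ha (b := b₁) (by rwa [← hc])
  rw [← hc] at hlin
  set ρ := min ρ₀ δ with hρ
  have hρp : 0 < ρ := lt_min hρ₀ hδ
  have hρδ : ρ ≤ δ := min_le_right _ _
  have hρρ : ρ ≤ ρ₀ := min_le_left _ _
  obtain ⟨N, θ, hθ, hesc⟩ := S.exists_escape hδ (half_pos hρp) hxs hsep hconv hV
  have hπ := Real.pi_pos
  -- The rates of the three rare events: wrapping around the circle (κ₁/ε²), noise beyond the escape
  -- tolerance θ (κ₂/ε²), and a jump inward from y on the line against the expansion (κ₃ y²).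
  set κ₁ := Real.pi ^ 2 / (16 * B ^ 2) with hκ₁
  set κ₂ := θ ^ 2 / (4 * B ^ 2) with hκ₂
  set κ₃ := ((|c| - 1) / S.σ a) ^ 2 / 4 with hκ₃
  have hκ₁p : 0 < κ₁ := by positivity
  have hκ₂p : 0 < κ₂ := by positivity
  have hκ₃p : 0 < κ₃ := by
    have : 0 < |c| - 1 := by linarith
    positivity
  have hc2 : 1 < c ^ 2 := by rw [← sq_abs]; exact one_lt_pow₀ hc1 (by norm_num)
  have hb2 : 1 < b₁ ^ 2 := one_lt_pow₀ hb1 (by norm_num)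
  -- A small k leaves exp(-kρ²/ε²), the floor of the weight, so large that each rare event stays
  -- below it with part of its rate to spare; that spare part supplies the factor ε.
  obtain ⟨k, hk, hk1, hk2, hk3, hk4, hk5, hk6⟩ : ∃ k > 0, k ≤ β ^ 2 / 4 ∧
      k ≤ 1 / (4 * B ^ 2) * (b₁ ^ 2 - 1) / 4 ∧ k ≤ (c ^ 2 - 1) / (4 * S.σ a ^ 2) ∧
      k ≤ κ₁ / (2 * ρ ^ 2) ∧ k ≤ κ₂ / (2 * ρ ^ 2) ∧ k ≤ κ₃ / 16 := by
    have p1 : 0 < β ^ 2 / 4 := by positivity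
    have p2 : 0 < 1 / (4 * B ^ 2) * (b₁ ^ 2 - 1) / 4 := by
      have : 0 < b₁ ^ 2 - 1 := by linarith
      positivity
    have p3 : 0 < (c ^ 2 - 1) / (4 * S.σ a ^ 2) := by
      have : 0 < c ^ 2 - 1 := by linarith
      positivity
    have p4 : 0 < κ₁ / (2 * ρ ^ 2) := by positivity
    have p5 : 0 < κ₂ / (2 * ρ ^ 2) := by positivity
    have p6 : 0 < κ₃ / 16 := by positivity
    obtain ⟨k, hk, h⟩ := exists_between (lt_min p1 (lt_min p2 (lt_min p3 (lt_min p4 (lt_min p5 p6)))))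
    simp only [lt_min_iff] at h
    obtain ⟨q1, q2, q3, q4, q5, q6⟩ := h
    exact ⟨k, hk, q1.le, q2.le, q3.le, q4.le, q5.le, q6.le⟩
  -- With this rate exp(-q y²) falls to the floor exp(-kρ²/ε²) exactly at |εy| = π, so the plateau
  -- covers the whole circle.
  set q := k * ρ ^ 2 / Real.pi ^ 2 with hq
  have hqp : 0 < q := by positivity
  have hqk : q ≤ k := by
    rw [hq, div_le_iff₀ (by positivity)]
    have : ρ ≤ Real.pi := hρδ.trans hδπ
    gcongr
  have hcs : 1 + 4 * k * S.σ a ^ 2 ≤ c ^ 2 := by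
    rw [le_div_iff₀ (by positivity)] at hk3
    linarith
  rw [le_div_iff₀ (by positivity)] at hk4 hk5
  obtain ⟨C₁, hC₁, hnear⟩ := exists_norm_integral_sub_le (c := c) (σ₀ := S.σ a) (b := b₁) (σm := σm)
    (B := B) (L := L) (k := k) (q := q) hb1 hσm (hσ a).1 (hB a) hL.le hk hqp hk2
  have hm := one_le_normalExpMoment
  set m := normalExpMoment with hm_def
  have hm0 : 0 < m := by linarith
  clear_value m
  set C₂ : ℝ := (r ^ N)⁻¹ * N * (1 + N * (r ^ N)⁻¹) * m * (1 / (κ₂ / 2)) * 2 with hC₂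
  have hC₂0 : 0 ≤ C₂ := by positivity
  set C₃ : ℝ := (C₂ + 2 * (1 / (κ₃ * ρ ^ 2 / 16))) * m + C₂ + C₂ with hC₃
  set C₄ : ℝ := C₁ + 4 * (1 / (κ₁ / 2)) * m with hC₄
  have hC₃0 : 0 ≤ C₃ := by positivity
  have hC₄0 : 0 < C₄ := by positivity
  clear_value κ₁ κ₂ κ₃ q b₁ C₂ C₃ C₄
  have hk6' : κ₃ * ρ ^ 2 / 16 + k * ρ ^ 2 ≤ κ₃ * ρ ^ 2 / 8 := by
    have := mul_le_mul_of_nonneg_right hk6 (sq_nonneg ρ)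
    linarith
  clear_value ρ
  refine ⟨k, q, ρ, C₄ + C₃, hk, hqp, hqk, hk1, hcs, by positivity, ?_⟩
  intro ε hε hε1 φ v μ μ' b Mφ Mv hφ hv hμr hμ1 hμr' hμ1' hMφ0 hMv0 hMφ hMv
  set R := ρ / ε with hR
  have hadm := admissibleWeight_plateauWeight (c := c) (s := S.σ a) R hk hqp hqk hcs hσa.le
  set w := plateauWeight k q R with hw
  set τ := Real.exp (-(k * ρ ^ 2 / ε ^ 2)) with hτ
  have hkR : k * R ^ 2 = k * ρ ^ 2 / ε ^ 2 := by rw [hR, div_pow]; ring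
  have hτR : Real.exp (-k * R ^ 2) = τ := by rw [hτ, ← hkR, neg_mul]
  have hτw : ∀ y, |ε * y| ≤ Real.pi → τ ≤ w y := by
    intro y hy
    rw [hw, plateauWeight, hτR, min_eq_left]
    · linarith [Real.exp_pos (-k * y ^ 2)]
    · rw [← hτR]
      apply Real.exp_le_exp.2
      have h1 : (ε * y) ^ 2 ≤ Real.pi ^ 2 := by
        rw [← sq_abs]; exact pow_le_pow_left₀ (abs_nonneg _) hy 2
      have h2 : q * y ^ 2 ≤ k * R ^ 2 := by
        rw [hkR, le_div_iff₀ (by positivity), hq, div_mul_eq_mul_div, div_mul_eq_mul_div,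
          div_le_iff₀ (by positivity)]
        have : k * ρ ^ 2 * y ^ 2 * ε ^ 2 = k * ρ ^ 2 * (ε * y) ^ 2 := by ring
        rw [this]; gcongr
      linarith
  clear_value R
  have hτ0 : 0 < τ := by rw [hτ]; exact Real.exp_pos _
  have hτ1 : τ ≤ 1 := by rw [hτ, Real.exp_le_one_iff, neg_nonpos]; positivity
  have hsup : ∀ (u : BddMeas (Metric.ball a δ)) (M : ℝ), 0 ≤ M →
      (∀ y, ‖lineLift ε a δ u y‖ ≤ M * w y) → ∀ x, ‖u.1 x‖ ≤ M * 2 := by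
    intro u M hM0 hM x
    rw [apply_eq_lineLift hε u x]
    exact hadm.norm_le_const hqp.le hM0 hM _
  have hφs := hsup φ Mφ hMφ0 hMφ
  have hvs := hsup v Mv hMv0 hMv
  -- Functions in the chain are of size ε relative to the weight at distance at least ρ/2 from a,
  -- because those points escape. The case e = 0 covers φ itself.
  have hfar : ∀ (u : BddMeas (Metric.ball a δ)) (ν e : ℂ) (Mu : ℝ),
      S.localBlock ε a δ u = ν • u + e • φ → r < ‖ν‖ → ‖ν‖ ≤ 1 → 0 ≤ Mu →
      (∀ x, ‖u.1 x‖ ≤ Mu * 2) → ∀ y, ρ / 2 ≤ |ε * y| →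
      ‖lineLift ε a δ u y‖ ≤ C₂ * ε * (Mu + ‖e‖ * Mφ) * w y := by
    intro u ν e Mu hu hνr hν1 hMu0 hMu y hy
    have hwy := (hadm.pos y).le
    by_cases hyδ : |ε * y| < δ
    · rw [lineLift_of_lt ε a δ u hyδ]
      have hyπ : |ε * y| ≤ Real.pi := hyδ.le.trans hδπ
      have hx := hesc (a + ((ε * y : ℝ) : S1)) (by
        rw [S1.dist_add_coe, S1.norm_coe_eq_abs hyπ]; exact hy)
      refine (S.norm_apply_le_of_mem_escapeSet hε hB0 hB hθ.le hr hφ hu hμr hμ1 hνr hν1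
        (by positivity) (by positivity) hφs hMu
        (x := ⟨a + ((ε * y : ℝ) : S1), add_coe_mem_ball a δ hyδ⟩) hx).trans ?_
      have e1 : (θ / (ε * B)) ^ 2 / 4 = κ₂ / ε ^ 2 := by rw [hκ₂]; field_simp
      have e2 := exp_neg_div_sq_le (κ := κ₂ / 2) (p := k * ρ ^ 2) (P := κ₂) hε hε1
        (by positivity) (by linarith)
      rw [e1, ← hm_def]
      calc _ ≤ (r ^ N)⁻¹ * N * (1 + N * (r ^ N)⁻¹) * m *
            (1 / (κ₂ / 2) * ε * w y) * (Mu * 2 + ‖e‖ * (Mφ * 2)) := by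
            gcongr
            refine e2.trans ?_
            have := hτw y hyπ
            gcongr
        _ = _ := by rw [hC₂]; ring
    · rw [lineLift_of_ge ε a δ u (not_lt.1 hyδ), norm_zero]
      positivity
  have hMt : 0 ≤ Mv + ‖b‖ * Mφ := by positivity
  have hfv := hfar v μ' b Mv hv hμr' hμ1' hMv0 hvs
  have hfφ := hfar φ μ 0 Mφ (by rw [hφ, zero_smul, add_zero]) hμr hμ1 hMφ0 hφs
  simp only [norm_zero, zero_mul, add_zero] at hfφ
  intro y
  have hwy := hadm.pos y
  have hεy : |ε * y| = ε * |y| := by rw [abs_mul, abs_of_pos hε]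
  by_cases hy : |ε * y| ≤ ρ / 2
  · -- inner region
    have hyδ : |ε * y| < δ := by linarith
    have hyR : |y| ≤ R / 2 := by
      rw [hR, div_div, mul_comm, ← div_div, le_div_iff₀ hε, mul_comm, ← hεy]
      exact hy
    set x : Metric.ball a δ := ⟨a + ((ε * y : ℝ) : S1), add_coe_mem_ball a δ hyδ⟩ with hx
    obtain ⟨l1, l2, l3, l4, l5⟩ := hlin (ε * y) (by linarith)
    have hT : (S.localBlock ε a δ v).1 x = μ' * lineLift ε a δ v y + b * lineLift ε a δ φ y := by
      rw [hv, lineLift_of_lt ε a δ v hyδ, lineLift_of_lt ε a δ φ hyδ]; rfl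
    have h1 := S.norm_localBlock_sub_integral_le hε hB (M := Mv * 2) (by positivity) hvs x
      (hG (ε * y)) l5
    have hdiv : ∀ X Y : ℝ, |X| ≤ Y → |X / ε| ≤ Y / ε := fun X Y h => by
      rw [abs_div, abs_of_pos hε]; gcongr
    have ec : G (ε * y) / ε - c * y = (G (ε * y) - c * (ε * y)) / ε := by field_simp
    have h2 := hnear ε R y (G (ε * y) / ε) (S.σ x) Mv (lineLift ε a δ v) hε hMv0 hyR (hσ x).1 (hB x)
      (l2.trans (le_of_eq (by rw [hεy]; ring)))
      (by rw [ec]; exact (hdiv _ _ l1).trans (le_of_eq (by field_simp)))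
      ((hdiv _ _ l3).trans (le_of_eq (by rw [hεy]; field_simp)))
      (by rw [ec]; exact (hdiv _ _ l4).trans (le_of_eq (by rw [hεy]; field_simp)))
      (measurable_lineLift ε a δ v) hMv
    have e1 : (Real.pi / (2 * (ε * B))) ^ 2 / 4 = κ₁ / ε ^ 2 := by rw [hκ₁]; field_simp; norm_num
    have e2 := exp_neg_div_sq_le (κ := κ₁ / 2) (p := k * ρ ^ 2) (P := κ₁) hε hε1
      (by positivity) (by linarith)
    rw [e1, ← hm_def] at h1
    have h3 : ‖(S.localBlock ε a δ v).1 x - ∫ z, lineLift ε a δ v (G (ε * y) / ε + S.σ x * z)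
        ∂stdNormal‖ ≤ 4 * (1 / (κ₁ / 2)) * m * ε * Mv * w y := by
      refine h1.trans ?_
      have := hτw y (hyδ.le.trans hδπ)
      calc _ ≤ 2 * (Mv * 2) * (1 / (κ₁ / 2) * ε * w y) * m := by
            gcongr
            refine e2.trans ?_
            gcongr
        _ = _ := by ring
    have h4 : gaussOp c (S.σ a) (lineLift ε a δ v) y - μ' * lineLift ε a δ v y
        - b * lineLift ε a δ φ y = -((S.localBlock ε a δ v).1 x
          - ∫ z, lineLift ε a δ v (G (ε * y) / ε + S.σ x * z) ∂stdNormal)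
          - (∫ z, lineLift ε a δ v (G (ε * y) / ε + S.σ x * z) ∂stdNormal
            - ∫ z, lineLift ε a δ v (c * y + S.σ a * z) ∂stdNormal) := by
      rw [hT, gaussOp]; ring
    rw [h4]
    refine (norm_sub_le _ _).trans ?_
    rw [norm_neg]
    have h5 := hadm.lower y
    calc _ ≤ 4 * (1 / (κ₁ / 2)) * m * ε * Mv * w y + C₁ * ε * Mv * w y := by
          refine add_le_add h3 (h2.trans ?_)
          gcongr
      _ = C₄ * ε * Mv * w y := by rw [hC₄]; ring
      _ ≤ (C₄ + C₃) * ε * (Mv + ‖b‖ * Mφ) * w y := by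
          gcongr
          · linarith
          · have : 0 ≤ ‖b‖ * Mφ := by positivity
            linarith
  · -- outer region
    have hy' : ρ / 2 ≤ |ε * y| := (not_le.1 hy).le
    have hyR : R / 2 ≤ |y| := by
      rw [hR, div_div, mul_comm, ← div_div, div_le_iff₀ hε, mul_comm, ← hεy]
      exact hy'
    have hRp : 0 < R := by rw [hR]; positivity
    have hinner : Real.exp (-(κ₃ * y ^ 2)) ≤ 1 / (κ₃ * ρ ^ 2 / 16) * ε * w y := by
      have hy2 : R ^ 2 / 4 ≤ y ^ 2 := by
        have := pow_le_pow_left₀ (by positivity) hyR 2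
        rw [sq_abs] at this
        linarith
      have h1 : Real.exp (-(κ₃ * y ^ 2)) ≤
          Real.exp (-(κ₃ * ρ ^ 2 / 8 / ε ^ 2)) * Real.exp (-q * y ^ 2) := by
        rw [← Real.exp_add]
        apply Real.exp_le_exp.2
        have e : κ₃ * ρ ^ 2 / 8 / ε ^ 2 = κ₃ / 8 * R ^ 2 := by rw [hR, div_pow]; ring
        rw [e]
        have : q ≤ κ₃ / 2 := by linarith
        have a1 := mul_le_mul_of_nonneg_left hy2 (half_pos hκ₃p).le
        have a2 := mul_le_mul_of_nonneg_right this (sq_nonneg y)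
        linarith
      have h2 := exp_neg_div_sq_le (κ := κ₃ * ρ ^ 2 / 16) (p := k * ρ ^ 2) (P := κ₃ * ρ ^ 2 / 8)
        hε hε1 (by positivity) hk6'
      have h3 : τ * Real.exp (-q * y ^ 2) ≤ w y := by
        have t2 : Real.exp (-q * y ^ 2) ≤ 1 :=
          Real.exp_le_one_iff.2 (by rw [neg_mul, neg_nonpos]; positivity)
        have t4 := Real.exp_pos (-q * y ^ 2)
        have : τ * Real.exp (-q * y ^ 2) ≤ min τ (Real.exp (-q * y ^ 2)) :=
          le_min (mul_le_of_le_one_right hτ0.le t2) (mul_le_of_le_one_left t4.le hτ1)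
        rw [hw, plateauWeight, hτR]
        linarith [Real.exp_pos (-k * y ^ 2)]
      calc _ ≤ (1 / (κ₃ * ρ ^ 2 / 16) * ε * τ) * Real.exp (-q * y ^ 2) :=
            h1.trans (mul_le_mul_of_nonneg_right h2 (Real.exp_pos _).le)
        _ = 1 / (κ₃ * ρ ^ 2 / 16) * ε * (τ * Real.exp (-q * y ^ 2)) := by ring
        _ ≤ _ := by gcongr
    have hgo : ‖gaussOp c (S.σ a) (lineLift ε a δ v) y‖
        ≤ (C₂ + 2 * (1 / (κ₃ * ρ ^ 2 / 16))) * ε * (Mv + ‖b‖ * Mφ) * w y * m := by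
      rw [hm_def]
      refine (norm_integral_stdNormal_le _
        (A := (C₂ + 2 * (1 / (κ₃ * ρ ^ 2 / 16))) * ε * (Mv + ‖b‖ * Mφ) * w y) (D := 0)
        fun z => ?_).trans (le_of_eq (add_zero _))
      rw [add_zero]
      set Y := c * y + S.σ a * z with hY
      have hκρ : 0 ≤ 1 / (κ₃ * ρ ^ 2 / 16) := by positivity
      -- Either the image stays in the far region, where v is already small, or it comes back inside
      -- although the mean moved outward, which requires |z| ≥ (|c| - 1)|y|/σ(a).
      by_cases hYf : ρ / 2 ≤ |ε * Y|
      · have h1 := plateauWeight_affine_le (R := R) hk hqp hqk hcs hσa.le y z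
        calc _ ≤ C₂ * ε * (Mv + ‖b‖ * Mφ) * w Y := hfv Y hYf
          _ ≤ C₂ * ε * (Mv + ‖b‖ * Mφ) * (Real.exp (z ^ 2 / 4) * w y) := by gcongr
          _ = C₂ * ε * (Mv + ‖b‖ * Mφ) * w y * Real.exp (z ^ 2 / 4) := by ring
          _ ≤ _ := by
              gcongr
              linarith
      · have hYR : |Y| ≤ |y| := by
          rw [not_le, abs_mul, abs_of_pos hε] at hYf
          rw [hεy] at hy'
          exact (lt_of_mul_lt_mul_left (hYf.trans_le hy') hε.le).le
        have hz : (|c| - 1) / S.σ a * |y| ≤ |z| := by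
          rw [div_mul_eq_mul_div, div_le_iff₀ hσa]
          have h1 := abs_sub_abs_le_abs_sub (c * y) (-(S.σ a * z))
          rw [abs_neg, sub_neg_eq_add, abs_mul, abs_mul, abs_of_pos hσa, ← hY] at h1
          linarith
        have h1 := one_le_exp_of_le_abs (mul_nonneg (div_nonneg (by linarith) hσa.le)
          (abs_nonneg y)) hz
        have e : ((|c| - 1) / S.σ a * |y|) ^ 2 / 4 = κ₃ * y ^ 2 := by
          rw [hκ₃, mul_pow, sq_abs]; ring
        rw [e] at h1
        calc ‖lineLift ε a δ v Y‖ ≤ Mv * 2 * 1 := by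
              rw [mul_one]; exact norm_lineLift_le ε a δ (by positivity) hvs Y
          _ ≤ Mv * 2 * (1 / (κ₃ * ρ ^ 2 / 16) * ε * w y * Real.exp (z ^ 2 / 4)) := by
              gcongr
              exact h1.trans (by gcongr)
          _ = (2 * (1 / (κ₃ * ρ ^ 2 / 16))) * ε * Mv * w y * Real.exp (z ^ 2 / 4) := by ring
          _ ≤ _ := by
              have : 0 ≤ ‖b‖ * Mφ := by positivity
              gcongr
              · linarith
              · linarith
    have hv1 : ‖μ' * lineLift ε a δ v y‖ ≤ C₂ * ε * (Mv + ‖b‖ * Mφ) * w y := by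
      rw [norm_mul]
      exact (mul_le_of_le_one_left (norm_nonneg _) hμ1').trans (hfv y hy')
    have hφ1 : ‖b * lineLift ε a δ φ y‖ ≤ C₂ * ε * (Mv + ‖b‖ * Mφ) * w y := by
      rw [norm_mul]
      calc ‖b‖ * ‖lineLift ε a δ φ y‖ ≤ ‖b‖ * (C₂ * ε * Mφ * w y) := by
            gcongr; exact hfφ y hy'
        _ = C₂ * ε * (‖b‖ * Mφ) * w y := by ring
        _ ≤ _ := by
            gcongr
            linarith
    refine (norm_sub_le _ _).trans ((add_le_add (norm_sub_le _ _) le_rfl).trans ?_)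
    calc _ ≤ (C₂ + 2 * (1 / (κ₃ * ρ ^ 2 / 16))) * ε * (Mv + ‖b‖ * Mφ) * w y * m
          + C₂ * ε * (Mv + ‖b‖ * Mφ) * w y + C₂ * ε * (Mv + ‖b‖ * Mφ) * w y :=
          add_le_add (add_le_add hgo hv1) hφ1
      _ = C₃ * ε * (Mv + ‖b‖ * Mφ) * w y := by rw [hC₃]; ring
      _ ≤ _ := by
          gcongr
          linarith

end NoisyCircleMap

/-! ### Hermite shape and uniqueness of eigenfunctions -/

namespace NoisyCircleMap

variable (S : NoisyCircleMap) {a : S1}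

theorem lineLift_sub_smul (ε : ℝ) (a : S1) (δ : ℝ) (φ ψ : BddMeas (Metric.ball a δ)) (t : ℂ)
    (y : ℝ) : lineLift ε a δ (φ - t • ψ) y = lineLift ε a δ φ y - t * lineLift ε a δ ψ y := by
  unfold lineLift ext0
  rw [map_sub, map_smul]
  split_ifs
  · rfl
  · simp

theorem lineLift_smul (ε : ℝ) (a : S1) (δ : ℝ) (ψ : BddMeas (Metric.ball a δ)) (t : ℂ)
    (y : ℝ) : lineLift ε a δ (t • ψ) y = t * lineLift ε a δ ψ y := by
  unfold lineLift ext0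
  rw [map_smul]
  split_ifs
  · rfl
  · simp

/-- For fixed ε the lift has bounded support, so its weighted norm is finite. The bound grows
without control as ε → 0 and only starts the halving argument. -/
theorem exists_norm_lineLift_le_weight {ε δ : ℝ} (hε : 0 < ε) (k q R : ℝ) (hk : 0 < k)
    (φ : BddMeas (Metric.ball a δ)) :
    ∃ M, 0 ≤ M ∧ ∀ y, ‖lineLift ε a δ φ y‖ ≤ M * plateauWeight k q R y := by
  obtain ⟨_, M, hM⟩ := φ.2
  refine ⟨|M| * Real.exp (k * (δ / ε) ^ 2), by positivity, fun y => ?_⟩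
  have hw := (plateauWeight_pos k q R y).le
  by_cases hy : |ε * y| < δ
  · rw [lineLift_of_lt ε a δ φ hy]
    have h1 : Real.exp (-k * y ^ 2) ≤ plateauWeight k q R y := by
      unfold plateauWeight
      linarith [lt_min (Real.exp_pos (-k * R ^ 2)) (Real.exp_pos (-q * y ^ 2))]
    have h2 : 1 ≤ Real.exp (k * (δ / ε) ^ 2) * Real.exp (-k * y ^ 2) := by
      rw [← Real.exp_add]
      apply Real.one_le_exp
      have h3 : |y| ≤ δ / ε := by
        rw [le_div_iff₀ hε]; rw [abs_mul, abs_of_pos hε] at hy; linarith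
      have h4 := pow_le_pow_left₀ (abs_nonneg y) h3 2
      rw [sq_abs] at h4
      nlinarith
    calc _ ≤ |M| * 1 := by rw [mul_one]; exact (hM _).trans (le_abs_self M)
      _ ≤ |M| * (Real.exp (k * (δ / ε) ^ 2) * plateauWeight k q R y) := by
          gcongr
          exact h2.trans (by gcongr)
      _ = _ := by ring
  · rw [lineLift_of_ge ε a δ φ (not_lt.1 hy), norm_zero]
    positivity

theorem exists_lineLift_ne_zero {ε δ : ℝ} (hε : 0 < ε) {φ : BddMeas (Metric.ball a δ)}
    (hφ : φ ≠ 0) : ∃ y, lineLift ε a δ φ y ≠ 0 := by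
  by_contra! h
  refine hφ (Subtype.ext (funext fun x => ?_))
  rw [apply_eq_lineLift hε φ x, h]
  rfl

/-- Eigenfunctions of the block operator are close to Hermite functions, and the Jordan chains with
eigenvalues near a given `|c|⁻¹ c⁻ʲ` are one-dimensional. -/
theorem exists_simple_structure {xs : S1} {δ β c r : ℝ} (hxs : S.f xs = xs)
    (ha : S.f a = a) (hc : c = circleDeriv S.f a) (hc1 : 1 < |c|)
    (hconv : ∀ x, x ≠ a → Filter.Tendsto (fun n : ℕ => S.f^[n] x) Filter.atTop (nhds xs))
    (hδ : 0 < δ) (hδπ : δ ≤ Real.pi) (hsep : xs ∉ Metric.ball a δ)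
    (hV : ∃ η > 0, ∀ x, x ∉ Metric.ball a δ → η < Metric.infDist (S.f x) (Metric.ball a δ))
    (hβ : 0 < β) (hβc : c ^ 2 - 1 = 2 * β ^ 2 * S.σ a ^ 2) (hr : 0 < r) :
    ∃ (J : ℕ) (q C ε₀ : ℝ), 0 < q ∧ 0 < C ∧ 0 < ε₀ ∧ ∀ ε, 0 < ε → ε < ε₀ →
      (∀ (φ : BddMeas (Metric.ball a δ)) (μ : ℂ), S.localBlock ε a δ φ = μ • φ → φ ≠ 0 →
        r < ‖μ‖ → ∃ j < J, ‖μ - limitEigenvalue c j‖ ≤ C * ε ∧ ∃ t : ℂ, t ≠ 0 ∧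
          hermiteCoeff β j (lineLift ε a δ (t • φ)) = 1 ∧
          ∀ y, ‖lineLift ε a δ (t • φ) y - scaledHermite β j y‖
            ≤ C * ε * Real.exp (-q * y ^ 2)) ∧
      (∀ j < J, ∀ (φ u : BddMeas (Metric.ball a δ)) (μ μ' b : ℂ), S.localBlock ε a δ φ = μ • φ →
        φ ≠ 0 → r < ‖μ‖ → r < ‖μ'‖ → ‖μ'‖ ≤ 1 → ‖μ - limitEigenvalue c j‖ ≤ C * ε →
        ‖μ' - limitEigenvalue c j‖ ≤ C * ε → S.localBlock ε a δ u = μ' • u + b • φ →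
        ∃ t : ℂ, u = t • φ) := by
  have hσa := S.σ_pos a
  obtain ⟨k, q, ρ, C₁, hk, hq, hqk, hkβ, hcs, hC₁, happ⟩ :=
    S.exists_norm_gaussOp_lineLift_sub_le hxs ha hc hc1 hconv hδ hδπ hsep hV hβ hr
  have hm := one_le_normalExpMoment
  have hm0 : 0 ≤ normalExpMoment := by linarith
  obtain ⟨J, C₂, η₀, g, hC₂, hη₀, hg, hdom⟩ :=
    exists_hermite_dominates (C₀ := normalExpMoment) hc1 hσa hβ hβc hq hkβ hm0 hr
  choose Cm' hCm0' hCm' using fun j =>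
    exists_norm_hermiteCoeff_le c (S.σ a) k normalExpMoment β j hq
  choose Ch' hCh0' hCh' using exists_norm_scaledHermite_le β
  have hbd : ∀ f : ℕ → ℝ, (∀ j, 0 < f j) → ∃ F > 0, ∀ j < J, f j ≤ F := fun f hf =>
    ⟨1 + ∑ j ∈ Finset.range J, f j, by
      have : 0 ≤ ∑ j ∈ Finset.range J, f j := Finset.sum_nonneg fun j _ => (hf j).le
      linarith, fun j hj => by
      have := Finset.single_le_sum (f := f) (fun i _ => (hf i).le) (Finset.mem_range.2 hj)
      linarith⟩
  obtain ⟨Cm, hCm0, hCm⟩ := hbd Cm' hCm0'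
  obtain ⟨Ch, hCh0, hCh⟩ := hbd Ch' hCh0'
  set C₃ : ℝ := Ch + C₂ * η₀ with hC₃
  have hC₃0 : 0 < C₃ := by positivity
  set C₄ : ℝ := 2 * C₁ + 2 * Cm * C₁ * C₃ with hC₄
  have hC₄0 : 0 < C₄ := by positivity
  set C₅ : ℝ := 2 * (C₂ * C₁) with hC₅
  have hC₅0 : 0 < C₅ := by positivity
  -- The bounds on ε make, in turn, the transfer valid, φ and then v approximate eigenfunctions
  -- within η₀, "near λ_j" closer than the gap g, and the φ-term absorbable when it is estimated
  -- through itself.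
  refine ⟨J, q, C₅, min (min 1 (η₀ / C₁)) (min (min (η₀ / C₄) (g / C₅)) (1 / (2 * (Cm * C₁ * C₃)))),
    hq, hC₅0, by positivity, ?_⟩
  clear_value C₃ C₄
  intro ε hε hlt
  obtain ⟨⟨hε1, hε2⟩, ⟨hε3, hε4⟩, hε5⟩ : (ε < 1 ∧ ε < η₀ / C₁) ∧ (ε < η₀ / C₄ ∧ ε < g / C₅) ∧
      ε < 1 / (2 * (Cm * C₁ * C₃)) := by
    simpa only [lt_min_iff] using hlt
  rw [lt_div_iff₀ (by positivity)] at hε2 hε3 hε4 hε5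
  set w := plateauWeight k q (ρ / ε) with hw
  have hadm : AdmissibleWeight c (S.σ a) k q normalExpMoment w :=
    admissibleWeight_plateauWeight (ρ / ε) hk hq hqk hcs hσa.le
  have hwex := fun φ : BddMeas (Metric.ball a δ) =>
    exists_norm_lineLift_le_weight hε k q (ρ / ε) hk φ
  -- an eigenfunction is dominated by one Hermite function
  have hA : ∀ (φ : BddMeas (Metric.ball a δ)) (μ : ℂ), S.localBlock ε a δ φ = μ • φ → φ ≠ 0 →
      r < ‖μ‖ → ∃ j < J, hermiteCoeff β j (lineLift ε a δ φ) ≠ 0 ∧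
        ‖μ - limitEigenvalue c j‖ ≤ C₂ * (C₁ * ε) ∧
        (∀ y, ‖lineLift ε a δ φ y - hermiteCoeff β j (lineLift ε a δ φ) * scaledHermite β j y‖
          ≤ C₂ * (C₁ * ε) * ‖hermiteCoeff β j (lineLift ε a δ φ)‖ * w y) ∧
        ∀ i < J, ‖μ - limitEigenvalue c i‖ < g → i = j := by
    intro φ μ hφ hφ0 hμ
    have hμ1 := S.norm_eigenvalue_le_one hφ hφ0
    refine hdom w hadm _ μ (C₁ * ε) (measurable_lineLift ε a δ φ) (by positivity) (by linarith)
      (hwex φ) (exists_lineLift_ne_zero hε hφ0) hμ hμ1 fun M hM0 hM y => ?_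
    have h1 := happ ε hε hε1.le φ φ μ μ 0 M M hφ (by rw [hφ, zero_smul, add_zero]) hμ hμ1 hμ hμ1
      hM0 hM0 hM hM y
    simpa only [norm_zero, zero_mul, add_zero, sub_zero] using h1
  refine ⟨fun φ μ hφ hφ0 hμ => ?_, fun j hj φ u μ μ' b hφ hφ0 hμ hμ' hμ1' hnear hnear' hu => ?_⟩
  · obtain ⟨j, hj, hmj, h1, h2, _⟩ := hA φ μ hφ hφ0 hμ
    set m := hermiteCoeff β j (lineLift ε a δ φ) with hm_def
    have hmp : 0 < ‖m‖ := norm_pos_iff.2 hmj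
    refine ⟨j, hj, h1.trans ?_, m⁻¹, inv_ne_zero hmj, ?_, fun y => ?_⟩
    · have : 0 ≤ C₂ * C₁ * ε := by positivity
      rw [hC₅]; linarith
    · have : lineLift ε a δ (m⁻¹ • φ) = fun y => m⁻¹ * lineLift ε a δ φ y :=
        funext fun y => lineLift_smul ε a δ φ m⁻¹ y
      rw [this, hermiteCoeff, hermitePairing_const_mul, mul_left_comm, ← hermiteCoeff, ← hm_def,
        inv_mul_cancel₀ hmj]
    · rw [lineLift_smul]
      have e : m⁻¹ * lineLift ε a δ φ y - scaledHermite β j y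
          = m⁻¹ * (lineLift ε a δ φ y - m * scaledHermite β j y) := by field_simp
      rw [e, norm_mul, norm_inv, inv_mul_le_iff₀ hmp]
      calc _ ≤ C₂ * (C₁ * ε) * ‖m‖ * w y := h2 y
        _ ≤ C₂ * (C₁ * ε) * ‖m‖ * (2 * Real.exp (-q * y ^ 2)) := by
            have := hadm.upper y
            gcongr
        _ = _ := by rw [hC₅]; ring
  · have hnear1 : ‖μ - limitEigenvalue c j‖ < g := hnear.trans_lt (by linarith)
    have hnear2 : ‖μ' - limitEigenvalue c j‖ < g := hnear'.trans_lt (by linarith)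
    obtain ⟨i, hi, hmj, _, h2, hgap⟩ := hA φ μ hφ hφ0 hμ
    obtain rfl := hgap j hj hnear1
    have hμ1 := S.norm_eigenvalue_le_one hφ hφ0
    set m := hermiteCoeff β j (lineLift ε a δ φ) with hm_def
    -- This t makes the j-th Hermite coefficient of u - tφ vanish.
    set t : ℂ := m⁻¹ * hermiteCoeff β j (lineLift ε a δ u) with ht
    refine ⟨t, ?_⟩
    by_contra hne
    set v := u - t • φ with hv
    have hv0 : v ≠ 0 := fun h => hne (sub_eq_zero.1 h)
    set d : ℂ := b + t * (μ' - μ) with hd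
    have hTv : S.localBlock ε a δ v = μ' • v + d • φ := by
      rw [hv, map_sub, map_smul, hu, hφ, hd]
      module
    obtain ⟨Mu, hMu0, hMu⟩ := hwex u
    obtain ⟨Mφ, hMφ0, hMφ⟩ := hwex φ
    have hvl : lineLift ε a δ v = fun y => lineLift ε a δ u y - t * lineLift ε a δ φ y :=
      funext fun y => lineLift_sub_smul ε a δ u φ t y
    have hcoeff0 : hermiteCoeff β j (lineLift ε a δ v) = 0 := by
      have e1 := hadm.norm_le_exp hMu0 hMu
      have e2 : ∀ y, ‖t * lineLift ε a δ φ y‖ ≤ (‖t‖ * (2 * Mφ)) * Real.exp (-q * y ^ 2) :=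
        fun y => by
          rw [norm_mul, mul_assoc]
          exact mul_le_mul_of_nonneg_left (hadm.norm_le_exp hMφ0 hMφ y) (norm_nonneg _)
      rw [hvl, hermiteCoeff, hermitePairing_sub β j hq (measurable_lineLift ε a δ u)
        ((measurable_lineLift ε a δ φ).const_mul t) e1 e2, hermitePairing_const_mul, mul_sub,
        mul_left_comm, ← hermiteCoeff, ← hermiteCoeff, ← hm_def, ht, mul_right_comm,
        inv_mul_cancel₀ hmj, one_mul, sub_self]
    -- bound of the eigenfunction by its coefficient
    have hφm : ∀ y, ‖lineLift ε a δ φ y‖ ≤ (‖m‖ * C₃) * w y := by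
      intro y
      have e : lineLift ε a δ φ y = (lineLift ε a δ φ y - m * scaledHermite β j y)
          + m * scaledHermite β j y := by ring
      rw [e]
      refine (norm_add_le _ _).trans ?_
      have h3 : ‖m * scaledHermite β j y‖ ≤ ‖m‖ * (Ch * w y) := by
        rw [norm_mul]
        gcongr
        refine (hCh' j y).trans (mul_le_mul (hCh j hj) (le_trans ?_ (hadm.lower y))
          (Real.exp_pos _).le hCh0.le)
        apply Real.exp_le_exp.2
        nlinarith [sq_nonneg y]
      have hwy := (hadm.pos y).le
      have h4 : C₂ * (C₁ * ε) * ‖m‖ * w y ≤ C₂ * η₀ * ‖m‖ * w y := by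
        gcongr
        linarith
      calc _ ≤ C₂ * η₀ * ‖m‖ * w y + ‖m‖ * (Ch * w y) := add_le_add ((h2 y).trans h4) h3
        _ = _ := by rw [hC₃]; ring
    have hstep : ∀ M, 0 ≤ M → (∀ y, ‖lineLift ε a δ v y‖ ≤ M * w y) →
        ∀ y, ‖gaussOp c (S.σ a) (lineLift ε a δ v) y - μ' * lineLift ε a δ v y‖
          ≤ C₄ * ε * M * w y := by
      intro M hM0 hM
      have h3 := happ ε hε hε1.le φ v μ μ' d (‖m‖ * C₃) M hφ hTv hμ hμ1 hμ' hμ1' (by positivity)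
        hM0 hφm hM
      set X : ℝ := ‖d‖ * ‖m‖ with hX
      have hX0 : 0 ≤ X := by positivity
      have hdX : ‖d‖ * (‖m‖ * C₃) = X * C₃ := by rw [hX]; ring
      rw [hdX] at h3
      have h4 := hCm' j w hadm _ (C₁ * ε * (M + X * C₃)) (by positivity) h3
      -- The v-terms drop out since v has no j-th coefficient, so the residual of the chain equation
      -- sees exactly -d m. This is what bounds the unknown d.
      have h5 : hermiteCoeff β j (fun y => gaussOp c (S.σ a) (lineLift ε a δ v) y
          - μ' * lineLift ε a δ v y - d * lineLift ε a δ φ y) = -(d * m) := by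
        have e0 := hermiteCoeff_gaussOp_sub hc1 hσa hβ hβc j hq hm0 hadm
          (measurable_lineLift ε a δ v) hM0 hM μ'
        rw [hcoeff0, mul_zero] at e0
        have e1 : ∀ y, ‖gaussOp c (S.σ a) (lineLift ε a δ v) y - μ' * lineLift ε a δ v y‖
            ≤ (normalExpMoment * M + ‖μ'‖ * M) * w y := fun y => by
          refine (norm_sub_le _ _).trans ?_
          rw [norm_mul, add_mul, mul_assoc ‖μ'‖]
          exact add_le_add (hadm.norm_gaussOp_le hq.le hM0 hM y)
            (mul_le_mul_of_nonneg_left (hM y) (norm_nonneg _))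
        have e2 : ∀ y, ‖d * lineLift ε a δ φ y‖ ≤ (‖d‖ * (2 * Mφ)) * Real.exp (-q * y ^ 2) :=
          fun y => by
            rw [norm_mul, mul_assoc]
            exact mul_le_mul_of_nonneg_left (hadm.norm_le_exp hMφ0 hMφ y) (norm_nonneg _)
        rw [hermiteCoeff, hermitePairing_sub β j hq
          (u := fun y => gaussOp c (S.σ a) (lineLift ε a δ v) y - μ' * lineLift ε a δ v y)
          ((measurable_gaussOp _ _ (measurable_lineLift ε a δ v)).sub
            ((measurable_lineLift ε a δ v).const_mul μ'))
          ((measurable_lineLift ε a δ φ).const_mul d)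
          (hadm.norm_le_exp (by positivity) e1) e2, hermitePairing_const_mul, mul_sub,
          ← hermiteCoeff, e0, mul_left_comm, ← hermiteCoeff, ← hm_def, zero_sub]
      rw [h5, norm_neg, norm_mul, ← hX] at h4
      -- X = |d m| also occurs in its own bound, with a factor at most 1/2, and is absorbed.
      have h6 : X ≤ 2 * Cm * C₁ * ε * M := by
        have h7 : X ≤ Cm * (C₁ * ε * (M + X * C₃)) :=
          h4.trans (mul_le_mul_of_nonneg_right (hCm j hj) (by positivity))
        have h8 : Cm * C₁ * C₃ * ε * X ≤ 1 / 2 * X :=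
          mul_le_mul_of_nonneg_right (by linarith) hX0
        linarith
      intro y
      have hwy := (hadm.pos y).le
      have e : gaussOp c (S.σ a) (lineLift ε a δ v) y - μ' * lineLift ε a δ v y
          = (gaussOp c (S.σ a) (lineLift ε a δ v) y - μ' * lineLift ε a δ v y
            - d * lineLift ε a δ φ y) + d * lineLift ε a δ φ y := by ring
      rw [e]
      refine (norm_add_le _ _).trans ?_
      have h7 : ‖d * lineLift ε a δ φ y‖ ≤ X * C₃ * w y := by
        rw [norm_mul, ← hdX, mul_assoc]
        exact mul_le_mul_of_nonneg_left (hφm y) (norm_nonneg _)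
      have h8 : X * C₃ ≤ 2 * Cm * C₁ * ε * M * C₃ := mul_le_mul_of_nonneg_right h6 hC₃0.le
      have h9 : 2 * Cm * C₁ * ε * M * C₃ ≤ M := by
        calc 2 * Cm * C₁ * ε * M * C₃ = (ε * (2 * (Cm * C₁ * C₃))) * M := by ring
          _ ≤ 1 * M := mul_le_mul_of_nonneg_right hε5.le hM0
          _ = M := one_mul M
      calc _ ≤ C₁ * ε * (M + X * C₃) * w y + X * C₃ * w y := add_le_add (h3 y) h7
        _ ≤ C₁ * ε * (M + M) * w y + 2 * Cm * C₁ * ε * M * C₃ * w y := by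
            gcongr
            exact h8.trans h9
        _ = C₄ * ε * M * w y := by rw [hC₄]; ring
    obtain ⟨i, hi, hmi, _, _, hgap'⟩ := hdom w hadm (lineLift ε a δ v) μ' (C₄ * ε)
      (measurable_lineLift ε a δ v) (by positivity) (by linarith) (hwex v)
      (exists_lineLift_ne_zero hε hv0) hμ' hμ1' hstep
    rw [← hgap' j hj hnear2] at hmi
    exact hmi hcoeff0

end NoisyCircleMap

end

/-! ### Conclusion -/

theorem isSimpleEigenvalue_of_chain {E : Type} [AddCommGroup E] [Module ℂ E] {T : Module.End ℂ E}
    {μ : ℂ} {φ : E} (hφ : T φ = μ • φ) (hφ0 : φ ≠ 0)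
    (h : ∀ (u : E) (b : ℂ), T u = μ • u + b • φ → ∃ t : ℂ, u = t • φ) :
    IsSimpleEigenvalue T μ := by
  have hev : T.HasEigenvector μ φ := ⟨Module.End.mem_eigenspace_iff.2 hφ, hφ0⟩
  refine ⟨Module.End.hasEigenvalue_of_hasEigenvector hev, ?_⟩
  -- If (T - μ)^{n+1} v = 0, then by induction (T - μ) v = b φ, so v is a chain of length at most
  -- two and hence a multiple of φ.
  have hpow : ∀ (n : ℕ) (v : E), ((T - μ • (1 : Module.End ℂ E)) ^ n) v = 0 →
      ∃ t : ℂ, v = t • φ := by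
    intro n
    induction n with
    | zero => exact fun v hv => ⟨0, by simpa using hv⟩
    | succ n ih =>
      intro v hv
      rw [pow_succ, Module.End.mul_apply] at hv
      obtain ⟨b, hb⟩ := ih _ hv
      refine h v b ?_
      rw [← hb]
      simp
  have : T.maxGenEigenspace μ = Submodule.span ℂ {φ} := by
    ext v
    rw [Module.End.mem_maxGenEigenspace, Submodule.mem_span_singleton]
    constructor
    · rintro ⟨n, hn⟩
      obtain ⟨t, ht⟩ := hpow n v hn
      exact ⟨t, ht.symm⟩
    · rintro ⟨t, rfl⟩
      exact ⟨1, by simp [hφ]⟩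
  rw [this, finrank_span_singleton hφ0]

theorem le_pi_of_notMem_ball {x a : S1} {δ : ℝ} (h : x ∉ Metric.ball a δ) : δ ≤ Real.pi := by
  have h1 := AddCircle.norm_le_half_period (2 * Real.pi) Real.two_pi_pos.ne' (x := x - a)
  rw [abs_of_pos Real.two_pi_pos, mul_div_cancel_left₀ _ two_ne_zero] at h1
  rw [Metric.mem_ball, not_lt, dist_eq_norm] at h
  exact h.trans h1

theorem theorem6 (S : NoisyCircleMap) (xs xu : S1)
    -- `xs` is a stable fixed point, `xu` an unstable one, and all other orbits converge to `xs`
    (hxs : S.f xs = xs) (hxu : S.f xu = xu)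
    (hcs : |circleDeriv S.f xs| < 1) (hcu : 1 < |circleDeriv S.f xu|)
    (hconv : ∀ x, x ≠ xu → Filter.Tendsto (fun n : ℕ => S.f^[n] x) Filter.atTop (nhds xs))
    -- the neighbourhood `V₁` of `xu`: a ball missing `xs` that no point outside it comes close to
    (δ : ℝ) (hδ : 0 < δ) (hsep : xs ∉ Metric.ball xu δ)
    (hV : ∃ η > 0, ∀ x, x ∉ Metric.ball xu δ → η < Metric.infDist (S.f x) (Metric.ball xu δ))
    (c β : ℝ) (hc : c = circleDeriv S.f xu)
    (hβ : β = Real.sqrt ((c ^ 2 - 1) / (2 * S.σ xu ^ 2)))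
    (r : ℝ) (hr : 0 < r) :
    ∃ ε₀ > 0, ∃ L > 0, ∃ K > 0, ∃ k > 0, ∀ ε : ℝ, 0 < ε → ε < ε₀ →
      ∃ (l : ℕ → ℂ) (ψ : ℕ → ℝ → ℂ),
        (∀ j, ‖l j‖ ≤ L) ∧
        (∀ j y, ‖ψ j y‖ * Real.exp (k * y ^ 2) ≤ K) ∧
        ∀ μ : ℂ, r < ‖μ‖ → (S.localBlock ε xu δ).HasEigenvalue μ →
          IsSimpleEigenvalue (S.localBlock ε xu δ) μ ∧
          ∃ j : ℕ, μ = ((|c|⁻¹ * (c ^ j)⁻¹ : ℝ) : ℂ) + (ε : ℂ) * l j ∧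
            ∀ φ : BddMeas (Metric.ball xu δ), S.localBlock ε xu δ φ = μ • φ →
              ∃ a : ℂ, ∀ x : Metric.ball xu δ,
                φ.1 x = a * ((hermiteFun j (β * signedRep (x.1 - xu) / ε) : ℂ)
                  + (ε : ℂ) * ψ j (signedRep (x.1 - xu) / ε)) := by
  have hc1 : 1 < |c| := hc ▸ hcu
  have hc2 : 0 < c ^ 2 - 1 := sub_pos.2 ((one_lt_sq_iff_one_lt_abs c).2 hc1)
  have hσ := S.σ_pos xu
  have hβ0 : 0 < β := hβ ▸ Real.sqrt_pos.2 (by positivity)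
  have hβc : c ^ 2 - 1 = 2 * β ^ 2 * S.σ xu ^ 2 := by
    rw [hβ, Real.sq_sqrt (by positivity)]
    field_simp
  obtain ⟨J, q, C, ε₀, hq, hC, hε₀, H⟩ := S.exists_simple_structure hxs hxu hc hc1 hconv hδ
    (le_pi_of_notMem_ball hsep) hsep hV hβ0 hβc hr
  refine ⟨ε₀, hε₀, C, hC, C, hC, q, hq, fun ε hε hlt => ?_⟩
  obtain ⟨HA, HC⟩ := H ε hε hlt
  have hεc : (ε : ℂ) ≠ 0 := Complex.ofReal_ne_zero.2 hε.ne'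
  set T := S.localBlock ε xu δ with hT
  -- normalised eigenfunctions near the `j`-th Hermite function
  let E : ℕ → BddMeas (Metric.ball xu δ) → ℂ → Prop := fun j φ μ =>
    j < J ∧ T φ = μ • φ ∧ φ ≠ 0 ∧ r < ‖μ‖ ∧ ‖μ - limitEigenvalue c j‖ ≤ C * ε ∧
      hermiteCoeff β j (NoisyCircleMap.lineLift ε xu δ φ) = 1 ∧
      ∀ y, ‖NoisyCircleMap.lineLift ε xu δ φ y - scaledHermite β j y‖ ≤ C * ε * Real.exp (-q * y ^ 2)
  -- The chain property with b = 0 compares two different eigenvalues near the same λ_j. So at most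
  -- one normalised pair belongs to each j, and the corrections l and ψ can depend on j and ε alone.
  have hchain : ∀ j φ μ φ' μ', E j φ μ → E j φ' μ' → φ' = φ ∧ μ' = μ := by
    rintro j φ μ φ' μ' ⟨hj, h1, h2, h3, h4, h5, -⟩ ⟨-, h1', h2', h3', h4', h5', -⟩
    obtain ⟨t, rfl⟩ := HC j hj φ φ' μ μ' 0 h1 h2 h3 h3' (S.norm_eigenvalue_le_one h1' h2') h4 h4'
      (by rw [zero_smul, add_zero, h1'])
    have e : NoisyCircleMap.lineLift ε xu δ (t • φ) = fun y => t * NoisyCircleMap.lineLift ε xu δ φ y :=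
      funext fun y => NoisyCircleMap.lineLift_smul ε xu δ φ t y
    have ht : t = 1 := by
      rw [e, hermiteCoeff, hermitePairing_const_mul, mul_left_comm, ← hermiteCoeff, h5,
        mul_one] at h5'
      exact h5'
    rw [ht, one_smul] at h1' ⊢
    refine ⟨rfl, smul_left_injective ℂ h2 ?_⟩
    exact h1'.symm.trans h1
  have hdata : ∀ j, ∃ (l : ℂ) (ψ : ℝ → ℂ), ‖l‖ ≤ C ∧ (∀ y, ‖ψ y‖ * Real.exp (q * y ^ 2) ≤ C) ∧
      ∀ φ μ, E j φ μ → μ = limitEigenvalue c j + ε * l ∧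
        ∀ y, NoisyCircleMap.lineLift ε xu δ φ y = scaledHermite β j y + ε * ψ y := by
    intro j
    by_cases hex : ∃ φ μ, E j φ μ
    · obtain ⟨φ, μ, h⟩ := hex
      refine ⟨(μ - limitEigenvalue c j) / ε,
        fun y => (NoisyCircleMap.lineLift ε xu δ φ y - scaledHermite β j y) / ε, ?_, fun y => ?_,
        fun φ' μ' h' => ?_⟩
      · rw [norm_div, Complex.norm_real, Real.norm_of_nonneg hε.le, div_le_iff₀ hε]
        exact h.2.2.2.2.1
      · have h6 := h.2.2.2.2.2.2 y
        rw [norm_div, Complex.norm_real, Real.norm_of_nonneg hε.le, div_mul_eq_mul_div,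
          div_le_iff₀ hε]
        refine (mul_le_mul_of_nonneg_right h6 (Real.exp_pos _).le).trans_eq ?_
        rw [mul_assoc, ← Real.exp_add, neg_mul, neg_add_cancel, Real.exp_zero, mul_one]
      · obtain ⟨rfl, rfl⟩ := hchain j φ μ φ' μ' h h'
        constructor
        · field_simp; ring
        · intro y; field_simp; ring
    -- If no eigenvalue belongs to j, in particular for j ≥ J, nothing is required beyond the
    -- bounds, and zero satisfies them.
    · refine ⟨0, 0, by simpa using hC.le, fun y => by simpa using hC.le, fun φ μ h => ?_⟩
      exact (hex ⟨φ, μ, h⟩).elim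
  choose l ψ hl hψ hlψ using hdata
  refine ⟨l, ψ, hl, hψ, fun μ hμ hev => ?_⟩
  obtain ⟨φ₀, hφ₀⟩ := hev.exists_hasEigenvector
  have hφ₀1 : T φ₀ = μ • φ₀ := hφ₀.apply_eq_smul
  obtain ⟨j, hj, hnear, t, ht, hcoeff, hclose⟩ := HA φ₀ μ hφ₀1 hφ₀.2 hμ
  set φ := t • φ₀ with hφ
  have hφ0 : φ ≠ 0 := smul_ne_zero ht hφ₀.2
  have hφ1 : T φ = μ • φ := by rw [hφ, map_smul, hφ₀1, smul_comm]
  have hμ1 := S.norm_eigenvalue_le_one hφ1 hφ0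
  have hline : ∀ (u : BddMeas (Metric.ball xu δ)) (b : ℂ), T u = μ • u + b • φ →
      ∃ t : ℂ, u = t • φ :=
    fun u b hu => HC j hj φ u μ μ b hφ1 hφ0 hμ hμ hμ1 hnear hnear hu
  obtain ⟨h1, h2⟩ := hlψ j φ μ ⟨hj, hφ1, hφ0, hμ, hnear, hcoeff, hclose⟩
  refine ⟨isSimpleEigenvalue_of_chain hφ1 hφ0 hline, j, h1, fun φ' hφ' => ?_⟩
  -- An arbitrary eigenfunction for μ is a chain with b = 0, so the same uniqueness makes it a
  -- multiple of φ.
  obtain ⟨s, rfl⟩ := hline φ' 0 (by rw [hφ', zero_smul, add_zero])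
  refine ⟨s, fun x => ?_⟩
  have h3 : (s • φ).1 x = s * φ.1 x := rfl
  rw [h3, NoisyCircleMap.apply_eq_lineLift hε φ x, h2, scaledHermite, mul_div_assoc]
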